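/- Let $X$ be a complex manifold of dimension $3$, let $\Omega$ be a nowhere vanishing holomorphic $(3,0)$-form on $X$, let $\alpha'\in\mathbb R$, and let $\Phi(t)$, $0\le t<T$, be a given family of smooth closed $(2,2)$-forms. For a Hermitian metric $\omega=i\,g_{\bar kj}\,dz^j\wedge d\bar z^k$ let $\|\Omega\|_\omega$ be defined by $i\,\Omega\wedge\bar\Omega=\|\Omega\|_\omega^2\,\omega^3$. Let $\omega(t)$, $0\le t<T$, be a smooth solution of the Anomaly flow $$\partial_t(\|\Omega\|_\omega\,\omega^2)=\Psi,\qquad \Psi=i\partial\bar\partial\omega-\alpha'\big({\rm Tr}(Rm\wedge Rm)-\Phi(t)\big),\qquad \omega(0)=\omega_0,$$ whose initial metric $\omega_0$ is conformally balanced, $d(\|\Omega\|_{\omega_0}\,\omega_0^2)=0$. Conventions. $\nabla$ is the Chern connection, $\nabla_mV^p=\partial_mV^p+g^{p\bar q}\partial_mg_{\bar qr}V^r$, $\nabla_{\bar m}V^p=\partial_{\bar m}V^p$, and $\Delta=g^{j\bar k}\nabla_j\nabla_{\bar k}$. Its curvature is $Rm=R_{\bar kj}{}^p{}_q\,dz^j\wedge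 d\bar z^k$ with $R_{\bar kj}{}^p{}_q=-\partial_{\bar k}(g^{p\bar\ell}\partial_jg_{\bar\ell q})$, and $R_{\bar kj}=R_{\bar kj}{}^p{}_p$, $R'_{\bar kj}=R_{\bar kp}{}^p{}_j$. The torsion is $T_{\bar kjm}=\partial_jg_{\bar km}-\partial_mg_{\bar kj}$, $\bar T_{k\bar j\bar m}=\partial_{\bar j}g_{\bar mk}-\partial_{\bar m}g_{\bar jk}$, with $T_m=g^{j\bar k}T_{\bar kjm}$, $\bar T_{\bar m}=g^{k\bar j}\bar T_{k\bar j\bar m}$, $T^r{}_{jm}=g^{r\bar k}T_{\bar kjm}$, $\bar T^{\bar r}{}_{\bar j\bar m}=g^{k\bar r}\bar T_{k\bar j\bar m}$ and $(T\bar T)_{\bar kj}=g^{s\bar r}g^{m\bar\ell}T_{\bar rmj}\bar T_{s\bar\ell\bar k}$. A $(2,2)$-form is written $\eta=\frac14\sum\eta_{\bar ps\bar rq}\,dz^q\wedge d\bar z^r\wedge dz^s\wedge d\bar z^p$ with $\eta_{\bar ps\bar rq}$ anti-symmetric in $\bar p,\bar r$ and in $s,q$; $\Psi_{\bar pq}=g^{s\bar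 r}\Psi_{\bar ps\bar rq}$, $\Phi_{\bar pq}=g^{s\bar r}\Phi_{\bar ps\bar rq}$, $\Psi^\rho{}_\lambda=g^{\rho\bar\mu}\Psi_{\bar\mu\lambda}$. Indices are raised and lowered with $g$, each keeping its position, e.g. $R_{\bar kj\bar\ell m}=g_{\bar\ell p}R_{\bar kj}{}^p{}_m$, $R^s{}_j{}^p{}_q=g^{s\bar\gamma}R_{\bar\gamma j}{}^p{}_q$, $\nabla^{\bar\gamma}=g^{s\bar\gamma}\nabla_s$. For an expression $c_{\bar\mu s\bar r\lambda}$, brackets denote anti-symmetrization, without numerical factor, separately in the barred indices $\bar\mu,\bar r$ and in the unbarred indices $s,\lambda$: $\{c_{\bar\mu s\bar r\lambda}\}_{\rm alt}=c_{\bar\mu s\bar r\lambda}-c_{\bar rs\bar\mu\lambda}-c_{\bar\mu\lambda\bar rs}+c_{\bar r\lambda\bar\mu s}$. Then, in every holomorphic coordinate system and for all $t\in[0,T)$ (with the one-sided derivative at $t=0$), the curvature of $\omega(t)$ satisfies $$\begin{aligned} \partial_tR_{\bar kj}{}^\rho{}_\lambda=\frac1{2\|\Omega\|_\omega}\Big[&\Delta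 R_{\bar kj}{}^\rho{}_\lambda+2\alpha'g^{\rho\bar\mu}g^{s\bar r}\big\{R_{\bar r\lambda}{}^\beta{}_\alpha\nabla_s\nabla_{\bar\mu}R_{\bar kj}{}^\alpha{}_\beta\big\}_{\rm alt}\\ &+\bar T_{\bar k}\nabla_j\Psi^\rho{}_\lambda+T_j\nabla_{\bar k}\Psi^\rho{}_\lambda+\big(\tfrac12R_{\bar kj}-T_j\bar T_{\bar k}\big)\Psi^\rho{}_\lambda\\ &-g^{\rho\bar\mu}\nabla_{\bar k}\nabla_j\big((T\bar T)_{\bar\mu\lambda}+\alpha'\Phi_{\bar\mu\lambda}\big)\\ &+\nabla_{\bar k}(T^r{}_{sj}R^s{}_r{}^\rho{}_\lambda)+\nabla^{\bar\gamma}(\bar T^{\bar r}{}_{\bar\gamma\bar k}R_{\bar rj}{}^\rho{}_\lambda)-R'_{\bar k}{}^{\bar\kappa}R_{\bar\kappa j}{}^\rho{}_\lambda\\ &+R_{\bar ks}{}^\kappa{}_jR^s{}_\kappa{}^\rho{}_\lambda-R_{\bar ks}{}^{\rho\bar\kappa}R^s{}_{j\bar\kappa\lambda}+R_{\bar ks}{}^\kappa{}_\lambda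 R^s{}_j{}^\rho{}_\kappa\\ &+\alpha'g^{\rho\bar\mu}g^{s\bar r}\big\{\nabla_jR_{\bar\mu s}{}^\alpha{}_\beta\nabla_{\bar k}R_{\bar r\lambda}{}^\beta{}_\alpha+\nabla_{\bar k}R_{\bar\mu s}{}^\alpha{}_\beta\nabla_jR_{\bar r\lambda}{}^\beta{}_\alpha\big\}_{\rm alt}\\ &+2\alpha'g^{\rho\bar\mu}g^{s\bar r}\big\{R_{\bar r\lambda}{}^{\beta\bar\delta}\big(\nabla_{\bar k}(T^\gamma{}_{sj}R_{\bar\mu\gamma\bar\delta\beta})+\nabla_s(\bar T^{\bar\gamma}{}_{\bar\mu\bar k}R_{\bar\gamma j\bar\delta\beta})-R_{\bar ks\bar\mu}{}^{\bar\kappa}R_{\bar\kappa j\bar\delta\beta}\\ &\qquad+R_{\bar ks}{}^\kappa{}_jR_{\bar\mu\kappa\bar\delta\beta}-R_{\bar ks\bar\delta}{}^{\bar\kappa}R_{\bar\mu j\bar\kappa\beta}+R_{\bar ks}{}^\kappa{}_\beta R_{\bar\mu j\bar\delta\kappa}\big)\big\}_{\rm alt}\Big]. \end{aligned}$$ -/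

import Mathlib

open scoped Manifold ContDiff BigOperators

noncomputable section

namespace AnomalyFlow

/-- The model space `ℂ³` of a complex threefold. -/
abbrev C3 : Type := EuclideanSpace ℂ (Fin 3)

/-! ### Tensor fields in a holomorphic coordinate system

Everything in this part lives on (an open subset of) `ℂ³` with coordinates `z¹, z², z³`.
A barred index is an index of `Fin 3` like any other; which slots are barred is recorded by
the order of the indices, in the way the names of the definitions indicate. -/

/-- `∂_j f = (∂f/∂x^j - i ∂f/∂y^j) / 2`. -/
def dz (j : Fin 3) (f : C3 → ℂ) (z : C3) : ℂ :=
  (fderiv ℝ f z (EuclideanSpace.single j 1)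
    - Complex.I * fderiv ℝ f z (EuclideanSpace.single j Complex.I)) / 2

/-- `∂_{j̄} f = (∂f/∂x^j + i ∂f/∂y^j) / 2`. -/
def dzbar (j : Fin 3) (f : C3 → ℂ) (z : C3) : ℂ :=
  (fderiv ℝ f z (EuclideanSpace.single j 1)
    + Complex.I * fderiv ℝ f z (EuclideanSpace.single j Complex.I)) / 2

/-- The components of a tensor field with `n` slots: `A z ![i₁, …, iₙ]`. -/
abbrev TField (n : ℕ) : Type := C3 → (Fin n → Fin 3) → ℂ

/-- The components `g_{k̄j}` of a Hermitian metric: `g z k j`. -/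
abbrev MetricField : Type := C3 → Matrix (Fin 3) (Fin 3) ℂ

/-- Anti-symmetrization, without numerical factor, separately in the barred indices `p, r` and in
the unbarred indices `s, q`:
`c_{[p̄ s r̄ q]} = c_{p̄sr̄q} - c_{r̄sp̄q} - c_{p̄qr̄s} + c_{r̄qp̄s}`. -/
def alt22 (c : Fin 3 → Fin 3 → Fin 3 → Fin 3 → ℂ) (p s r q : Fin 3) : ℂ :=
  c p s r q - c r s p q - c p q r s + c r q p s

/-- The components of the wedge product of two `(1,1)`-forms `a = a_{k̄j} dz^j ∧ dz̄^k` and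
`b = b_{k̄j} dz^j ∧ dz̄^k`. The components of a `(2,2)`-form `η` are the coefficients `η_{p̄sr̄q}`,
anti-symmetric in `p, r` and in `s, q`, with
`η = (1/4) ∑ η_{p̄sr̄q} dz^q ∧ dz̄^r ∧ dz^s ∧ dz̄^p`. -/
def wedge11 (a b : TField 2) : TField 4 := fun z I =>
  alt22 (fun p s r q => a z ![r, q] * b z ![p, s]) (I 0) (I 1) (I 2) (I 3)

/-- The components of the `(2,2)`-form `∂∂̄a`, for a `(1,1)`-form `a = a_{k̄j} dz^j ∧ dz̄^k`. -/
def ddbar11 (a : TField 2) : TField 4 := fun z I =>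
  alt22 (fun p s r q => dz q (dzbar r (fun y => a y ![p, s])) z) (I 0) (I 1) (I 2) (I 3)

/-- `dη = 0` on `U` for a `(2,2)`-form with components `η_{p̄sr̄q}`: both `∂η` and `∂̄η` vanish. -/
def IsClosed22On (η : TField 4) (U : Set C3) : Prop :=
  (∀ z ∈ U, ∀ p r a s q : Fin 3,
    dz a (fun y => η y ![p, s, r, q]) z + dz s (fun y => η y ![p, q, r, a]) z
      + dz q (fun y => η y ![p, a, r, s]) z = 0) ∧
  (∀ z ∈ U, ∀ s q a p r : Fin 3,
    dzbar a (fun y => η y ![p, s, r, q]) z + dzbar p (fun y => η y ![r, s, a, q]) z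
      + dzbar r (fun y => η y ![a, s, p, q]) z = 0)

/-! ### The metric, the Chern connection, its torsion and its curvature -/

/-- `g^{jk̄}`, with `∑_k g^{jk̄} g_{k̄m} = δ^j_m`. -/
def ginv (g : MetricField) (z : C3) (j k : Fin 3) : ℂ := (g z)⁻¹ j k

/-- The components of `ω = i g_{k̄j} dz^j ∧ dz̄^k`. -/
def omega (g : MetricField) : TField 2 := fun z I => Complex.I * g z (I 0) (I 1)

/-- The Chern connection `A_{mq}^p = g^{pl̄} ∂_m g_{l̄q}`, as `Gam g z m p q`, so that
`∇_m V^p = ∂_m V^p + A_{mq}^p V^q` and `∇_{m̄} V^p = ∂_{m̄} V^p`. -/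
def Gam (g : MetricField) (z : C3) (m p q : Fin 3) : ℂ :=
  ∑ l, ginv g z p l * dz m (fun y => g y l q) z

/-- The curvature `R_{k̄j}{}^p{}_q = - ∂_{k̄} A_{jq}^p`, as `Rm g z ![k, j, p, q]`. -/
def Rm (g : MetricField) : TField 4 := fun z I =>
  - dzbar (I 0) (fun y => Gam g y (I 1) (I 2) (I 3)) z

/-- `R_{k̄jl̄m} = g_{l̄p} R_{k̄j}{}^p{}_m`. -/
def RmLow (g : MetricField) : TField 4 := fun z I =>
  ∑ p, g z (I 2) p * Rm g z ![I 0, I 1, p, I 3]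

/-- `R^s{}_j{}^p{}_q = g^{sγ̄} R_{γ̄j}{}^p{}_q`. -/
def RmUp (g : MetricField) : TField 4 := fun z I =>
  ∑ γ, ginv g z (I 0) γ * Rm g z ![γ, I 1, I 2, I 3]

/-- `R^s{}_{jl̄m} = g^{sγ̄} R_{γ̄jl̄m}`. -/
def RmLowUp (g : MetricField) : TField 4 := fun z I =>
  ∑ γ, ginv g z (I 0) γ * RmLow g z ![γ, I 1, I 2, I 3]

/-- `R_{k̄j}{}^{pκ̄} = R_{k̄j}{}^p{}_q g^{qκ̄}`, as `RmUpUp g z ![k, j, p, κ]`. -/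
def RmUpUp (g : MetricField) : TField 4 := fun z I =>
  ∑ q, Rm g z ![I 0, I 1, I 2, q] * ginv g z q (I 3)

/-- `R_{k̄jl̄}{}^{κ̄} = R_{k̄jl̄q} g^{qκ̄}`, as `RmBar g z ![k, j, l, κ]`. -/
def RmBar (g : MetricField) : TField 4 := fun z I =>
  ∑ q, RmLow g z ![I 0, I 1, I 2, q] * ginv g z q (I 3)

/-- The Ricci tensor `R_{k̄j} = R_{k̄j}{}^p{}_p`. -/
def Ric (g : MetricField) : TField 2 := fun z I => ∑ p, Rm g z ![I 0, I 1, p, p]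

/-- The Ricci tensor `R'_{k̄j} = R_{k̄p}{}^p{}_j`. -/
def RicPrime (g : MetricField) : TField 2 := fun z I => ∑ p, Rm g z ![I 0, p, p, I 1]

/-- `R'_{k̄}{}^{κ̄} = R'_{k̄q} g^{qκ̄}`. -/
def RicPrimeUp (g : MetricField) : TField 2 := fun z I =>
  ∑ q, RicPrime g z ![I 0, q] * ginv g z q (I 1)

/-- The torsion `T_{k̄jm} = ∂_j g_{k̄m} - ∂_m g_{k̄j}`. -/
def Tor (g : MetricField) : TField 3 := fun z I =>
  dz (I 1) (fun y => g y (I 0) (I 2)) z - dz (I 2) (fun y => g y (I 0) (I 1)) z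

/-- The conjugate torsion `T̄_{kj̄m̄} = ∂_{j̄} g_{m̄k} - ∂_{m̄} g_{j̄k}`. -/
def TorBar (g : MetricField) : TField 3 := fun z I =>
  dzbar (I 1) (fun y => g y (I 2) (I 0)) z - dzbar (I 2) (fun y => g y (I 1) (I 0)) z

/-- `T^r{}_{jm} = g^{rk̄} T_{k̄jm}`. -/
def TorUp (g : MetricField) : TField 3 := fun z I =>
  ∑ k, ginv g z (I 0) k * Tor g z ![k, I 1, I 2]

/-- `T̄^{r̄}{}_{j̄m̄} = g^{kr̄} T̄_{kj̄m̄}`. -/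
def TorBarUp (g : MetricField) : TField 3 := fun z I =>
  ∑ k, ginv g z k (I 0) * TorBar g z ![k, I 1, I 2]

/-- `T_m = g^{jk̄} T_{k̄jm}`. -/
def TorTr (g : MetricField) (z : C3) (m : Fin 3) : ℂ :=
  ∑ j, ∑ k, ginv g z j k * Tor g z ![k, j, m]

/-- `T̄_{m̄} = g^{kj̄} T̄_{kj̄m̄}`. -/
def TorBarTr (g : MetricField) (z : C3) (m : Fin 3) : ℂ :=
  ∑ j, ∑ k, ginv g z k j * TorBar g z ![k, j, m]

/-- `(TT̄)_{k̄j} = g^{sr̄} g^{ml̄} T_{r̄mj} T̄_{sl̄k̄}`. -/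
def TT (g : MetricField) : TField 2 := fun z I =>
  ∑ s, ∑ r, ∑ m, ∑ l, ginv g z s r * ginv g z m l
    * Tor g z ![r, m, I 1] * TorBar g z ![s, l, I 0]

/-! ### Covariant derivatives of arbitrary tensors -/

/-- The type of a tensor slot: lower or upper, unbarred or barred. -/
inductive Slot : Type
  | lo
  | up
  | loBar
  | upBar

/-- `∇_m` of a tensor field with slots `σ`; the new index `m` is the first index of the result. -/
def nabla (g : MetricField) {n : ℕ} (σ : Fin n → Slot) (A : TField n) : TField (n + 1) := fun z J =>
  dz (J 0) (fun y => A y (Fin.tail J)) z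
    + ∑ i : Fin n, match σ i with
      | Slot.lo => - ∑ r, Gam g z (J 0) r (Fin.tail J i) * A z (Function.update (Fin.tail J) i r)
      | Slot.up => ∑ r, Gam g z (J 0) (Fin.tail J i) r * A z (Function.update (Fin.tail J) i r)
      | Slot.loBar => 0
      | Slot.upBar => 0

/-- `∇_{m̄}` of a tensor field with slots `σ`; the new index `m̄` is the first index of the result.
The connection acts on barred slots by the complex conjugates of the coefficients `A_{mq}^p`. -/
def nablaBar (g : MetricField) {n : ℕ} (σ : Fin n → Slot) (A : TField n) : TField (n + 1) :=
  fun z J =>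
  dzbar (J 0) (fun y => A y (Fin.tail J)) z
    + ∑ i : Fin n, match σ i with
      | Slot.lo => 0
      | Slot.up => 0
      | Slot.loBar =>
        - ∑ r, star (Gam g z (J 0) r (Fin.tail J i)) * A z (Function.update (Fin.tail J) i r)
      | Slot.upBar =>
        ∑ r, star (Gam g z (J 0) (Fin.tail J i) r) * A z (Function.update (Fin.tail J) i r)

/-- The slots of `R_{k̄j}{}^p{}_q`. -/
abbrev rmSlots : Fin 4 → Slot := ![Slot.loBar, Slot.lo, Slot.up, Slot.lo]

/-- `∇_m R_{k̄j}{}^p{}_q`, as `dRm g z ![m, k, j, p, q]`. -/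
def dRm (g : MetricField) : TField 5 := nabla g rmSlots (Rm g)

/-- `∇_{m̄} R_{k̄j}{}^p{}_q`, as `dbarRm g z ![m, k, j, p, q]`. -/
def dbarRm (g : MetricField) : TField 5 := nablaBar g rmSlots (Rm g)

/-- `∇_s ∇_{m̄} R_{k̄j}{}^p{}_q`, as `ddbarRm g z ![s, m, k, j, p, q]`. -/
def ddbarRm (g : MetricField) : TField 6 :=
  nabla g ![Slot.loBar, Slot.loBar, Slot.lo, Slot.up, Slot.lo] (dbarRm g)

/-- The rough Laplacian `Δ R_{k̄j}{}^p{}_q = g^{sm̄} ∇_s ∇_{m̄} R_{k̄j}{}^p{}_q`. -/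
def lapRm (g : MetricField) : TField 4 := fun z I =>
  ∑ s, ∑ m, ginv g z s m * ddbarRm g z ![s, m, I 0, I 1, I 2, I 3]

/-- `∇_{k̄} ∇_j A_{μ̄l}`, as `dbard11 g A z ![k, j, μ, l]`. -/
def dbard11 (g : MetricField) (A : TField 2) : TField 4 :=
  nablaBar g ![Slot.lo, Slot.loBar, Slot.lo] (nabla g ![Slot.loBar, Slot.lo] A)

/-- `T^r{}_{sj} R^s{}_r{}^p{}_q`, a tensor with slots `j, p, q`. -/
def torRm (g : MetricField) : TField 3 := fun z I =>
  ∑ r, ∑ s, TorUp g z ![r, s, I 0] * RmUp g z ![s, r, I 1, I 2]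

/-- `T̄^{r̄}{}_{γ̄k̄} R_{r̄j}{}^p{}_q`, a tensor with slots `γ̄, k̄, j, p, q`. -/
def torBarRm (g : MetricField) : TField 5 := fun z I =>
  ∑ r, TorBarUp g z ![r, I 0, I 1] * Rm g z ![r, I 2, I 3, I 4]

/-- `T^r{}_{sj} R_{μ̄rδ̄β}`, a tensor with slots `s, j, μ̄, δ̄, β`. -/
def torRmLow (g : MetricField) : TField 5 := fun z I =>
  ∑ r, TorUp g z ![r, I 0, I 1] * RmLow g z ![I 2, r, I 3, I 4]

/-- `T̄^{r̄}{}_{μ̄k̄} R_{r̄jδ̄β}`, a tensor with slots `μ̄, k̄, j, δ̄, β`. -/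
def torBarRmLow (g : MetricField) : TField 5 := fun z I =>
  ∑ r, TorBarUp g z ![r, I 0, I 1] * RmLow g z ![r, I 2, I 3, I 4]

/-! ### The right-hand side of the flow -/

/-- `Tr (Rm ∧ Rm)` for the endomorphism valued `(1,1)`-form `Rm = R_{k̄j}{}^p{}_q dz^j ∧ dz̄^k`. -/
def trRmRm (g : MetricField) : TField 4 := fun z I =>
  ∑ α, ∑ β, wedge11 (fun y K => Rm g y ![K 0, K 1, α, β])
    (fun y K => Rm g y ![K 0, K 1, β, α]) z I

/-- `Ψ_{p̄sr̄q}`, the components of `Ψ = i∂∂̄ω - α' (Tr (Rm ∧ Rm) - Φ)`. -/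
def Psi (α' : ℝ) (Φ : TField 4) (g : MetricField) : TField 4 := fun z I =>
  Complex.I * ddbar11 (omega g) z I - (α' : ℂ) * (trRmRm g z I - Φ z I)

/-- The contraction `η_{p̄q} = g^{sr̄} η_{p̄sr̄q}` of a `(2,2)`-form. -/
def contr22 (g : MetricField) (η : TField 4) : TField 2 := fun z I =>
  ∑ s, ∑ r, ginv g z s r * η z ![I 0, s, r, I 1]

/-- `Ψ^p{}_q = g^{pμ̄} Ψ_{μ̄q}`. -/
def PsiUp (α' : ℝ) (Φ : TField 4) (g : MetricField) : TField 2 := fun z I =>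
  ∑ μ, ginv g z (I 0) μ * contr22 g (Psi α' Φ g) z ![μ, I 1]

/-- `‖Ω‖_ω`, for `Ω = F dz¹ ∧ dz² ∧ dz³`, where `i Ω ∧ Ω̄ = ‖Ω‖_ω² ω³`. Since
`i Ω ∧ Ω̄ = -i |F|² dz¹ ∧ dz̄¹ ∧ dz² ∧ dz̄² ∧ dz³ ∧ dz̄³` and
`ω³ = -6 i det(g) dz¹ ∧ dz̄¹ ∧ dz² ∧ dz̄² ∧ dz³ ∧ dz̄³`, this is `(|F|² / (6 det g))^{1/2}`. -/
def normOmega (F : C3 → ℂ) (g : MetricField) (z : C3) : ℝ :=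
  Real.sqrt (‖F z‖ ^ 2 / (6 * (g z).det.re))

/-- The components of the `(2,2)`-form `‖Ω‖_ω ω²`. -/
def normOmegaSq (F : C3 → ℂ) (g : MetricField) : TField 4 := fun z I =>
  (normOmega F g z : ℂ) * wedge11 (omega g) (omega g) z I

/-! ### Global objects on a complex threefold -/

section Manifold

variable (X : Type*) [TopologicalSpace X] [ChartedSpace C3 X]

/-- The holomorphic coordinate systems of `X`. -/
abbrev holCharts : Set (OpenPartialHomeomorph X C3) := IsManifold.maximalAtlas 𝓘(ℂ, C3) ω X

variable {X}

/-- The holomorphic coordinate vector `∂_j` of a coordinate system at the point with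
coordinates `z`. The holomorphic tangent space of `X` is identified with its tangent space, with the
given complex structure. -/
def coordVec (φ : OpenPartialHomeomorph X C3) (z : C3) (j : Fin 3) :
    TangentSpace 𝓘(ℂ, C3) (φ.symm z) :=
  mfderiv 𝓘(ℂ, C3) 𝓘(ℂ, C3) φ.symm z (EuclideanSpace.single j (1 : ℂ))

variable (X)

/-- A smooth Hermitian metric on the holomorphic tangent bundle, conjugate linear in the first
argument. -/
structure HermitianMetric where
  /-- the Hermitian form on each tangent space -/
  form : ∀ x : X, TangentSpace 𝓘(ℂ, C3) x →ₗ⋆[ℂ] TangentSpace 𝓘(ℂ, C3) x →ₗ[ℂ] ℂ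
  hermitian : ∀ x v w, star (form x v w) = form x w v
  pos : ∀ x v, v ≠ 0 → 0 < (form x v v).re
  smooth : ∀ φ ∈ holCharts X, ∀ k j : Fin 3,
    ContDiffOn ℝ ∞ (fun z => form (φ.symm z) (coordVec φ z k) (coordVec φ z j)) φ.target

/-- A smooth `(2,2)`-form `η`, given by `η(v̄, w, v̄', w')`, which is conjugate linear and alternating
in `v, v'` and linear and alternating in `w, w'`. Its components are
`η_{p̄sr̄q} = η(∂_p, ∂_s, ∂_r, ∂_q)`, in the normalization of `wedge11`. -/
structure Form22 where
  /-- the form on each tangent space -/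
  form : ∀ x : X, TangentSpace 𝓘(ℂ, C3) x →ₗ⋆[ℂ] TangentSpace 𝓘(ℂ, C3) x →ₗ[ℂ]
    TangentSpace 𝓘(ℂ, C3) x →ₗ⋆[ℂ] TangentSpace 𝓘(ℂ, C3) x →ₗ[ℂ] ℂ
  alt_bar : ∀ x v w v' w', form x v' w v w' = - form x v w v' w'
  alt : ∀ x v w v' w', form x v w' v' w = - form x v w v' w'
  smooth : ∀ φ ∈ holCharts X, ∀ p s r q : Fin 3,
    ContDiffOn ℝ ∞ (fun z => form (φ.symm z) (coordVec φ z p) (coordVec φ z s)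
      (coordVec φ z r) (coordVec φ z q)) φ.target

/-- A nowhere vanishing holomorphic `(3,0)`-form. -/
structure HolVolumeForm where
  /-- the form on each tangent space -/
  form : ∀ x : X, TangentSpace 𝓘(ℂ, C3) x [⋀^Fin 3]→ₗ[ℂ] ℂ
  ne_zero : ∀ x, form x ≠ 0
  holomorphic : ∀ φ ∈ holCharts X,
    DifferentiableOn ℂ (fun z => form (φ.symm z) (coordVec φ z)) φ.target

variable {X}

/-- `g_{k̄j} = g(∂_k, ∂_j)` in a coordinate system. -/
def HermitianMetric.comp (h : HermitianMetric X) (φ : OpenPartialHomeomorph X C3) : MetricField :=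
  fun z => Matrix.of fun k j => h.form (φ.symm z) (coordVec φ z k) (coordVec φ z j)

/-- `η_{p̄sr̄q}` in a coordinate system. -/
def Form22.comp (η : Form22 X) (φ : OpenPartialHomeomorph X C3) : TField 4 :=
  fun z I => η.form (φ.symm z) (coordVec φ z (I 0)) (coordVec φ z (I 1))
    (coordVec φ z (I 2)) (coordVec φ z (I 3))

/-- `F` with `Ω = F dz¹ ∧ dz² ∧ dz³` in a coordinate system. -/
def HolVolumeForm.comp (Ω : HolVolumeForm X) (φ : OpenPartialHomeomorph X C3) : C3 → ℂ :=
  fun z => Ω.form (φ.symm z) (coordVec φ z)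

/-- `dη = 0`. -/
def Form22.IsClosed (η : Form22 X) : Prop :=
  ∀ φ ∈ holCharts X, IsClosed22On (η.comp φ) φ.target

/-- The conformally balanced condition `d(‖Ω‖_ω ω²) = 0`. -/
def HermitianMetric.IsConformallyBalanced (h : HermitianMetric X) (Ω : HolVolumeForm X) : Prop :=
  ∀ φ ∈ holCharts X, IsClosed22On (normOmegaSq (Ω.comp φ) (h.comp φ)) φ.target

/-- The Anomaly flow on the time interval `[0, T)`: a smooth family of Hermitian metrics with
`∂_t (‖Ω‖_ω ω²) = i∂∂̄ω - α' (Tr (Rm ∧ Rm) - Φ(t))` and `ω(0) = ω₀`. -/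
structure IsAnomalyFlow (Ω : HolVolumeForm X) (α' : ℝ) (Φ : ℝ → Form22 X) (T : ℝ)
    (h₀ : HermitianMetric X) (h : ℝ → HermitianMetric X) : Prop where
  initial : h 0 = h₀
  smooth : ∀ φ ∈ holCharts X, ∀ k j : Fin 3,
    ContDiffOn ℝ ∞ (fun y : ℝ × C3 => (h y.1).comp φ y.2 k j) (Set.Ico 0 T ×ˢ φ.target)
  flow : ∀ φ ∈ holCharts X, ∀ t ∈ Set.Ico 0 T, ∀ z ∈ φ.target, ∀ p s r q : Fin 3,
    HasDerivWithinAt (fun τ => normOmegaSq (Ω.comp φ) ((h τ).comp φ) z ![p, s, r, q])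
      (Psi α' ((Φ t).comp φ) ((h t).comp φ) z ![p, s, r, q]) (Set.Ico 0 T) t

end Manifold

end AnomalyFlow

end

open AnomalyFlow

open AnomalyFlow

noncomputable section

/-! Everything is local, so one works in a holomorphic chart, with `Ω = F dz¹∧dz²∧dz³`, `N = ‖Ω‖_ω`
and `N² · 6 det g = |F|²`. Differentiating this relation in time gives `∂_t N = -½ N tr(∂_t g)`.
Contracting the flow equation with the inverse metric then cancels the trace and leaves `∂_t g_{p̄q}
= Ψ_{p̄q} / (2N)` (`hasDerivWithinAt_metric`). For the Chern connection, a variation `∂_t g` changes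
the connection by `∇_j (g^{-1} ∂_t g)` and the curvature by `-∇_{k̄} ∇_j (g^{-1} ∂_t g)`
(`hasDerivWithinAt_Gam`, `hasDerivWithinAt_Rm`).

The form `Ψ` is closed: `∂∂̄ω` is closed since `∂² = ∂̄² = 0`, `Tr(Rm ∧ Rm)` by the Bianchi
identities, and `Φ` by assumption. Hence `d(N ω²)` is constant in time and the conformally balanced
condition persists (`isClosed_normOmegaSq`). It is equivalent to first order information on `N`: it
gives `∂_a N = N T_a` (`dz_eq_mul_TorTr`). Combined with `N² · 6 det g = F F̄` and holomorphy of
`F`, this yields `∂_{k̄} T_j = ½ R_{k̄j}` (`dzbar_TorTr`), and therefore `R' = ½ Ric`.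
Differentiating the factor `1/(2N)` accounts for all terms with `T_j`, `T̄_{k̄}` and
undifferentiated `Ψ` (`neg_dzbar_nabla_metricDot`).

It remains to compute `-∇_{k̄} ∇_j Ψ^ρ{}_λ`. In the contraction of `i∂∂̄ω` the three Ricci-type
traces occur with weights `½ - 1 + ½` and cancel, so that `Ψ^ρ{}_λ` is `-g^{sr̄} R_{r̄s}{}^ρ{}_λ`,
plus `TT̄ + α'Φ`, minus `α'` times the contraction of `Tr(Rm ∧ Rm)` (`contr22_ddbar11_omega`,
`PsiUp_eq`). Both curvature parts require `∇_{k̄} ∇_j R_{μ̄s}` to be turned into `∇_s ∇_{μ̄}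
R_{k̄j}`. One Bianchi identity exchanges `j` and `s`, a commutator exchanges the derivatives, and
the conjugate Bianchi identity exchanges `k̄` and `μ̄`; the errors are torsion terms and terms
quadratic in the curvature (`dbardRm_eq_ddbarRm`). Contracting over `s, μ̄` produces the Laplacian,
and tracing against `Rm` produces the leading `α'` term, doubled because both factors of `Tr(Rm ∧
Rm)` contribute equally. -/

namespace AnomalyFlow

/-! ### Wirtinger calculus on `ℂ³`. -/

section Wirtinger
variable {f g : C3 → ℂ} {z : C3} {U : Set C3} (j k : Fin 3)

theorem dz_congr (h : f =ᶠ[nhds z] g) : dz j f z = dz j g z := by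
  simp only [dz, h.fderiv_eq]

theorem dzbar_congr (h : f =ᶠ[nhds z] g) : dzbar j f z = dzbar j g z := by
  simp only [dzbar, h.fderiv_eq]

theorem dz_congr_on (hU : IsOpen U) (hz : z ∈ U) (h : ∀ y ∈ U, f y = g y) :
    dz j f z = dz j g z :=
  dz_congr j (Filter.eventuallyEq_of_mem (hU.mem_nhds hz) h)

theorem dzbar_congr_on (hU : IsOpen U) (hz : z ∈ U) (h : ∀ y ∈ U, f y = g y) :
    dzbar j f z = dzbar j g z :=
  dzbar_congr j (Filter.eventuallyEq_of_mem (hU.mem_nhds hz) h)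

@[simp] theorem dz_const (c : ℂ) : dz j (fun _ => c) z = 0 := by
  simp [dz]

@[simp] theorem dzbar_const (c : ℂ) : dzbar j (fun _ => c) z = 0 := by
  simp [dzbar]

theorem dz_add (hf : DifferentiableAt ℝ f z) (hg : DifferentiableAt ℝ g z) :
    dz j (fun y => f y + g y) z = dz j f z + dz j g z := by
  simp only [dz, fderiv_fun_add hf hg, add_apply]; ring

theorem dzbar_add (hf : DifferentiableAt ℝ f z) (hg : DifferentiableAt ℝ g z) :
    dzbar j (fun y => f y + g y) z = dzbar j f z + dzbar j g z := by
  simp only [dzbar, fderiv_fun_add hf hg, add_apply]; ring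

theorem dz_sub (hf : DifferentiableAt ℝ f z) (hg : DifferentiableAt ℝ g z) :
    dz j (fun y => f y - g y) z = dz j f z - dz j g z := by
  simp only [dz, fderiv_fun_sub hf hg, sub_apply]; ring

theorem dzbar_sub (hf : DifferentiableAt ℝ f z) (hg : DifferentiableAt ℝ g z) :
    dzbar j (fun y => f y - g y) z = dzbar j f z - dzbar j g z := by
  simp only [dzbar, fderiv_fun_sub hf hg, sub_apply]; ring

theorem dz_neg : dz j (fun y => - f y) z = - dz j f z := by
  simp only [dz, fderiv_fun_neg, neg_apply]; ring

theorem dzbar_neg : dzbar j (fun y => - f y) z = - dzbar j f z := by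
  simp only [dzbar, fderiv_fun_neg, neg_apply]; ring

theorem dz_mul (hf : DifferentiableAt ℝ f z) (hg : DifferentiableAt ℝ g z) :
    dz j (fun y => f y * g y) z = dz j f z * g z + f z * dz j g z := by
  simp only [dz, fderiv_fun_mul hf hg, add_apply,
    smul_apply, smul_eq_mul]; ring

theorem dzbar_mul (hf : DifferentiableAt ℝ f z) (hg : DifferentiableAt ℝ g z) :
    dzbar j (fun y => f y * g y) z = dzbar j f z * g z + f z * dzbar j g z := by
  simp only [dzbar, fderiv_fun_mul hf hg, add_apply,
    smul_apply, smul_eq_mul]; ring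

theorem dz_const_mul (c : ℂ) (hf : DifferentiableAt ℝ f z) :
    dz j (fun y => c * f y) z = c * dz j f z := by
  rw [dz_mul j (differentiableAt_const c) hf, dz_const]; ring

theorem dzbar_const_mul (c : ℂ) (hf : DifferentiableAt ℝ f z) :
    dzbar j (fun y => c * f y) z = c * dzbar j f z := by
  rw [dzbar_mul j (differentiableAt_const c) hf, dzbar_const]; ring

theorem dz_sum {ι : Type*} (s : Finset ι) {F : ι → C3 → ℂ}
    (hF : ∀ i, DifferentiableAt ℝ (F i) z) :
    dz j (fun y => ∑ i ∈ s, F i y) z = ∑ i ∈ s, dz j (F i) z := by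
  simp only [dz, fderiv_fun_sum (fun i _ => hF i), sum_apply,
    Finset.mul_sum, ← Finset.sum_sub_distrib, Finset.sum_div]

theorem dzbar_sum {ι : Type*} (s : Finset ι) {F : ι → C3 → ℂ}
    (hF : ∀ i, DifferentiableAt ℝ (F i) z) :
    dzbar j (fun y => ∑ i ∈ s, F i y) z = ∑ i ∈ s, dzbar j (F i) z := by
  simp only [dzbar, fderiv_fun_sum (fun i _ => hF i), sum_apply,
    Finset.mul_sum, ← Finset.sum_add_distrib, Finset.sum_div]

theorem fderiv_star_apply (v : C3) :
    fderiv ℝ (fun y => star (f y)) z v = star (fderiv ℝ f z v) := by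
  have := (starL' ℝ : ℂ ≃L[ℝ] ℂ).comp_fderiv (f := f) (x := z)
  exact congrArg (fun L => L v) this

theorem dz_star : dz j (fun y => star (f y)) z = star (dzbar j f z) := by
  simp only [dz, dzbar, fderiv_star_apply]; simp only [Complex.star_def, map_div₀, map_add, map_mul,
    Complex.conj_I, map_ofNat]; ring

theorem dzbar_star : dzbar j (fun y => star (f y)) z = star (dz j f z) := by
  simp only [dz, dzbar, fderiv_star_apply]; simp only [Complex.star_def, map_div₀, map_sub, map_mul,
    Complex.conj_I, map_ofNat]; ring

theorem smooth_fderiv_apply (hU : IsOpen U) (hf : ContDiffOn ℝ ∞ f U) (v : C3) :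
    ContDiffOn ℝ ∞ (fun y => fderiv ℝ f y v) U :=
  (hf.fderiv_of_isOpen hU (by simp)).clm_apply contDiffOn_const

theorem smooth_dz (hU : IsOpen U) (hf : ContDiffOn ℝ ∞ f U) : ContDiffOn ℝ ∞ (dz j f) U := by
  have h1 := smooth_fderiv_apply hU hf (EuclideanSpace.single j 1)
  have h2 := smooth_fderiv_apply hU hf (EuclideanSpace.single j Complex.I)
  exact (h1.sub (contDiffOn_const.mul h2)).div_const 2

theorem smooth_dzbar (hU : IsOpen U) (hf : ContDiffOn ℝ ∞ f U) :
    ContDiffOn ℝ ∞ (dzbar j f) U := by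
  have h1 := smooth_fderiv_apply hU hf (EuclideanSpace.single j 1)
  have h2 := smooth_fderiv_apply hU hf (EuclideanSpace.single j Complex.I)
  exact (h1.add (contDiffOn_const.mul h2)).div_const 2

theorem smooth_differentiableAt (hU : IsOpen U) (hz : z ∈ U) (hf : ContDiffOn ℝ ∞ f U) :
    DifferentiableAt ℝ f z :=
  (hf.contDiffAt (hU.mem_nhds hz)).differentiableAt (by simp)

theorem fderiv_fderiv_apply {v : C3} (h : DifferentiableAt ℝ (fderiv ℝ f) z) (w : C3) :
    fderiv ℝ (fun y => fderiv ℝ f y v) z w = fderiv ℝ (fderiv ℝ f) z w v := by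
  rw [fderiv_clm_apply h (differentiableAt_const v)]
  simp

/-- Symmetry of the second real derivative. Only differentiability of the first derivative is
demanded, because `dzbar_log_deriv_eq_zero` applies this to a function `F` known only to be complex
differentiable. -/
theorem dz_dzbar_comm_of_differentiable (h1 : ∀ᶠ y in nhds z, DifferentiableAt ℝ f y)
    (h : DifferentiableAt ℝ (fderiv ℝ f) z) :
    dz j (dzbar k f) z = dzbar k (dz j f) z ∧ dz j (dz k f) z = dz k (dz j f) z ∧
      dzbar j (dzbar k f) z = dzbar k (dzbar j f) z := by
  have hs : ∀ v w, fderiv ℝ (fderiv ℝ f) z v w = fderiv ℝ (fderiv ℝ f) z w v :=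
    second_derivative_symmetric_of_eventually (𝕜 := ℝ)
      (h1.mono fun y hy => hy.hasFDerivAt) h.hasFDerivAt
  have hd : ∀ v, DifferentiableAt ℝ (fun y => fderiv ℝ f y v) z := fun v =>
    h.clm_apply (differentiableAt_const v)
  have hI : ∀ v, DifferentiableAt ℝ (fun y => Complex.I * fderiv ℝ f y v) z := fun v =>
    (differentiableAt_const _).mul (hd v)
  have e1 : ∀ k v, fderiv ℝ (dz k f) z v
      = (fderiv ℝ (fderiv ℝ f) z v (EuclideanSpace.single k 1)
        - Complex.I * fderiv ℝ (fderiv ℝ f) z v (EuclideanSpace.single k Complex.I)) / 2 := by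
    intro k v
    have : dz k f = fun y => (fderiv ℝ f y (EuclideanSpace.single k 1)
        - Complex.I * fderiv ℝ f y (EuclideanSpace.single k Complex.I)) * 2⁻¹ := by
      funext y; simp [dz, div_eq_mul_inv]
    rw [this, fderiv_mul_const ((hd _).fun_sub (hI _)), fderiv_fun_sub (hd _) (hI _),
      fderiv_const_mul (hd _)]
    simp only [smul_apply, sub_apply,
      fderiv_fderiv_apply h, smul_eq_mul]
    ring
  have e2 : ∀ k v, fderiv ℝ (dzbar k f) z v
      = (fderiv ℝ (fderiv ℝ f) z v (EuclideanSpace.single k 1)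
        + Complex.I * fderiv ℝ (fderiv ℝ f) z v (EuclideanSpace.single k Complex.I)) / 2 := by
    intro k v
    have : dzbar k f = fun y => (fderiv ℝ f y (EuclideanSpace.single k 1)
        + Complex.I * fderiv ℝ f y (EuclideanSpace.single k Complex.I)) * 2⁻¹ := by
      funext y; simp [dzbar, div_eq_mul_inv]
    rw [this, fderiv_mul_const ((hd _).fun_add (hI _)), fderiv_fun_add (hd _) (hI _),
      fderiv_const_mul (hd _)]
    simp only [smul_apply, add_apply,
      fderiv_fderiv_apply h, smul_eq_mul]
    ring
  refine ⟨?_, ?_, ?_⟩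
  · rw [dz, dzbar, e1, e1, e2, e2, hs (EuclideanSpace.single k 1) (EuclideanSpace.single j 1),
      hs (EuclideanSpace.single k 1), hs (EuclideanSpace.single k Complex.I),
      hs (EuclideanSpace.single k Complex.I)]
    ring
  · rw [dz, dz, e1, e1, e1, e1, hs (EuclideanSpace.single k 1) (EuclideanSpace.single j 1),
      hs (EuclideanSpace.single k 1), hs (EuclideanSpace.single k Complex.I),
      hs (EuclideanSpace.single k Complex.I)]
    ring
  · rw [dzbar, dzbar, e2, e2, e2, e2, hs (EuclideanSpace.single k 1) (EuclideanSpace.single j 1),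
      hs (EuclideanSpace.single k 1), hs (EuclideanSpace.single k Complex.I),
      hs (EuclideanSpace.single k Complex.I)]
    ring

theorem smooth_fderiv_differentiableAt (hU : IsOpen U) (hz : z ∈ U) (hf : ContDiffOn ℝ ∞ f U) :
    (∀ᶠ y in nhds z, DifferentiableAt ℝ f y) ∧ DifferentiableAt ℝ (fderiv ℝ f) z :=
  ⟨Filter.eventually_of_mem (hU.mem_nhds hz) fun _ hy => smooth_differentiableAt hU hy hf,
    ((hf.fderiv_of_isOpen hU (m := ∞) (by simp)).contDiffAt (hU.mem_nhds hz)).differentiableAt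
      (by simp)⟩

theorem dz_dzbar_comm (hU : IsOpen U) (hz : z ∈ U) (hf : ContDiffOn ℝ ∞ f U) :
    dz j (dzbar k f) z = dzbar k (dz j f) z :=
  let h := smooth_fderiv_differentiableAt hU hz hf
  (dz_dzbar_comm_of_differentiable j k h.1 h.2).1

theorem dz_dz_comm (hU : IsOpen U) (hz : z ∈ U) (hf : ContDiffOn ℝ ∞ f U) :
    dz j (dz k f) z = dz k (dz j f) z :=
  let h := smooth_fderiv_differentiableAt hU hz hf
  (dz_dzbar_comm_of_differentiable j k h.1 h.2).2.1

theorem dzbar_dzbar_comm (hU : IsOpen U) (hz : z ∈ U) (hf : ContDiffOn ℝ ∞ f U) :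
    dzbar j (dzbar k f) z = dzbar k (dzbar j f) z :=
  let h := smooth_fderiv_differentiableAt hU hz hf
  (dz_dzbar_comm_of_differentiable j k h.1 h.2).2.2

end Wirtinger

/-! ### Coordinate formulas for covariant derivatives. -/

section Expansion
variable (g : MetricField) (z : C3)

theorem update_vec2 {α : Type*} (a1 a2 x : α) :
    Function.update ![a1, a2] 0 x = ![x, a2] ∧
    Function.update ![a1, a2] 1 x = ![a1, x] := by
  refine ⟨?_, ?_⟩ <;> (ext i; fin_cases i <;> rfl)

theorem update_vec3 {α : Type*} (a1 a2 a3 x : α) :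
    Function.update ![a1, a2, a3] 0 x = ![x, a2, a3] ∧
    Function.update ![a1, a2, a3] 1 x = ![a1, x, a3] ∧
    Function.update ![a1, a2, a3] 2 x = ![a1, a2, x] := by
  refine ⟨?_, ?_, ?_⟩ <;> (ext i; fin_cases i <;> rfl)

theorem update_vec4 {α : Type*} (a1 a2 a3 a4 x : α) :
    Function.update ![a1, a2, a3, a4] 0 x = ![x, a2, a3, a4] ∧
    Function.update ![a1, a2, a3, a4] 1 x = ![a1, x, a3, a4] ∧
    Function.update ![a1, a2, a3, a4] 2 x = ![a1, a2, x, a4] ∧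
    Function.update ![a1, a2, a3, a4] 3 x = ![a1, a2, a3, x] := by
  refine ⟨?_, ?_, ?_, ?_⟩ <;> (ext i; fin_cases i <;> rfl)

theorem update_vec5 {α : Type*} (a1 a2 a3 a4 a5 x : α) :
    Function.update ![a1, a2, a3, a4, a5] 0 x = ![x, a2, a3, a4, a5] ∧
    Function.update ![a1, a2, a3, a4, a5] 1 x = ![a1, x, a3, a4, a5] ∧
    Function.update ![a1, a2, a3, a4, a5] 2 x = ![a1, a2, x, a4, a5] ∧
    Function.update ![a1, a2, a3, a4, a5] 3 x = ![a1, a2, a3, x, a5] ∧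
    Function.update ![a1, a2, a3, a4, a5] 4 x = ![a1, a2, a3, a4, x] := by
  refine ⟨?_, ?_, ?_, ?_, ?_⟩ <;> (ext i; fin_cases i <;> rfl)

/-- For each slot pattern in use, the sum over slots is unfolded once into explicit connection
terms. Since `∇_m` ignores barred slots and `∇_{m̄}` ignores unbarred ones, few terms survive, and
later identities reduce to `ring` after sums over `Fin 3` are written out. -/
theorem nabla_loBar_lo_up_lo (A : TField 4) (m i1 i2 i3 i4 : Fin 3) :
    nabla g ![Slot.loBar, Slot.lo, Slot.up, Slot.lo] A z ![m, i1, i2, i3, i4]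
      = dz m (fun y => A y ![i1, i2, i3, i4]) z
      - ∑ r, Gam g z m r i2 * A z ![i1, r, i3, i4]
      + ∑ r, Gam g z m i3 r * A z ![i1, i2, r, i4]
      - ∑ r, Gam g z m r i4 * A z ![i1, i2, i3, r] := by
  rw [nabla, Fin.sum_univ_four]
  simp [update_vec4, sub_eq_add_neg, add_assoc]

theorem nabla_loBar_loBar_lo_up_lo (A : TField 5) (m i1 i2 i3 i4 i5 : Fin 3) :
    nabla g ![Slot.loBar, Slot.loBar, Slot.lo, Slot.up, Slot.lo] A z ![m, i1, i2, i3, i4, i5]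
      = dz m (fun y => A y ![i1, i2, i3, i4, i5]) z
      - ∑ r, Gam g z m r i3 * A z ![i1, i2, r, i4, i5]
      + ∑ r, Gam g z m i4 r * A z ![i1, i2, i3, r, i5]
      - ∑ r, Gam g z m r i5 * A z ![i1, i2, i3, i4, r] := by
  rw [nabla, Fin.sum_univ_five]
  simp [update_vec5, sub_eq_add_neg, add_assoc]

theorem nabla_up_lo (A : TField 2) (m i1 i2 : Fin 3) :
    nabla g ![Slot.up, Slot.lo] A z ![m, i1, i2]
      = dz m (fun y => A y ![i1, i2]) z
      + ∑ r, Gam g z m i1 r * A z ![r, i2]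
      - ∑ r, Gam g z m r i2 * A z ![i1, r] := by
  rw [nabla, Fin.sum_univ_two]
  simp [update_vec2, sub_eq_add_neg, add_assoc]

theorem nabla_loBar_lo (A : TField 2) (m i1 i2 : Fin 3) :
    nabla g ![Slot.loBar, Slot.lo] A z ![m, i1, i2]
      = dz m (fun y => A y ![i1, i2]) z
      - ∑ r, Gam g z m r i2 * A z ![i1, r] := by
  rw [nabla, Fin.sum_univ_two]
  simp [update_vec2, sub_eq_add_neg]

theorem nabla_loBar_loBar_lo_loBar_lo (A : TField 5) (m i1 i2 i3 i4 i5 : Fin 3) :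
    nabla g ![Slot.loBar, Slot.loBar, Slot.lo, Slot.loBar, Slot.lo] A z ![m, i1, i2, i3, i4, i5]
      = dz m (fun y => A y ![i1, i2, i3, i4, i5]) z
      - ∑ r, Gam g z m r i3 * A z ![i1, i2, r, i4, i5]
      - ∑ r, Gam g z m r i5 * A z ![i1, i2, i3, i4, r] := by
  rw [nabla, Fin.sum_univ_five]
  simp [update_vec5, sub_eq_add_neg, add_assoc]

theorem nabla_loBar_lo_loBar_lo (A : TField 4) (m i1 i2 i3 i4 : Fin 3) :
    nabla g ![Slot.loBar, Slot.lo, Slot.loBar, Slot.lo] A z ![m, i1, i2, i3, i4]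
      = dz m (fun y => A y ![i1, i2, i3, i4]) z
      - ∑ r, Gam g z m r i2 * A z ![i1, r, i3, i4]
      - ∑ r, Gam g z m r i4 * A z ![i1, i2, i3, r] := by
  rw [nabla, Fin.sum_univ_four]
  simp [update_vec4, sub_eq_add_neg, add_assoc]

theorem nablaBar_lo_loBar_lo_loBar_lo (A : TField 5) (m i1 i2 i3 i4 i5 : Fin 3) :
    nablaBar g ![Slot.lo, Slot.loBar, Slot.lo, Slot.loBar, Slot.lo] A z ![m, i1, i2, i3, i4, i5]
      = dzbar m (fun y => A y ![i1, i2, i3, i4, i5]) z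
      - ∑ r, star (Gam g z m r i2) * A z ![i1, r, i3, i4, i5]
      - ∑ r, star (Gam g z m r i4) * A z ![i1, i2, i3, r, i5] := by
  rw [nablaBar, Fin.sum_univ_five]
  simp [update_vec5, sub_eq_add_neg, add_assoc]

theorem nablaBar_loBar_lo_up_lo (A : TField 4) (m i1 i2 i3 i4 : Fin 3) :
    nablaBar g ![Slot.loBar, Slot.lo, Slot.up, Slot.lo] A z ![m, i1, i2, i3, i4]
      = dzbar m (fun y => A y ![i1, i2, i3, i4]) z
      - ∑ r, star (Gam g z m r i1) * A z ![r, i2, i3, i4] := by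
  rw [nablaBar, Fin.sum_univ_four]
  simp [update_vec4, sub_eq_add_neg]

theorem nablaBar_up_lo (A : TField 2) (m i1 i2 : Fin 3) :
    nablaBar g ![Slot.up, Slot.lo] A z ![m, i1, i2]
      = dzbar m (fun y => A y ![i1, i2]) z := by
  rw [nablaBar, Fin.sum_univ_two]
  simp

theorem nablaBar_lo_loBar_lo (A : TField 3) (m i1 i2 i3 : Fin 3) :
    nablaBar g ![Slot.lo, Slot.loBar, Slot.lo] A z ![m, i1, i2, i3]
      = dzbar m (fun y => A y ![i1, i2, i3]) z
      - ∑ r, star (Gam g z m r i2) * A z ![i1, r, i3] := by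
  rw [nablaBar, Fin.sum_univ_three]
  simp [update_vec3, sub_eq_add_neg]

theorem nablaBar_lo_up_lo (A : TField 3) (m i1 i2 i3 : Fin 3) :
    nablaBar g ![Slot.lo, Slot.up, Slot.lo] A z ![m, i1, i2, i3]
      = dzbar m (fun y => A y ![i1, i2, i3]) z := by
  rw [nablaBar, Fin.sum_univ_three]
  simp

theorem nablaBar_lo_lo_loBar_loBar_lo (A : TField 5) (m i1 i2 i3 i4 i5 : Fin 3) :
    nablaBar g ![Slot.lo, Slot.lo, Slot.loBar, Slot.loBar, Slot.lo] A z ![m, i1, i2, i3, i4, i5]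
      = dzbar m (fun y => A y ![i1, i2, i3, i4, i5]) z
      - ∑ r, star (Gam g z m r i3) * A z ![i1, i2, r, i4, i5]
      - ∑ r, star (Gam g z m r i4) * A z ![i1, i2, i3, r, i5] := by
  rw [nablaBar, Fin.sum_univ_five]
  simp [update_vec5, sub_eq_add_neg, add_assoc]

theorem nablaBar_lo_loBar_lo_up_lo (A : TField 5) (m i1 i2 i3 i4 i5 : Fin 3) :
    nablaBar g ![Slot.lo, Slot.loBar, Slot.lo, Slot.up, Slot.lo] A z ![m, i1, i2, i3, i4, i5]
      = dzbar m (fun y => A y ![i1, i2, i3, i4, i5]) z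
      - ∑ r, star (Gam g z m r i2) * A z ![i1, r, i3, i4, i5] := by
  rw [nablaBar, Fin.sum_univ_five]
  simp [update_vec5, sub_eq_add_neg]

theorem nablaBar_lo_lo_loBar_up_lo (A : TField 5) (m i1 i2 i3 i4 i5 : Fin 3) :
    nablaBar g ![Slot.lo, Slot.lo, Slot.loBar, Slot.up, Slot.lo] A z ![m, i1, i2, i3, i4, i5]
      = dzbar m (fun y => A y ![i1, i2, i3, i4, i5]) z
      - ∑ r, star (Gam g z m r i3) * A z ![i1, i2, r, i4, i5] := by
  rw [nablaBar, Fin.sum_univ_five]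
  simp [update_vec5, sub_eq_add_neg]

end Expansion

/-! ### Metric compatibility, torsion, Bianchi identities and Hermitian symmetry of the curvature.
-/

/-- A smooth nondegenerate Hermitian matrix of functions on an open set. -/
structure SmoothMetricOn (g : MetricField) (U : Set C3) : Prop where
  isOpen : IsOpen U
  smooth : ∀ k j, ContDiffOn ℝ ∞ (fun y => g y k j) U
  herm : ∀ y ∈ U, ∀ k j, star (g y k j) = g y j k
  det_ne : ∀ y ∈ U, (g y).det ≠ 0

theorem contDiffOn_star {E : Type*} [NormedAddCommGroup E] [NormedSpace ℝ E] {f : E → ℂ}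
    {S : Set E} (hf : ContDiffOn ℝ ∞ f S) : ContDiffOn ℝ ∞ (fun y => star (f y)) S :=
  ((starL' ℝ : ℂ ≃L[ℝ] ℂ) : ℂ →L[ℝ] ℂ).contDiff.comp_contDiffOn hf

theorem contDiffOn_det {E : Type*} [NormedAddCommGroup E] [NormedSpace ℝ E]
    {M : E → Matrix (Fin 3) (Fin 3) ℂ} {S : Set E}
    (hM : ∀ k j, ContDiffOn ℝ ∞ (fun y => M y k j) S) :
    ContDiffOn ℝ ∞ (fun y => (M y).det) S := by
  simp only [Matrix.det_fin_three]
  fun_prop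

theorem contDiffOn_inv {E : Type*} [NormedAddCommGroup E] [NormedSpace ℝ E]
    {M : E → Matrix (Fin 3) (Fin 3) ℂ} {S : Set E}
    (hM : ∀ k j, ContDiffOn ℝ ∞ (fun y => M y k j) S) (hdet : ∀ y ∈ S, (M y).det ≠ 0)
    (j k : Fin 3) :
    ContDiffOn ℝ ∞ (fun y => (M y)⁻¹ j k) S := by
  have h1 : ContDiffOn ℝ ∞ (fun y => ((M y).det)⁻¹) S := (contDiffOn_det hM).inv hdet
  have h2 : ContDiffOn ℝ ∞ (fun y => (M y).adjugate j k) S := by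
    fin_cases j <;> fin_cases k <;> simp [Matrix.adjugate_fin_three] <;> fun_prop
  simpa [Matrix.inv_def, Ring.inverse_eq_inv'] using h1.mul h2

namespace SmoothMetricOn
variable {g : MetricField} {U : Set C3} (hg : SmoothMetricOn g U) {z : C3} (hz : z ∈ U)
include hg

theorem smooth_ginv (j k : Fin 3) : ContDiffOn ℝ ∞ (fun y => ginv g y j k) U :=
  contDiffOn_inv hg.smooth hg.det_ne j k

theorem smooth_dz_g (m k j : Fin 3) : ContDiffOn ℝ ∞ (dz m (fun y => g y k j)) U :=
  smooth_dz m hg.isOpen (hg.smooth k j)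

theorem smooth_dzbar_g (m k j : Fin 3) : ContDiffOn ℝ ∞ (dzbar m (fun y => g y k j)) U :=
  smooth_dzbar m hg.isOpen (hg.smooth k j)

theorem smooth_Gam (m p q : Fin 3) : ContDiffOn ℝ ∞ (fun y => Gam g y m p q) U :=
  ContDiffOn.sum fun l _ => (hg.smooth_ginv p l).mul (hg.smooth_dz_g m l q)

theorem smooth_Rm (I : Fin 4 → Fin 3) : ContDiffOn ℝ ∞ (fun y => Rm g y I) U :=
  (smooth_dzbar (I 0) hg.isOpen (hg.smooth_Gam (I 1) (I 2) (I 3))).neg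

theorem smooth_Tor (I : Fin 3 → Fin 3) : ContDiffOn ℝ ∞ (fun y => Tor g y I) U :=
  (hg.smooth_dz_g _ _ _).sub (hg.smooth_dz_g _ _ _)

theorem smooth_TorBar (I : Fin 3 → Fin 3) : ContDiffOn ℝ ∞ (fun y => TorBar g y I) U :=
  (hg.smooth_dzbar_g _ _ _).sub (hg.smooth_dzbar_g _ _ _)

theorem smooth_TorUp (I : Fin 3 → Fin 3) : ContDiffOn ℝ ∞ (fun y => TorUp g y I) U :=
  ContDiffOn.sum fun k _ => (hg.smooth_ginv _ k).mul (hg.smooth_Tor _)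

theorem smooth_TorBarUp (I : Fin 3 → Fin 3) : ContDiffOn ℝ ∞ (fun y => TorBarUp g y I) U :=
  ContDiffOn.sum fun k _ => (hg.smooth_ginv k _).mul (hg.smooth_TorBar _)

theorem smooth_TT (I : Fin 2 → Fin 3) : ContDiffOn ℝ ∞ (fun y => TT g y I) U :=
  ContDiffOn.sum fun s _ => ContDiffOn.sum fun r _ => ContDiffOn.sum fun m _ =>
    ContDiffOn.sum fun l _ => (((hg.smooth_ginv s r).mul (hg.smooth_ginv m l)).mul
      (hg.smooth_Tor _)).mul (hg.smooth_TorBar _)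

include hz

theorem ginv_mul (j m : Fin 3) : ∑ k, ginv g z j k * g z k m = if j = m then 1 else 0 := by
  have h : (g z)⁻¹ * g z = 1 := Matrix.nonsing_inv_mul _ (hg.det_ne z hz).isUnit
  have := congrFun (congrFun h j) m
  simpa [Matrix.mul_apply, Matrix.one_apply, ginv] using this

theorem mul_ginv (j m : Fin 3) : ∑ k, g z j k * ginv g z k m = if j = m then 1 else 0 := by
  have h : g z * (g z)⁻¹ = 1 := Matrix.mul_nonsing_inv _ (hg.det_ne z hz).isUnit
  have := congrFun (congrFun h j) m
  simpa [Matrix.mul_apply, Matrix.one_apply, ginv] using this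

theorem star_ginv (j k : Fin 3) : star (ginv g z j k) = ginv g z k j := by
  have h : (g z).IsHermitian := by
    ext a b; exact hg.herm z hz b a
  exact congrFun (congrFun h.inv k) j

theorem star_dz_g (m k j : Fin 3) :
    star (dz m (fun y => g y k j) z) = dzbar m (fun y => g y j k) z := by
  rw [← dzbar_star]
  exact dzbar_congr_on m hg.isOpen hz fun y hy => hg.herm y hy k j

theorem lower_raise (A : Fin 3 → ℂ) (l : Fin 3) :
    ∑ p, g z l p * ∑ m, ginv g z p m * A m = A l := by
  simp only [Finset.mul_sum]
  rw [Finset.sum_comm]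
  simp only [← mul_assoc, ← Finset.sum_mul, hg.mul_ginv hz]
  simp

theorem raise_lower (A : Fin 3 → ℂ) (l : Fin 3) :
    ∑ p, ginv g z l p * ∑ m, g z p m * A m = A l := by
  simp only [Finset.mul_sum]
  rw [Finset.sum_comm]
  simp only [← mul_assoc, ← Finset.sum_mul, hg.ginv_mul hz]
  simp

theorem lower_raise_right (A : Fin 3 → ℂ) (l : Fin 3) :
    ∑ p, (∑ m, A m * ginv g z m p) * g z p l = A l := by
  simp only [Finset.sum_mul]
  rw [Finset.sum_comm]
  simp only [mul_assoc, ← Finset.mul_sum, hg.ginv_mul hz]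
  simp

theorem raise_lower_right (A : Fin 3 → ℂ) (l : Fin 3) :
    ∑ p, (∑ m, A m * g z m p) * ginv g z p l = A l := by
  simp only [Finset.sum_mul]
  rw [Finset.sum_comm]
  simp only [mul_assoc, ← Finset.mul_sum, hg.mul_ginv hz]
  simp

/-- The connection is `g⁻¹ ∂g`, so lowering its upper index recovers `∂g`. This is metric
compatibility; the formulas below for differentiating raised, lowered and contracted tensors rest on
it. -/
theorem dz_g (m l q : Fin 3) :
    dz m (fun y => g y l q) z = ∑ p, g z l p * Gam g z m p q :=
  (hg.lower_raise hz (fun a => dz m (fun y => g y a q) z) l).symm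

theorem star_Gam (m p q : Fin 3) :
    star (Gam g z m p q) = ∑ l, dzbar m (fun y => g y q l) z * ginv g z l p := by
  simp only [Gam, star_sum, star_mul, hg.star_ginv hz, hg.star_dz_g hz]

theorem dzbar_g (m l q : Fin 3) :
    dzbar m (fun y => g y l q) z = ∑ p, star (Gam g z m p l) * g z p q := by
  simp only [hg.star_Gam hz]
  exact (hg.lower_raise_right hz (fun a => dzbar m (fun y => g y l a) z) q).symm

theorem differentiableAt_g (k j : Fin 3) : DifferentiableAt ℝ (fun y => g y k j) z :=
  smooth_differentiableAt hg.isOpen hz (hg.smooth k j)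

theorem differentiableAt_ginv (k j : Fin 3) : DifferentiableAt ℝ (fun y => ginv g y k j) z :=
  smooth_differentiableAt hg.isOpen hz (hg.smooth_ginv k j)

theorem differentiableAt_Gam (m p q : Fin 3) : DifferentiableAt ℝ (fun y => Gam g y m p q) z :=
  smooth_differentiableAt hg.isOpen hz (hg.smooth_Gam m p q)

theorem differentiableAt_Rm (I : Fin 4 → Fin 3) : DifferentiableAt ℝ (fun y => Rm g y I) z :=
  smooth_differentiableAt hg.isOpen hz (hg.smooth_Rm I)

theorem differentiableAt_star_Gam (m p q : Fin 3) :
    DifferentiableAt ℝ (fun y => star (Gam g y m p q)) z :=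
  smooth_differentiableAt hg.isOpen hz (contDiffOn_star (hg.smooth_Gam m p q))

/-- Differentiate `g⁻¹ g = 1` and multiply by `g⁻¹` on the right. -/
theorem dz_ginv (m s r : Fin 3) :
    dz m (fun y => ginv g y s r) z = - ∑ a, Gam g z m s a * ginv g z a r := by
  have hi := hg.differentiableAt_ginv hz
  have h0 := hg.differentiableAt_g hz
  have key : ∀ q, ∑ k, dz m (fun y => ginv g y s k) z * g z k q = - Gam g z m s q := by
    intro q
    have h1 : dz m (fun y => ∑ k, ginv g y s k * g y k q) z = 0 := by
      rw [dz_congr_on m hg.isOpen hz fun y hy => hg.ginv_mul hy s q, dz_const]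
    rw [dz_sum _ _ fun k => (hi s k).fun_mul (h0 k q)] at h1
    simp only [dz_mul m (hi s _) (h0 _ q), Finset.sum_add_distrib] at h1
    rw [eq_neg_iff_add_eq_zero]
    exact h1
  rw [← hg.raise_lower_right hz (fun k => dz m (fun y => ginv g y s k) z) r]
  simp only [key, neg_mul, Finset.sum_neg_distrib]

theorem dzbar_ginv (m s r : Fin 3) :
    dzbar m (fun y => ginv g y s r) z = - ∑ b, ginv g z s b * star (Gam g z m r b) := by
  have h1 : dzbar m (fun y => ginv g y s r) z = dzbar m (fun y => star (ginv g y r s)) z :=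
    dzbar_congr_on m hg.isOpen hz fun y hy => (hg.star_ginv hy r s).symm
  rw [h1, dzbar_star, hg.dz_ginv hz]
  simp only [star_neg, star_sum, star_mul, hg.star_ginv hz]

/-- Torsion is the skew part of the connection; in this form it can be matched with the connection
terms left over in the Bianchi identities. -/
theorem TorUp_eq (r j m : Fin 3) : TorUp g z ![r, j, m] = Gam g z j r m - Gam g z m r j := by
  simp [TorUp, Tor, Gam, mul_sub]

theorem TorBarUp_eq (r j m : Fin 3) :
    TorBarUp g z ![r, j, m] = star (Gam g z j r m) - star (Gam g z m r j) := by
  simp only [hg.star_Gam hz]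
  simp [TorBarUp, TorBar, mul_sub, mul_comm]

/-- The contraction of a pair of indices commutes with `∇_m`. -/
theorem dz_contr {A : Fin 3 → Fin 3 → C3 → ℂ} (hA : ∀ r s, DifferentiableAt ℝ (A r s) z)
    (m : Fin 3) :
    dz m (fun y => ∑ s, ∑ r, ginv g y s r * A r s y) z
      = ∑ s, ∑ r, ginv g z s r * (dz m (A r s) z - ∑ c, Gam g z m c s * A r c z) := by
  have hi := hg.differentiableAt_ginv hz
  rw [dz_sum _ _ fun s => by fun_prop]
  simp only [dz_sum _ _ fun r => (hi _ r).fun_mul (hA r _), dz_mul m (hi _ _) (hA _ _),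
    hg.dz_ginv hz]
  simp only [Fin.sum_univ_three]; ring

theorem dzbar_contr {A : Fin 3 → Fin 3 → C3 → ℂ} (hA : ∀ r s, DifferentiableAt ℝ (A r s) z)
    (m : Fin 3) :
    dzbar m (fun y => ∑ s, ∑ r, ginv g y s r * A r s y) z
      = ∑ s, ∑ r, ginv g z s r * (dzbar m (A r s) z - ∑ c, star (Gam g z m c r) * A c s z) := by
  have hi := hg.differentiableAt_ginv hz
  rw [dzbar_sum _ _ fun s => by fun_prop]
  simp only [dzbar_sum _ _ fun r => (hi _ r).fun_mul (hA r _), dzbar_mul m (hi _ _) (hA _ _),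
    hg.dzbar_ginv hz]
  simp only [Fin.sum_univ_three]; ring

theorem dz_raise {A : Fin 3 → C3 → ℂ} (hA : ∀ r, DifferentiableAt ℝ (A r) z) (m s : Fin 3) :
    dz m (fun y => ∑ r, ginv g y s r * A r y) z
      = ∑ r, ginv g z s r * dz m (A r) z - ∑ c, Gam g z m s c * ∑ r, ginv g z c r * A r z := by
  have hi := hg.differentiableAt_ginv hz
  simp only [dz_sum _ _ fun r => (hi s r).fun_mul (hA r), dz_mul m (hi _ _) (hA _),
    hg.dz_ginv hz]
  simp only [Fin.sum_univ_three]; ring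

theorem dzbar_raise {A : Fin 3 → C3 → ℂ} (hA : ∀ r, DifferentiableAt ℝ (A r) z) (m s : Fin 3) :
    dzbar m (fun y => ∑ r, ginv g y s r * A r y) z
      = ∑ r, ginv g z s r * (dzbar m (A r) z - ∑ c, star (Gam g z m c r) * A c z) := by
  have hi := hg.differentiableAt_ginv hz
  simp only [dzbar_sum _ _ fun r => (hi s r).fun_mul (hA r), dzbar_mul m (hi _ _) (hA _),
    hg.dzbar_ginv hz]
  simp only [Fin.sum_univ_three]; ring

theorem dz_lower {A : Fin 3 → C3 → ℂ} (hA : ∀ p, DifferentiableAt ℝ (A p) z) (m l : Fin 3) :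
    dz m (fun y => ∑ p, g y l p * A p y) z
      = ∑ p, g z l p * (dz m (A p) z + ∑ c, Gam g z m p c * A c z) := by
  have h0 := hg.differentiableAt_g hz
  simp only [dz_sum _ _ fun p => (h0 l p).fun_mul (hA p), dz_mul m (h0 _ _) (hA _),
    hg.dz_g hz]
  simp only [Fin.sum_univ_three]; ring

theorem dzbar_lower {A : Fin 3 → C3 → ℂ} (hA : ∀ p, DifferentiableAt ℝ (A p) z) (m l : Fin 3) :
    dzbar m (fun y => ∑ p, g y l p * A p y) z
      = ∑ p, g z l p * dzbar m (A p) z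
        + ∑ c, star (Gam g z m c l) * ∑ p, g z c p * A p z := by
  have h0 := hg.differentiableAt_g hz
  simp only [dzbar_sum _ _ fun p => (h0 l p).fun_mul (hA p), dzbar_mul m (h0 _ _) (hA _),
    hg.dzbar_g hz]
  simp only [Fin.sum_univ_three]; ring

/-- The connection is flat in the `(2,0)` directions. -/
theorem flat (j m p q : Fin 3) :
    dz j (fun y => Gam g y m p q) z - dz m (fun y => Gam g y j p q) z
      + ∑ r, (Gam g z j p r * Gam g z m r q - Gam g z m p r * Gam g z j r q) = 0 := by
  have hd : ∀ m l, DifferentiableAt ℝ (dz m (fun y => g y l q)) z := fun m l =>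
    smooth_differentiableAt hg.isOpen hz (hg.smooth_dz_g m l q)
  -- With `A = g⁻¹ ∂g`, the derivative of `A` is `g⁻¹ ∂∂g` minus `A A`; the first part is symmetric
  -- in `j, m`, so skew-symmetrizing gives flatness.
  have e : ∀ j m, dz j (fun y => Gam g y m p q) z
      = ∑ r, ginv g z p r * dz j (dz m (fun y => g y r q)) z - ∑ c, Gam g z j p c * Gam g z m c q :=
    fun j m => hg.dz_raise hz (fun r => hd m r) j p
  rw [e, e]
  simp only [fun r => dz_dz_comm j m hg.isOpen hz (hg.smooth r q), Finset.sum_sub_distrib]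
  ring

/-- The second Bianchi identity for the endomorphism valued form `Rm`. -/
theorem bianchi_dz (k j m p q : Fin 3) :
    dz j (fun y => Rm g y ![k, m, p, q]) z - dz m (fun y => Rm g y ![k, j, p, q]) z
      + ∑ r, (Gam g z j p r * Rm g z ![k, m, r, q] - Rm g z ![k, m, p, r] * Gam g z j r q
        - Gam g z m p r * Rm g z ![k, j, r, q] + Rm g z ![k, j, p, r] * Gam g z m r q) = 0 := by
  have hG := hg.differentiableAt_Gam hz
  have hdG : ∀ j m p q, DifferentiableAt ℝ (dz j (fun y => Gam g y m p q)) z := fun j m p q =>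
    smooth_differentiableAt hg.isOpen hz (smooth_dz j hg.isOpen (hg.smooth_Gam m p q))
  -- The identity is `∂_{k̄}` of the flatness relation, since `∂_{k̄}` of the connection is `-Rm`.
  have h0 : dzbar k (fun y => dz j (fun y => Gam g y m p q) y - dz m (fun y => Gam g y j p q) y
      + ∑ r, (Gam g y j p r * Gam g y m r q - Gam g y m p r * Gam g y j r q)) z = 0 := by
    rw [dzbar_congr_on k hg.isOpen hz fun y hy => hg.flat hy j m p q, dzbar_const]
  have hR : ∀ a b c, dzbar k (fun y => Gam g y a b c) z = - Rm g z ![k, a, b, c] := by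
    intro a b c; simp [Rm]
  have hdR : ∀ j m, dzbar k (dz j (fun y => Gam g y m p q)) z
      = - dz j (fun y => Rm g y ![k, m, p, q]) z := by
    intro j m
    rw [← dz_dzbar_comm j k hg.isOpen hz (hg.smooth_Gam m p q), ← dz_neg]
    simp [Rm]
  rw [dzbar_add k (by fun_prop) (by fun_prop), dzbar_sub k (by fun_prop) (by fun_prop),
    dzbar_sum _ _ fun r => by fun_prop] at h0
  simp only [dzbar_sub k ((hG _ _ _).fun_mul (hG _ _ _)) ((hG _ _ _).fun_mul (hG _ _ _)),
    dzbar_mul k (hG _ _ _) (hG _ _ _)] at h0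
  rw [hdR, hdR] at h0
  simp only [hR] at h0
  simp only [Fin.sum_univ_three] at h0 ⊢
  linear_combination -h0

/-- `Rm` is `-∂̄` of the connection and `∂̄² = 0`. -/
theorem bianchi_dzbar (a r q α β : Fin 3) :
    dzbar a (fun y => Rm g y ![r, q, α, β]) z = dzbar r (fun y => Rm g y ![a, q, α, β]) z := by
  have := dzbar_dzbar_comm a r hg.isOpen hz (hg.smooth_Gam q α β)
  have e : ∀ a r, dzbar a (fun y => Rm g y ![r, q, α, β]) z
      = - dzbar a (dzbar r (fun y => Gam g y q α β)) z := by
    intro a r; rw [← dzbar_neg]; simp [Rm]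
  rw [e, e, this]

/-- Apply `∂_{k̄}` to `∂_j g = g A`. The resulting form, `-∂∂̄g` plus a term quadratic in first
derivatives, shows both the Hermitian symmetry and the relation with `i∂∂̄ω`. -/
theorem RmLow_eq (k j l m : Fin 3) :
    RmLow g z ![k, j, l, m] = - dzbar k (dz j (fun y => g y l m)) z
      + ∑ a, star (Gam g z k a l) * ∑ p, g z a p * Gam g z j p m := by
  have h1 : dzbar k (dz j (fun y => g y l m)) z
      = dzbar k (fun y => ∑ p, g y l p * Gam g y j p m) z :=
    dzbar_congr_on k hg.isOpen hz fun y hy => hg.dz_g hy j l m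
  rw [h1, hg.dzbar_lower hz fun p => hg.differentiableAt_Gam hz j p m]
  simp [RmLow, Rm]

theorem star_RmLow (k j l m : Fin 3) :
    star (RmLow g z ![k, j, l, m]) = RmLow g z ![j, k, m, l] := by
  rw [hg.RmLow_eq hz, hg.RmLow_eq hz]
  have h1 : star (dzbar k (dz j (fun y => g y l m)) z) = dzbar j (dz k (fun y => g y m l)) z := by
    rw [← dz_star, ← dz_dzbar_comm k j hg.isOpen hz (hg.smooth m l)]
    exact dz_congr_on k hg.isOpen hz fun y hy => hg.star_dz_g hy j l m
  simp only [star_add, star_neg, h1, star_sum, star_mul, star_star, hg.herm z hz]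
  congr 1
  simp only [Finset.mul_sum, Finset.sum_mul]
  rw [Finset.sum_comm]
  refine Finset.sum_congr rfl fun _ _ => Finset.sum_congr rfl fun _ _ => by ring

/-- Hermitian symmetry identifies the lowered and raised curvature with a conjugate. This is the
endomorphism by which the commutator acts on a barred slot, where the connection is the conjugate
one. -/
theorem RmBar_eq (k j l m : Fin 3) : RmBar g z ![k, j, l, m] = star (Rm g z ![j, k, m, l]) := by
  have h1 : ∀ q, RmLow g z ![k, j, l, q]
      = ∑ p, star (Rm g z ![j, k, p, l]) * g z p q := by
    intro q
    rw [← hg.star_RmLow hz, show RmLow g z ![j, k, q, l] = ∑ p, g z q p * Rm g z ![j, k, p, l] from rfl]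
    simp only [star_sum, star_mul, hg.herm z hz]
  have : RmBar g z ![k, j, l, m] = ∑ q, RmLow g z ![k, j, l, q] * ginv g z q m := rfl
  rw [this]
  simp only [h1]
  exact hg.raise_lower_right hz (fun p => star (Rm g z ![j, k, p, l])) m

end SmoothMetricOn

/-! ### Exchanging the indices of second derivatives of the curvature. -/

/-- `∇_{k̄} ∇_j R_{μ̄s}{}^p{}_q`, as `dbardRm g z ![k, j, μ, s, p, q]`. -/
def dbardRm (g : MetricField) : TField 6 :=
  nablaBar g ![Slot.lo, Slot.loBar, Slot.lo, Slot.up, Slot.lo] (dRm g)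

/-- `T^r{}_{sj} R_{μ̄r}{}^p{}_q`, a tensor with slots `s, j, μ̄, p, q`. -/
def torRmMixed (g : MetricField) : TField 5 := fun z I =>
  ∑ r, TorUp g z ![r, I 0, I 1] * Rm g z ![I 2, r, I 3, I 4]

/-- The curvature terms in the commutator `[∇_{k̄}, ∇_s] R_{μ̄j}{}^α{}_β`. -/
def commRm (g : MetricField) (z : C3) (k s μ j α β : Fin 3) : ℂ :=
  - (∑ κ, RmBar g z ![k, s, μ, κ] * Rm g z ![κ, j, α, β])
    + (∑ κ, Rm g z ![k, s, κ, j] * Rm g z ![μ, κ, α, β])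
    - (∑ κ, Rm g z ![k, s, α, κ] * Rm g z ![μ, j, κ, β])
    + (∑ κ, Rm g z ![k, s, κ, β] * Rm g z ![μ, j, α, κ])

theorem dRm_eq (g : MetricField) (z : C3) (m k j p q : Fin 3) :
    dRm g z ![m, k, j, p, q] = dz m (fun y => Rm g y ![k, j, p, q]) z
      - ∑ r, Gam g z m r j * Rm g z ![k, r, p, q]
      + ∑ r, Gam g z m p r * Rm g z ![k, j, r, q]
      - ∑ r, Gam g z m r q * Rm g z ![k, j, p, r] :=
  nabla_loBar_lo_up_lo g z (Rm g) m k j p q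

theorem dbarRm_eq (g : MetricField) (z : C3) (m k j p q : Fin 3) :
    dbarRm g z ![m, k, j, p, q] = dzbar m (fun y => Rm g y ![k, j, p, q]) z
      - ∑ r, star (Gam g z m r k) * Rm g z ![r, j, p, q] :=
  nablaBar_loBar_lo_up_lo g z (Rm g) m k j p q

theorem ddbarRm_eq (g : MetricField) (z : C3) (s m k j p q : Fin 3) :
    ddbarRm g z ![s, m, k, j, p, q] = dz s (fun y => dbarRm g y ![m, k, j, p, q]) z
      - ∑ r, Gam g z s r j * dbarRm g z ![m, k, r, p, q]
      + ∑ r, Gam g z s p r * dbarRm g z ![m, k, j, r, q]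
      - ∑ r, Gam g z s r q * dbarRm g z ![m, k, j, p, r] :=
  nabla_loBar_loBar_lo_up_lo g z (dbarRm g) s m k j p q

theorem dbardRm_eq (g : MetricField) (z : C3) (k j μ s p q : Fin 3) :
    dbardRm g z ![k, j, μ, s, p, q] = dzbar k (fun y => dRm g y ![j, μ, s, p, q]) z
      - ∑ r, star (Gam g z k r μ) * dRm g z ![j, r, s, p, q] :=
  nablaBar_lo_loBar_lo_up_lo g z (dRm g) k j μ s p q

theorem dzbar_Gam (g : MetricField) (z : C3) (k a b c : Fin 3) :
    dzbar k (fun y => Gam g y a b c) z = - Rm g z ![k, a, b, c] := by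
  simp [Rm]

namespace SmoothMetricOn
variable {g : MetricField} {U : Set C3} (hg : SmoothMetricOn g U) {z : C3} (hz : z ∈ U)
include hg

theorem smooth_dz_Rm (m : Fin 3) (I : Fin 4 → Fin 3) :
    ContDiffOn ℝ ∞ (dz m (fun y => Rm g y I)) U :=
  smooth_dz m hg.isOpen (hg.smooth_Rm I)

theorem smooth_dzbar_Rm (m : Fin 3) (I : Fin 4 → Fin 3) :
    ContDiffOn ℝ ∞ (dzbar m (fun y => Rm g y I)) U :=
  smooth_dzbar m hg.isOpen (hg.smooth_Rm I)

theorem smooth_dRm (m k j p q : Fin 3) :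
    ContDiffOn ℝ ∞ (fun y => dRm g y ![m, k, j, p, q]) U := by
  have h1 := hg.smooth_dz_Rm
  have h2 := hg.smooth_Rm
  have h3 := hg.smooth_Gam
  simp only [dRm_eq]
  have h4 := h1 m ![k, j, p, q]
  fun_prop

theorem smooth_dbarRm (m k j p q : Fin 3) :
    ContDiffOn ℝ ∞ (fun y => dbarRm g y ![m, k, j, p, q]) U := by
  have h2 := hg.smooth_Rm
  have h3 := fun a b c => contDiffOn_star (hg.smooth_Gam a b c)
  simp only [dbarRm_eq]
  have h4 := hg.smooth_dzbar_Rm m ![k, j, p, q]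
  fun_prop

theorem smooth_torRmMixed (I : Fin 5 → Fin 3) : ContDiffOn ℝ ∞ (fun y => torRmMixed g y I) U :=
  ContDiffOn.sum fun _ _ => (hg.smooth_TorUp _).mul (hg.smooth_Rm _)

theorem smooth_torBarRm (I : Fin 5 → Fin 3) : ContDiffOn ℝ ∞ (fun y => torBarRm g y I) U :=
  ContDiffOn.sum fun _ _ => (hg.smooth_TorBarUp _).mul (hg.smooth_Rm _)

include hz

theorem differentiableAt_dRm (m k j p q : Fin 3) :
    DifferentiableAt ℝ (fun y => dRm g y ![m, k, j, p, q]) z :=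
  smooth_differentiableAt hg.isOpen hz (hg.smooth_dRm m k j p q)

theorem differentiableAt_dbarRm (m k j p q : Fin 3) :
    DifferentiableAt ℝ (fun y => dbarRm g y ![m, k, j, p, q]) z :=
  smooth_differentiableAt hg.isOpen hz (hg.smooth_dbarRm m k j p q)

/-- The Bianchi identity `bianchi_dz` covers the endomorphism slots only. The connection terms on
the form index do not cancel under skew-symmetrization in `j, s`; their difference is torsion times
curvature. -/
theorem dRm_swap (j μ s α β : Fin 3) :
    dRm g z ![j, μ, s, α, β] = dRm g z ![s, μ, j, α, β] + torRmMixed g z ![s, j, μ, α, β] := by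
  have h := hg.bianchi_dz hz μ j s α β
  have h2 : torRmMixed g z ![s, j, μ, α, β]
      = ∑ r, (Gam g z s r j - Gam g z j r s) * Rm g z ![μ, r, α, β] := by
    simp only [← hg.TorUp_eq hz]; rfl
  rw [h2, dRm_eq, dRm_eq]
  simp only [Fin.sum_univ_three] at h ⊢
  linear_combination h

/-- Here the partial derivatives are already symmetric by `bianchi_dzbar`, and the conjugate
connection on the barred form index leaves the conjugate torsion. -/
theorem dbarRm_swap (k μ j α β : Fin 3) :
    dbarRm g z ![k, μ, j, α, β] = dbarRm g z ![μ, k, j, α, β] + torBarRm g z ![μ, k, j, α, β] := by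
  have h2 : torBarRm g z ![μ, k, j, α, β]
      = ∑ r, (star (Gam g z μ r k) - star (Gam g z k r μ)) * Rm g z ![r, j, α, β] := by
    simp only [← hg.TorBarUp_eq hz]; rfl
  rw [h2, dbarRm_eq, dbarRm_eq, hg.bianchi_dzbar hz]
  simp only [Fin.sum_univ_three]
  ring

theorem dz_star_Gam (s k κ μ : Fin 3) :
    dz s (fun y => star (Gam g y k κ μ)) z = - RmBar g z ![k, s, μ, κ] := by
  rw [dz_star, dzbar_Gam, star_neg, hg.RmBar_eq hz]

/-- The commutator of `∇_{k̄}` and `∇_s` on the curvature. -/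
theorem dbardRm_comm (k s μ j α β : Fin 3) :
    dbardRm g z ![k, s, μ, j, α, β]
      = ddbarRm g z ![s, k, μ, j, α, β] + commRm g z k s μ j α β := by
  have hG := hg.differentiableAt_Gam hz
  have hsG := hg.differentiableAt_star_Gam hz
  have hR := hg.differentiableAt_Rm hz
  have hd : ∀ m I, DifferentiableAt ℝ (dz m (fun y => Rm g y I)) z := fun m I =>
    smooth_differentiableAt hg.isOpen hz (hg.smooth_dz_Rm m I)
  have hdb : ∀ m I, DifferentiableAt ℝ (dzbar m (fun y => Rm g y I)) z := fun m I =>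
    smooth_differentiableAt hg.isOpen hz (hg.smooth_dzbar_Rm m I)
  have e1 : dzbar k (fun y => dRm g y ![s, μ, j, α, β]) z
      = dzbar k (dz s (fun y => Rm g y ![μ, j, α, β])) z
        - ∑ r, (- Rm g z ![k, s, r, j] * Rm g z ![μ, r, α, β]
            + Gam g z s r j * dzbar k (fun y => Rm g y ![μ, r, α, β]) z)
        + ∑ r, (- Rm g z ![k, s, α, r] * Rm g z ![μ, j, r, β]
            + Gam g z s α r * dzbar k (fun y => Rm g y ![μ, j, r, β]) z)
        - ∑ r, (- Rm g z ![k, s, r, β] * Rm g z ![μ, j, α, r]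
            + Gam g z s r β * dzbar k (fun y => Rm g y ![μ, j, α, r]) z) := by
    simp only [dRm_eq]
    rw [dzbar_sub k (by fun_prop) (by fun_prop), dzbar_add k (by fun_prop) (by fun_prop),
      dzbar_sub k (by fun_prop) (by fun_prop), dzbar_sum _ _ fun r => by fun_prop,
      dzbar_sum _ _ fun r => by fun_prop, dzbar_sum _ _ fun r => by fun_prop]
    simp only [dzbar_mul k (hG _ _ _) (hR _), dzbar_Gam]
  have e2 : ∀ j α β, dz s (fun y => dbarRm g y ![k, μ, j, α, β]) z
      = dz s (dzbar k (fun y => Rm g y ![μ, j, α, β])) z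
        - ∑ r, (- RmBar g z ![k, s, μ, r] * Rm g z ![r, j, α, β]
            + star (Gam g z k r μ) * dz s (fun y => Rm g y ![r, j, α, β]) z) := by
    intro j α β
    simp only [dbarRm_eq]
    rw [dz_sub s (by fun_prop) (by fun_prop), dz_sum _ _ fun r => by fun_prop]
    simp only [dz_mul s (hsG _ _ _) (hR _), hg.dz_star_Gam hz]
  -- Once the mixed partials are exchanged, the only survivors are the derivatives of connection
  -- coefficients: `-Rm` for the unbarred slots and `-RmBar` for the conjugate coefficient on the
  -- barred slot.
  rw [dbardRm_eq, ddbarRm_eq, e1, e2, commRm, ← dz_dzbar_comm s k hg.isOpen hz (hg.smooth_Rm _)]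
  simp only [dRm_eq, dbarRm_eq, Fin.sum_univ_three]
  ring

/-- The formula expressing `∇_{k̄} ∇_j R_{μ̄s}` by `∇_s ∇_{μ̄} R_{k̄j}`. -/
theorem dbardRm_eq_ddbarRm (k j μ s α β : Fin 3) :
    dbardRm g z ![k, j, μ, s, α, β] = ddbarRm g z ![s, μ, k, j, α, β]
      + nablaBar g ![Slot.lo, Slot.lo, Slot.loBar, Slot.up, Slot.lo] (torRmMixed g) z
          ![k, s, j, μ, α, β]
      + nabla g ![Slot.loBar, Slot.loBar, Slot.lo, Slot.up, Slot.lo] (torBarRm g) z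
          ![s, μ, k, j, α, β]
      + commRm g z k s μ j α β := by
  have hT : ∀ I, DifferentiableAt ℝ (fun y => torRmMixed g y I) z := fun I =>
    smooth_differentiableAt hg.isOpen hz (hg.smooth_torRmMixed I)
  have hT' : ∀ I, DifferentiableAt ℝ (fun y => torBarRm g y I) z := fun I =>
    smooth_differentiableAt hg.isOpen hz (hg.smooth_torBarRm I)
  -- Exchange of `j` and `s` under `∇_{k̄}`; the error is differentiated as a tensor.
  have e1 : dbardRm g z ![k, j, μ, s, α, β] = dbardRm g z ![k, s, μ, j, α, β]
      + nablaBar g ![Slot.lo, Slot.lo, Slot.loBar, Slot.up, Slot.lo] (torRmMixed g) z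
          ![k, s, j, μ, α, β] := by
    rw [dbardRm_eq, dbardRm_eq, nablaBar_lo_lo_loBar_up_lo,
      dzbar_congr_on k hg.isOpen hz fun y hy => hg.dRm_swap hy j μ s α β,
      dzbar_add k (hg.differentiableAt_dRm hz _ _ _ _ _) (hT _)]
    simp only [fun r => hg.dRm_swap hz j r s α β, mul_add, Finset.sum_add_distrib]
    ring
  -- Exchange of `k̄` and `μ̄` under `∇_s`.
  have e2 : ddbarRm g z ![s, k, μ, j, α, β] = ddbarRm g z ![s, μ, k, j, α, β]
      + nabla g ![Slot.loBar, Slot.loBar, Slot.lo, Slot.up, Slot.lo] (torBarRm g) z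
          ![s, μ, k, j, α, β] := by
    rw [ddbarRm_eq, ddbarRm_eq, nabla_loBar_loBar_lo_up_lo,
      dz_congr_on s hg.isOpen hz fun y hy => hg.dbarRm_swap hy k μ j α β,
      dz_add s (hg.differentiableAt_dbarRm hz _ _ _ _ _) (hT' _)]
    simp only [hg.dbarRm_swap hz k μ, mul_add, Finset.sum_add_distrib]
    ring
  rw [e1, hg.dbardRm_comm hz, e2]
  ring

end SmoothMetricOn

/-! ### The contracted curvature and the appearance of the Laplacian. -/

/-- `g^{sr̄} R_{r̄s}{}^p{}_q`. -/
def trRm (g : MetricField) : TField 2 := fun z I =>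
  ∑ s, ∑ r, ginv g z s r * Rm g z ![r, s, I 0, I 1]

namespace SmoothMetricOn
variable {g : MetricField} {U : Set C3} (hg : SmoothMetricOn g U) {z : C3} (hz : z ∈ U)
include hg hz

theorem nabla_trRm (j ρ l : Fin 3) :
    nabla g ![Slot.up, Slot.lo] (trRm g) z ![j, ρ, l]
      = ∑ s, ∑ r, ginv g z s r * dRm g z ![j, r, s, ρ, l] := by
  rw [nabla_up_lo]
  have h1 : dz j (fun y => trRm g y ![ρ, l]) z
      = ∑ s, ∑ r, ginv g z s r * (dz j (fun y => Rm g y ![r, s, ρ, l]) z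
        - ∑ c, Gam g z j c s * Rm g z ![r, c, ρ, l]) :=
    hg.dz_contr hz (A := fun r s y => Rm g y ![r, s, ρ, l])
      (fun r s => hg.differentiableAt_Rm hz _) j
  have h2 : ∀ a b, trRm g z ![a, b] = ∑ s, ∑ r, ginv g z s r * Rm g z ![r, s, a, b] :=
    fun _ _ => rfl
  rw [h1]
  simp only [h2, dRm_eq, Fin.sum_univ_three]
  ring

theorem nablaBar_nabla_trRm (k j ρ l : Fin 3) :
    nablaBar g ![Slot.lo, Slot.up, Slot.lo] (nabla g ![Slot.up, Slot.lo] (trRm g)) z ![k, j, ρ, l]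
      = ∑ s, ∑ r, ginv g z s r * dbardRm g z ![k, j, r, s, ρ, l] := by
  rw [nablaBar_lo_up_lo, dzbar_congr_on k hg.isOpen hz fun y hy => hg.nabla_trRm hy j ρ l,
    hg.dzbar_contr hz (A := fun r s y => dRm g y ![j, r, s, ρ, l])
      (fun r s => hg.differentiableAt_dRm hz _ _ _ _ _) k]
  simp only [dbardRm_eq]

/-- Contraction of the last Bianchi error: the metric is parallel, so `∇_{k̄}` passes through
`g^{sr̄}`. -/
theorem nablaBar_torRm (k j ρ l : Fin 3) :
    nablaBar g ![Slot.lo, Slot.up, Slot.lo] (torRm g) z ![k, j, ρ, l]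
      = ∑ s, ∑ r, ginv g z s r *
          nablaBar g ![Slot.lo, Slot.lo, Slot.loBar, Slot.up, Slot.lo] (torRmMixed g) z
            ![k, s, j, r, ρ, l] := by
  have h1 : (fun y => torRm g y ![j, ρ, l])
      = fun y => ∑ s, ∑ r, ginv g y s r * torRmMixed g y ![s, j, r, ρ, l] := by
    funext y
    have e1 : torRm g y ![j, ρ, l]
        = ∑ a, ∑ s, TorUp g y ![a, s, j] * ∑ r, ginv g y s r * Rm g y ![r, a, ρ, l] := rfl
    have e2 : ∀ s r, torRmMixed g y ![s, j, r, ρ, l]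
        = ∑ a, TorUp g y ![a, s, j] * Rm g y ![r, a, ρ, l] := fun _ _ => rfl
    rw [e1]
    simp only [e2, Fin.sum_univ_three]
    ring
  rw [nablaBar_lo_up_lo, h1,
    hg.dzbar_contr hz (A := fun r s y => torRmMixed g y ![s, j, r, ρ, l])
      (fun r s => smooth_differentiableAt hg.isOpen hz (hg.smooth_torRmMixed _)) k]
  simp only [nablaBar_lo_lo_loBar_up_lo]

theorem contr_commRm (k j ρ l : Fin 3) :
    ∑ s, ∑ r, ginv g z s r * commRm g z k s r j ρ l
      = - (∑ κ, RicPrimeUp g z ![k, κ] * Rm g z ![κ, j, ρ, l])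
          + (∑ s, ∑ κ, Rm g z ![k, s, κ, j] * RmUp g z ![s, κ, ρ, l])
          - (∑ s, ∑ κ, RmUpUp g z ![k, s, ρ, κ] * RmLowUp g z ![s, j, κ, l])
          + (∑ s, ∑ κ, Rm g z ![k, s, κ, l] * RmUp g z ![s, j, ρ, κ]) := by
  have hUp : ∀ s a b c, RmUp g z ![s, a, b, c] = ∑ r, ginv g z s r * Rm g z ![r, a, b, c] :=
    fun _ _ _ _ => rfl
  -- `R_{k̄sr̄}{}^{κ̄}` is `R_{k̄s}{}^p{}_q` with `p` lowered and `q` raised. Contracting with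
  -- `g^{sr̄}` undoes the lowering and sets `p = s`, which is the trace defining `R'`.
  have e1 : ∀ κ, ∑ s, ∑ r, ginv g z s r * RmBar g z ![k, s, r, κ] = RicPrimeUp g z ![k, κ] := by
    intro κ
    have h1 : ∀ s r, RmBar g z ![k, s, r, κ]
        = ∑ p, g z r p * ∑ q, Rm g z ![k, s, p, q] * ginv g z q κ := by
      intro s r
      have : RmBar g z ![k, s, r, κ]
        = ∑ q, (∑ p, g z r p * Rm g z ![k, s, p, q]) * ginv g z q κ := rfl
      rw [this]
      simp only [Finset.sum_mul, Finset.mul_sum]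
      rw [Finset.sum_comm]
      refine Finset.sum_congr rfl fun _ _ => Finset.sum_congr rfl fun _ _ => by ring
    have h2 : RicPrimeUp g z ![k, κ] = ∑ q, (∑ p, Rm g z ![k, p, p, q]) * ginv g z q κ := rfl
    simp only [h1, hg.raise_lower hz (fun p => ∑ q, Rm g z ![k, _, p, q] * ginv g z q κ)]
    rw [h2]
    simp only [Finset.sum_mul]
    rw [Finset.sum_comm]
  -- One index is raised in the first factor and its partner lowered in the second, so the two
  -- metrics cancel.
  have e3 : ∀ s, ∑ κ, RmUpUp g z ![k, s, ρ, κ] * RmLowUp g z ![s, j, κ, l]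
      = ∑ p, Rm g z ![k, s, ρ, p] * RmUp g z ![s, j, p, l] := by
    intro s
    have h1 : ∀ κ, RmLowUp g z ![s, j, κ, l] = ∑ p, g z κ p * RmUp g z ![s, j, p, l] := by
      intro κ
      have : RmLowUp g z ![s, j, κ, l]
        = ∑ r, ginv g z s r * ∑ p, g z κ p * Rm g z ![r, j, p, l] := rfl
      rw [this]
      simp only [hUp, Finset.mul_sum]
      rw [Finset.sum_comm]
      refine Finset.sum_congr rfl fun _ _ => Finset.sum_congr rfl fun _ _ => by ring
    have h2 : ∀ κ, RmUpUp g z ![k, s, ρ, κ] = ∑ q, Rm g z ![k, s, ρ, q] * ginv g z q κ :=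
      fun _ => rfl
    simp only [h1, h2, Finset.mul_sum]
    rw [Finset.sum_comm]
    simp only [← mul_assoc, ← Finset.sum_mul]
    simp only [hg.lower_raise_right hz (fun q => Rm g z ![k, s, ρ, q])]
  simp only [e3, ← e1, commRm, hUp]
  simp only [mul_add, mul_sub, mul_neg, Finset.sum_add_distrib, Finset.sum_sub_distrib,
    Finset.sum_neg_distrib]
  congr 1
  · congr 1
    · congr 1
      · congr 1
        simp only [Fin.sum_univ_three]; ring
      · simp only [Fin.sum_univ_three]; ring
    · simp only [Fin.sum_univ_three]; ring
  · simp only [Fin.sum_univ_three]; ring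

/-- The second covariant derivative of the contracted curvature. -/
theorem nablaBar_nabla_trRm_eq_lapRm (k j ρ l : Fin 3) :
    nablaBar g ![Slot.lo, Slot.up, Slot.lo] (nabla g ![Slot.up, Slot.lo] (trRm g)) z ![k, j, ρ, l]
      = lapRm g z ![k, j, ρ, l]
        + (nablaBar g ![Slot.lo, Slot.up, Slot.lo] (torRm g) z ![k, j, ρ, l]
          + (∑ s, ∑ γ, ginv g z s γ *
              nabla g ![Slot.loBar, Slot.loBar, Slot.lo, Slot.up, Slot.lo] (torBarRm g) z
                ![s, γ, k, j, ρ, l])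
          - (∑ κ, RicPrimeUp g z ![k, κ] * Rm g z ![κ, j, ρ, l])
          + (∑ s, ∑ κ, Rm g z ![k, s, κ, j] * RmUp g z ![s, κ, ρ, l])
          - (∑ s, ∑ κ, RmUpUp g z ![k, s, ρ, κ] * RmLowUp g z ![s, j, κ, l])
          + (∑ s, ∑ κ, Rm g z ![k, s, κ, l] * RmUp g z ![s, j, ρ, κ])) := by
  have h1 : lapRm g z ![k, j, ρ, l]
      = ∑ s, ∑ r, ginv g z s r * ddbarRm g z ![s, r, k, j, ρ, l] := rfl
  have h2 := hg.contr_commRm hz k j ρ l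
  rw [hg.nablaBar_nabla_trRm hz, h1, hg.nablaBar_torRm hz]
  simp only [hg.dbardRm_eq_ddbarRm hz, mul_add, Finset.sum_add_distrib]
  linear_combination h2

end SmoothMetricOn

/-! ### The same exchange formula with lowered endomorphism indices. -/

namespace SmoothMetricOn
variable {g : MetricField} {U : Set C3} (hg : SmoothMetricOn g U) {z : C3} (hz : z ∈ U)
include hg hz

/-- Lowering the index `δ̄` commutes with covariant differentiation, the metric being parallel: the
conjugate connection term on `δ̄` is the one coming from `∂_{k̄} g`. -/
theorem nablaBar_torRmLow (k s j μ δ β : Fin 3) :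
    nablaBar g ![Slot.lo, Slot.lo, Slot.loBar, Slot.loBar, Slot.lo] (torRmLow g) z
        ![k, s, j, μ, δ, β]
      = ∑ p, g z δ p * nablaBar g ![Slot.lo, Slot.lo, Slot.loBar, Slot.up, Slot.lo]
          (torRmMixed g) z ![k, s, j, μ, p, β] := by
  have h1 : ∀ y μ δ, torRmLow g y ![s, j, μ, δ, β]
      = ∑ p, g y δ p * torRmMixed g y ![s, j, μ, p, β] := by
    intro y μ δ
    have e1 : torRmLow g y ![s, j, μ, δ, β]
        = ∑ r, TorUp g y ![r, s, j] * ∑ p, g y δ p * Rm g y ![μ, r, p, β] := rfl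
    have e2 : ∀ p, torRmMixed g y ![s, j, μ, p, β]
        = ∑ r, TorUp g y ![r, s, j] * Rm g y ![μ, r, p, β] := fun _ => rfl
    simp only [e1, e2, Finset.mul_sum]
    rw [Finset.sum_comm]
    refine Finset.sum_congr rfl fun _ _ => Finset.sum_congr rfl fun _ _ => by ring
  rw [nablaBar_lo_lo_loBar_loBar_lo]
  simp only [h1]
  rw [hg.dzbar_lower hz (A := fun p y => torRmMixed g y ![s, j, μ, p, β])
    fun p => smooth_differentiableAt hg.isOpen hz (hg.smooth_torRmMixed _)]
  simp only [nablaBar_lo_lo_loBar_up_lo, Fin.sum_univ_three]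
  ring

theorem nabla_torBarRmLow (s μ k j δ β : Fin 3) :
    nabla g ![Slot.loBar, Slot.loBar, Slot.lo, Slot.loBar, Slot.lo] (torBarRmLow g) z
        ![s, μ, k, j, δ, β]
      = ∑ p, g z δ p * nabla g ![Slot.loBar, Slot.loBar, Slot.lo, Slot.up, Slot.lo]
          (torBarRm g) z ![s, μ, k, j, p, β] := by
  have h1 : ∀ y j β, torBarRmLow g y ![μ, k, j, δ, β]
      = ∑ p, g y δ p * torBarRm g y ![μ, k, j, p, β] := by
    intro y j β
    have e1 : torBarRmLow g y ![μ, k, j, δ, β]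
        = ∑ r, TorBarUp g y ![r, μ, k] * ∑ p, g y δ p * Rm g y ![r, j, p, β] := rfl
    have e2 : ∀ p, torBarRm g y ![μ, k, j, p, β]
        = ∑ r, TorBarUp g y ![r, μ, k] * Rm g y ![r, j, p, β] := fun _ => rfl
    simp only [e1, e2, Finset.mul_sum]
    rw [Finset.sum_comm]
    refine Finset.sum_congr rfl fun _ _ => Finset.sum_congr rfl fun _ _ => by ring
  rw [nabla_loBar_loBar_lo_loBar_lo]
  simp only [h1]
  rw [hg.dz_lower hz (A := fun p y => torBarRm g y ![μ, k, j, p, β])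
    fun p => smooth_differentiableAt hg.isOpen hz (hg.smooth_torBarRm _)]
  simp only [nabla_loBar_loBar_lo_up_lo, Fin.sum_univ_three]
  ring

theorem commRm_lower (k s μ j δ β : Fin 3) :
    - (∑ κ, RmBar g z ![k, s, μ, κ] * RmLow g z ![κ, j, δ, β])
        + (∑ κ, Rm g z ![k, s, κ, j] * RmLow g z ![μ, κ, δ, β])
        - (∑ κ, RmBar g z ![k, s, δ, κ] * RmLow g z ![μ, j, κ, β])
        + (∑ κ, Rm g z ![k, s, κ, β] * RmLow g z ![μ, j, δ, κ])
      = ∑ p, g z δ p * commRm g z k s μ j p β := by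
  have hLow : ∀ a b c d, RmLow g z ![a, b, c, d] = ∑ p, g z c p * Rm g z ![a, b, p, d] :=
    fun _ _ _ _ => rfl
  have h3 : ∑ κ, RmBar g z ![k, s, δ, κ] * RmLow g z ![μ, j, κ, β]
      = ∑ q, RmLow g z ![k, s, δ, q] * Rm g z ![μ, j, q, β] := by
    have h2 : ∀ κ, RmBar g z ![k, s, δ, κ] = ∑ q, RmLow g z ![k, s, δ, q] * ginv g z q κ :=
      fun _ => rfl
    simp only [hLow μ, h2, Finset.mul_sum]
    rw [Finset.sum_comm]
    simp only [← mul_assoc, ← Finset.sum_mul]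
    simp only [hg.lower_raise_right hz (fun q => RmLow g z ![k, s, δ, q])]
  rw [h3]
  simp only [commRm, hLow, Fin.sum_univ_three]
  ring

/-- `Y` is kept arbitrary so that the whole bracket of error terms can be inserted at once. -/
theorem RmUpUp_contr (r l : Fin 3) (Y : Fin 3 → Fin 3 → ℂ) :
    ∑ β, ∑ δ, RmUpUp g z ![r, l, β, δ] * ∑ p, g z δ p * Y p β
      = ∑ α, ∑ β, Rm g z ![r, l, β, α] * Y α β := by
  have h2 : ∀ β δ, RmUpUp g z ![r, l, β, δ] = ∑ q, Rm g z ![r, l, β, q] * ginv g z q δ :=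
    fun _ _ => rfl
  rw [Finset.sum_comm (γ := Fin 3) (f := fun α β => Rm g z ![r, l, β, α] * Y α β)]
  refine Finset.sum_congr rfl fun β _ => ?_
  simp only [h2, Finset.mul_sum]
  rw [Finset.sum_comm]
  simp only [← mul_assoc, ← Finset.sum_mul]
  simp only [hg.lower_raise_right hz (fun q => Rm g z ![r, l, β, q])]

/-- The trace of `R_{r̄l}` against `∇_{k̄} ∇_j R_{μ̄s}`, in the form with lowered indices. -/
theorem trace_dbardRm (k j μ s r l : Fin 3) :
    ∑ α, ∑ β, Rm g z ![r, l, β, α] * dbardRm g z ![k, j, μ, s, α, β]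
      = (∑ α, ∑ β, Rm g z ![r, l, β, α] * ddbarRm g z ![s, μ, k, j, α, β])
        + ∑ β, ∑ δ, RmUpUp g z ![r, l, β, δ] *
              (nablaBar g ![Slot.lo, Slot.lo, Slot.loBar, Slot.loBar, Slot.lo] (torRmLow g) z
                  ![k, s, j, μ, δ, β]
                + nabla g ![Slot.loBar, Slot.loBar, Slot.lo, Slot.loBar, Slot.lo] (torBarRmLow g) z
                  ![s, μ, k, j, δ, β]
                - (∑ κ, RmBar g z ![k, s, μ, κ] * RmLow g z ![κ, j, δ, β])
                + (∑ κ, Rm g z ![k, s, κ, j] * RmLow g z ![μ, κ, δ, β])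
                - (∑ κ, RmBar g z ![k, s, δ, κ] * RmLow g z ![μ, j, κ, β])
                + (∑ κ, Rm g z ![k, s, κ, β] * RmLow g z ![μ, j, δ, κ])) := by
  -- The entire bracket is the lowered difference of the two second derivatives; the trace formula
  -- follows by cancelling the metric against the raised index.
  have h : ∀ β δ, (nablaBar g ![Slot.lo, Slot.lo, Slot.loBar, Slot.loBar, Slot.lo] (torRmLow g) z
                  ![k, s, j, μ, δ, β]
                + nabla g ![Slot.loBar, Slot.loBar, Slot.lo, Slot.loBar, Slot.lo] (torBarRmLow g) z
                  ![s, μ, k, j, δ, β]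
                - (∑ κ, RmBar g z ![k, s, μ, κ] * RmLow g z ![κ, j, δ, β])
                + (∑ κ, Rm g z ![k, s, κ, j] * RmLow g z ![μ, κ, δ, β])
                - (∑ κ, RmBar g z ![k, s, δ, κ] * RmLow g z ![μ, j, κ, β])
                + (∑ κ, Rm g z ![k, s, κ, β] * RmLow g z ![μ, j, δ, κ]))
      = ∑ p, g z δ p * (dbardRm g z ![k, j, μ, s, p, β] - ddbarRm g z ![s, μ, k, j, p, β]) := by
    intro β δ
    simp only [hg.dbardRm_eq_ddbarRm hz]
    have e := hg.commRm_lower hz k s μ j δ β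
    rw [hg.nablaBar_torRmLow hz, hg.nabla_torBarRmLow hz]
    simp only [mul_add, mul_sub, Finset.sum_add_distrib, Finset.sum_sub_distrib]
    linear_combination e
  simp only [h]
  rw [hg.RmUpUp_contr hz r l (fun p β => dbardRm g z ![k, j, μ, s, p, β]
    - ddbarRm g z ![s, μ, k, j, p, β])]
  simp only [mul_sub, Finset.sum_sub_distrib]
  ring

end SmoothMetricOn

/-! ### Second derivatives of `Tr(Rm ∧ Rm)`. -/

/-- `R_{r̄q}{}^α{}_β R_{p̄s}{}^β{}_α`, with slots `p̄, s, r̄, q`. -/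
def trRR (g : MetricField) : TField 4 := fun z I =>
  ∑ α, ∑ β, Rm g z ![I 2, I 3, α, β] * Rm g z ![I 0, I 1, β, α]

/-- `∇_j (R_{r̄q}{}^α{}_β R_{p̄s}{}^β{}_α)`, with slots `j, p̄, s, r̄, q`. -/
def dtrRR (g : MetricField) : TField 5 := fun z I =>
  ∑ α, ∑ β, (dRm g z ![I 0, I 3, I 4, α, β] * Rm g z ![I 1, I 2, β, α]
    + Rm g z ![I 3, I 4, α, β] * dRm g z ![I 0, I 1, I 2, β, α])

/-- Interchanging both pairs at once costs two signs. This folds the two halves of the product rule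
for `Tr(Rm ∧ Rm)` into one term with coefficient `2`. -/
theorem alt22_swap (c : Fin 3 → Fin 3 → Fin 3 → Fin 3 → ℂ) (p s r q : Fin 3) :
    alt22 (fun p s r q => c r q p s) p s r q = alt22 c p s r q := by
  simp only [alt22]; ring

theorem trRmRm_eq (g : MetricField) (z : C3) (p s r q : Fin 3) :
    trRmRm g z ![p, s, r, q] = alt22 (fun p s r q => trRR g z ![p, s, r, q]) p s r q := by
  have h : trRmRm g z ![p, s, r, q] = ∑ α, ∑ β, alt22 (fun p s r q =>
      Rm g z ![r, q, α, β] * Rm g z ![p, s, β, α]) p s r q := rfl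
  have h2 : ∀ p s r q, trRR g z ![p, s, r, q]
      = ∑ α, ∑ β, Rm g z ![r, q, α, β] * Rm g z ![p, s, β, α] := fun _ _ _ _ => rfl
  rw [h]
  simp only [alt22, h2, Finset.sum_add_distrib, Finset.sum_sub_distrib]

namespace SmoothMetricOn
variable {g : MetricField} {U : Set C3} (hg : SmoothMetricOn g U) {z : C3} (hz : z ∈ U)
include hg

theorem smooth_trRR (I : Fin 4 → Fin 3) : ContDiffOn ℝ ∞ (fun y => trRR g y I) U :=
  ContDiffOn.sum fun _ _ => ContDiffOn.sum fun _ _ => (hg.smooth_Rm _).mul (hg.smooth_Rm _)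

theorem smooth_dtrRR (j p s r q : Fin 3) :
    ContDiffOn ℝ ∞ (fun y => dtrRR g y ![j, p, s, r, q]) U :=
  ContDiffOn.sum fun _ _ => ContDiffOn.sum fun _ _ =>
    ((hg.smooth_dRm _ _ _ _ _).mul (hg.smooth_Rm _)).add
      ((hg.smooth_Rm _).mul (hg.smooth_dRm _ _ _ _ _))

include hz

theorem nabla_trRR (j p s r q : Fin 3) :
    nabla g ![Slot.loBar, Slot.lo, Slot.loBar, Slot.lo] (trRR g) z ![j, p, s, r, q]
      = dtrRR g z ![j, p, s, r, q] := by
  have hR := hg.differentiableAt_Rm hz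
  have h : ∀ y p s r q, trRR g y ![p, s, r, q]
      = ∑ α, ∑ β, Rm g y ![r, q, α, β] * Rm g y ![p, s, β, α] := fun _ _ _ _ _ => rfl
  have h1 : dtrRR g z ![j, p, s, r, q]
      = ∑ α, ∑ β, (dRm g z ![j, r, q, α, β] * Rm g z ![p, s, β, α]
        + Rm g z ![r, q, α, β] * dRm g z ![j, p, s, β, α]) := rfl
  rw [nabla_loBar_lo_loBar_lo, h1]
  simp only [h]
  rw [dz_sum _ _ fun α => by fun_prop]
  simp only [dz_sum _ _ fun β => (hR ![r, q, _, β]).fun_mul (hR ![p, s, β, _]),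
    dz_mul j (hR _) (hR _)]
  simp only [dRm_eq, Fin.sum_univ_three]
  ring

/-- The Leibniz rule applied twice: each factor may take both derivatives, and the cross terms
become the part quadratic in first derivatives of the curvature. -/
theorem nablaBar_dtrRR (k j p s r q : Fin 3) :
    nablaBar g ![Slot.lo, Slot.loBar, Slot.lo, Slot.loBar, Slot.lo] (dtrRR g) z
        ![k, j, p, s, r, q]
      = (∑ α, ∑ β, Rm g z ![p, s, β, α] * dbardRm g z ![k, j, r, q, α, β])
        + (∑ α, ∑ β, (dRm g z ![j, r, q, α, β] * dbarRm g z ![k, p, s, β, α]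
            + dbarRm g z ![k, r, q, α, β] * dRm g z ![j, p, s, β, α]))
        + ∑ α, ∑ β, Rm g z ![r, q, β, α] * dbardRm g z ![k, j, p, s, α, β] := by
  have hR := hg.differentiableAt_Rm hz
  have hD := hg.differentiableAt_dRm hz
  have h : ∀ y p s r q, dtrRR g y ![j, p, s, r, q]
      = ∑ α, ∑ β, (dRm g y ![j, r, q, α, β] * Rm g y ![p, s, β, α]
        + Rm g y ![r, q, α, β] * dRm g y ![j, p, s, β, α]) := fun _ _ _ _ _ => rfl
  rw [nablaBar_lo_loBar_lo_loBar_lo]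
  simp only [h]
  rw [dzbar_sum _ _ fun α => by fun_prop]
  simp only [dzbar_sum _ _ fun β => ((hD j r q _ β).fun_mul (hR ![p, s, β, _])).fun_add
    ((hR ![r, q, _, β]).fun_mul (hD j p s β _)),
    dzbar_add k ((hD j r q _ _).fun_mul (hR ![p, s, _, _]))
    ((hR ![r, q, _, _]).fun_mul (hD j p s _ _)),
    dzbar_mul k (hR _) (hD _ _ _ _ _), dzbar_mul k (hD _ _ _ _ _) (hR _)]
  simp only [dbarRm_eq, dbardRm_eq, Fin.sum_univ_three]
  ring

/-- `∇_{k̄} ∇_j` of the contraction of an anti-symmetrized tensor. -/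
theorem dbard11_contr22_alt {S : TField 4} (hS : ∀ I, ContDiffOn ℝ ∞ (fun y => S y I) U)
    {η : TField 4} (hη : ∀ y p s r q,
      η y ![p, s, r, q] = alt22 (fun p s r q => S y ![p, s, r, q]) p s r q)
    {D : TField 5} (hD : ∀ j p s r q, ContDiffOn ℝ ∞ (fun y => D y ![j, p, s, r, q]) U)
    (hSD : ∀ y ∈ U, ∀ j p s r q,
      nabla g ![Slot.loBar, Slot.lo, Slot.loBar, Slot.lo] S y ![j, p, s, r, q]
        = D y ![j, p, s, r, q]) (k j μ l : Fin 3) :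
    dbard11 g (contr22 g η) z ![k, j, μ, l]
      = ∑ s, ∑ r, ginv g z s r * alt22 (fun p s r q =>
          nablaBar g ![Slot.lo, Slot.loBar, Slot.lo, Slot.loBar, Slot.lo] D z ![k, j, p, s, r, q])
            μ s r l := by
  have hη' : ∀ y p s r q, η y ![p, s, r, q] = S y ![p, s, r, q] - S y ![r, s, p, q]
      - S y ![p, q, r, s] + S y ![r, q, p, s] := fun y p s r q => hη y p s r q
  have hSd : ∀ y ∈ U, ∀ I, DifferentiableAt ℝ (fun y => S y I) y := fun y hy I =>
    smooth_differentiableAt hg.isOpen hy (hS I)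
  have hDd : ∀ j p s r q, DifferentiableAt ℝ (fun y => D y ![j, p, s, r, q]) z :=
    fun j p s r q => smooth_differentiableAt hg.isOpen hz (hD j p s r q)
  have hc : ∀ y μ l, contr22 g η y ![μ, l] = ∑ s, ∑ r, ginv g y s r * η y ![μ, s, r, l] :=
    fun _ _ _ => rfl
  -- The parallel metric lets `∇_j` pass through the contraction. The identity is proved on all of
  -- `U` because it is differentiated again.
  have h1 : ∀ y ∈ U, ∀ μ l, nabla g ![Slot.loBar, Slot.lo] (contr22 g η) y ![j, μ, l]
      = ∑ s, ∑ r, ginv g y s r *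
        (D y ![j, μ, s, r, l] - D y ![j, r, s, μ, l] - D y ![j, μ, l, r, s]
          + D y ![j, r, l, μ, s]) := by
    intro y hy μ l
    have hd := hSd y hy
    rw [nabla_loBar_lo]
    simp only [hc]
    rw [hg.dz_contr hy (A := fun r s y => η y ![μ, s, r, l])
      (fun r s => by simp only [hη']; fun_prop) j]
    have e : ∀ s r, dz j (fun y => η y ![μ, s, r, l]) y
        = dz j (fun y => S y ![μ, s, r, l]) y - dz j (fun y => S y ![r, s, μ, l]) y
          - dz j (fun y => S y ![μ, l, r, s]) y + dz j (fun y => S y ![r, l, μ, s]) y := by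
      intro s r
      simp only [hη']
      rw [dz_add j (by fun_prop) (by fun_prop), dz_sub j (by fun_prop) (by fun_prop),
        dz_sub j (by fun_prop) (by fun_prop)]
    have hDe : ∀ p s r q, D y ![j, p, s, r, q] = _ := fun p s r q =>
      (hSD y hy j p s r q).symm.trans (nabla_loBar_lo_loBar_lo g y S j p s r q)
    simp only [e, hDe]
    simp only [hη']
    simp only [Fin.sum_univ_three]
    ring
  have h2 : dbard11 g (contr22 g η) z ![k, j, μ, l]
      = nablaBar g ![Slot.lo, Slot.loBar, Slot.lo]
        (nabla g ![Slot.loBar, Slot.lo] (contr22 g η)) z ![k, j, μ, l] := rfl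
  rw [h2, nablaBar_lo_loBar_lo, dzbar_congr_on k hg.isOpen hz fun y hy => h1 y hy μ l,
    hg.dzbar_contr hz (A := fun r s y => D y ![j, μ, s, r, l] - D y ![j, r, s, μ, l]
      - D y ![j, μ, l, r, s] + D y ![j, r, l, μ, s]) (fun r s => by fun_prop) k]
  have e : ∀ s r, dzbar k (fun y => D y ![j, μ, s, r, l] - D y ![j, r, s, μ, l]
      - D y ![j, μ, l, r, s] + D y ![j, r, l, μ, s]) z
        = dzbar k (fun y => D y ![j, μ, s, r, l]) z - dzbar k (fun y => D y ![j, r, s, μ, l]) z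
          - dzbar k (fun y => D y ![j, μ, l, r, s]) z
          + dzbar k (fun y => D y ![j, r, l, μ, s]) z := by
    intro s r
    rw [dzbar_add k (by fun_prop) (by fun_prop), dzbar_sub k (by fun_prop) (by fun_prop),
      dzbar_sub k (by fun_prop) (by fun_prop)]
  simp only [e, h1 z hz, alt22, nablaBar_lo_loBar_lo_loBar_lo]
  simp only [Fin.sum_univ_three]
  ring

theorem dbard11_contr22_trRmRm (k j μ l : Fin 3) :
    dbard11 g (contr22 g (trRmRm g)) z ![k, j, μ, l]
      = ∑ s, ∑ r, ginv g z s r *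
          (2 * alt22 (fun μ s r l => ∑ α, ∑ β,
              Rm g z ![r, l, β, α] * dbardRm g z ![k, j, μ, s, α, β]) μ s r l
            + alt22 (fun μ s r l => ∑ α, ∑ β,
              (dRm g z ![j, μ, s, α, β] * dbarRm g z ![k, r, l, β, α]
                + dbarRm g z ![k, μ, s, α, β] * dRm g z ![j, r, l, β, α])) μ s r l) := by
  rw [hg.dbard11_contr22_alt hz hg.smooth_trRR (trRmRm_eq g) hg.smooth_dtrRR
    (fun y hy => hg.nabla_trRR hy)]
  refine Finset.sum_congr rfl fun s _ => Finset.sum_congr rfl fun r _ => ?_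
  congr 1
  have h1 := alt22_swap (fun μ s r l => ∑ α, ∑ β,
    Rm g z ![r, l, β, α] * dbardRm g z ![k, j, μ, s, α, β]) μ s r l
  have h2 := alt22_swap (fun μ s r l => ∑ α, ∑ β,
    (dRm g z ![j, μ, s, α, β] * dbarRm g z ![k, r, l, β, α]
      + dbarRm g z ![k, μ, s, α, β] * dRm g z ![j, r, l, β, α])) μ s r l
  simp only [hg.nablaBar_dtrRR hz]
  simp only [alt22] at h1 h2 ⊢
  linear_combination h1 + h2

end SmoothMetricOn

/-! ### The Ricci tensors and the contraction of `Ψ`. -/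

namespace SmoothMetricOn
variable {g : MetricField} {U : Set C3} (hg : SmoothMetricOn g U) {z : C3} (hz : z ∈ U)
include hg

theorem smooth_TorTr (m : Fin 3) : ContDiffOn ℝ ∞ (fun y => TorTr g y m) U :=
  ContDiffOn.sum fun j _ => ContDiffOn.sum fun k _ => (hg.smooth_ginv j k).mul (hg.smooth_Tor _)

include hz

theorem TorTr_eq (m : Fin 3) :
    TorTr g z m = ∑ p, Gam g z p p m - ∑ p, Gam g z m p p := by
  have h : TorTr g z m = ∑ p, TorUp g z ![p, p, m] := rfl
  simp only [h, hg.TorUp_eq hz, Finset.sum_sub_distrib]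

/-- The trace of the torsion is the difference of the two traces of the connection, and `∂_{k̄}`
turns each of these into minus a Ricci tensor. -/
theorem RicPrime_eq (k m : Fin 3) :
    RicPrime g z ![k, m] = Ric g z ![k, m] - dzbar k (fun y => TorTr g y m) z := by
  have hG := hg.differentiableAt_Gam hz
  have h1 : RicPrime g z ![k, m] = ∑ p, Rm g z ![k, p, p, m] := rfl
  have h2 : Ric g z ![k, m] = ∑ p, Rm g z ![k, m, p, p] := rfl
  rw [dzbar_congr_on k hg.isOpen hz fun y hy => hg.TorTr_eq hy m,
    dzbar_sub k (by fun_prop) (by fun_prop), dzbar_sum _ _ fun p => by fun_prop,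
    dzbar_sum _ _ fun p => by fun_prop]
  simp only [dzbar_Gam, h1, h2, Finset.sum_neg_distrib]
  ring

theorem contr_RmLow_eq_RicPrime (p q : Fin 3) :
    ∑ s, ∑ r, ginv g z s r * RmLow g z ![p, s, r, q] = RicPrime g z ![p, q] := by
  have h1 : ∀ s r, RmLow g z ![p, s, r, q] = ∑ m, g z r m * Rm g z ![p, s, m, q] :=
    fun _ _ => rfl
  simp only [h1, hg.raise_lower hz (fun m => Rm g z ![p, _, m, q])]
  rfl

theorem contr_RmLow_eq_Ric (p q : Fin 3) :
    ∑ s, ∑ r, ginv g z s r * RmLow g z ![p, q, r, s] = Ric g z ![p, q] := by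
  have h1 : ∀ s r, RmLow g z ![p, q, r, s] = ∑ m, g z r m * Rm g z ![p, q, m, s] :=
    fun _ _ => rfl
  simp only [h1, hg.raise_lower hz (fun m => Rm g z ![p, q, m, _])]
  rfl

theorem star_Ric (p q : Fin 3) : star (Ric g z ![p, q]) = Ric g z ![q, p] := by
  rw [← hg.contr_RmLow_eq_Ric hz, ← hg.contr_RmLow_eq_Ric hz]
  simp only [star_sum, star_mul, hg.star_RmLow hz, hg.star_ginv hz]
  rw [Finset.sum_comm]
  refine Finset.sum_congr rfl fun _ _ => Finset.sum_congr rfl fun _ _ => by ring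

/-- Without the Kähler symmetries this is a further trace of the curvature; Hermitian symmetry
reduces it to the conjugate of `R'`. -/
theorem contr_RmLow_eq_star_RicPrime (p q : Fin 3) :
    ∑ s, ∑ r, ginv g z s r * RmLow g z ![r, q, p, s] = star (RicPrime g z ![q, p]) := by
  rw [← hg.contr_RmLow_eq_RicPrime hz]
  simp only [star_sum, star_mul, hg.star_RmLow hz, hg.star_ginv hz]
  rw [Finset.sum_comm]
  refine Finset.sum_congr rfl fun _ _ => Finset.sum_congr rfl fun _ _ => by ring

theorem contr_RmLow_eq_trRm (p q : Fin 3) :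
    ∑ s, ∑ r, ginv g z s r * RmLow g z ![r, s, p, q] = ∑ m, g z p m * trRm g z ![m, q] := by
  have h1 : ∀ s r, RmLow g z ![r, s, p, q] = ∑ m, g z p m * Rm g z ![r, s, m, q] :=
    fun _ _ => rfl
  have h2 : ∀ m, trRm g z ![m, q] = ∑ s, ∑ r, ginv g z s r * Rm g z ![r, s, m, q] :=
    fun _ => rfl
  simp only [h1, h2, Finset.mul_sum]
  simp only [Fin.sum_univ_three]
  ring

theorem TT_eq (k j : Fin 3) :
    TT g z ![k, j] = ∑ m, ∑ l, ginv g z m l * ∑ a, ∑ b,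
      TorBarUp g z ![a, l, k] * g z a b * TorUp g z ![b, m, j] := by
  have h1 : ∀ s l, TorBar g z ![s, l, k] = ∑ a, TorBarUp g z ![a, l, k] * g z a s := by
    intro s l
    have e : ∀ a, TorBarUp g z ![a, l, k] = ∑ c, TorBar g z ![c, l, k] * ginv g z c a := by
      intro a
      simp only [mul_comm _ (ginv g z _ a)]
      rfl
    simp only [e]
    exact (hg.lower_raise_right hz (fun c => TorBar g z ![c, l, k]) s).symm
  have h2 : ∀ b m, TorUp g z ![b, m, j] = ∑ r, ginv g z b r * Tor g z ![r, m, j] :=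
    fun _ _ => rfl
  have h3 : TT g z ![k, j] = ∑ s, ∑ r, ∑ m, ∑ l, ginv g z s r * ginv g z m l
    * Tor g z ![r, m, j] * TorBar g z ![s, l, k] := rfl
  have h4 : TT g z ![k, j] = ∑ m, ∑ l, ginv g z m l * ∑ s, TorUp g z ![s, m, j]
      * TorBar g z ![s, l, k] := by
    rw [h3]
    simp only [h2, Fin.sum_univ_three]
    ring
  rw [h4]
  simp only [h1, Fin.sum_univ_three]
  ring

/-- The components of `i∂∂̄ω`. -/
theorem ddbar11_omega (p s r q : Fin 3) :
    Complex.I * ddbar11 (omega g) z ![p, s, r, q]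
      = alt22 (fun p s r q => RmLow g z ![r, q, p, s]) p s r q
        + ∑ a, ∑ b, TorBarUp g z ![a, r, p] * g z a b * TorUp g z ![b, s, q] := by
  have hd : ∀ r p s, DifferentiableAt ℝ (dzbar r (fun y => g y p s)) z := fun r p s =>
    smooth_differentiableAt hg.isOpen hz (hg.smooth_dzbar_g r p s)
  have h1 : ∀ p s r q, dz q (dzbar r (fun y => omega g y ![p, s])) z
      = Complex.I * dzbar r (dz q (fun y => g y p s)) z := by
    intro p s r q
    have e : ∀ y ∈ U, dzbar r (fun y => omega g y ![p, s]) y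
        = Complex.I * dzbar r (fun y => g y p s) y := fun y hy =>
      dzbar_const_mul r Complex.I (hg.differentiableAt_g hy p s)
    rw [dz_congr_on q hg.isOpen hz e, dz_const_mul q _ (hd r p s),
      dz_dzbar_comm q r hg.isOpen hz (hg.smooth p s)]
  have h2 : ddbar11 (omega g) z ![p, s, r, q]
      = alt22 (fun p s r q => dz q (dzbar r (fun y => omega g y ![p, s])) z) p s r q := rfl
  rw [h2]
  -- Since `ω` is `i g`, the factor `i · i = -1` gives `-∂∂̄g`, the leading part of the curvature.
  -- The quadratic connection terms in `RmLow` skew-symmetrize to minus a product of torsions, which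
  -- the added torsion term cancels.
  simp only [h1, alt22, hg.RmLow_eq hz, hg.TorUp_eq hz, hg.TorBarUp_eq hz, Fin.sum_univ_three]
  linear_combination (dzbar r (dz q (fun y => g y p s)) z - dzbar p (dz q (fun y => g y r s)) z
    - dzbar r (dz s (fun y => g y p q)) z + dzbar p (dz s (fun y => g y r q)) z) * Complex.I_mul_I

/-- The four skew-symmetrized curvature terms contract to `½ Ric`, `-Ric`, minus the trace over the
form indices, and `½ Ric`. The Ricci terms cancel because `hRic` makes `R' = ½ Ric` and `Ric` is
Hermitian. -/
theorem contr22_ddbar11_omega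
    (hRic : ∀ k j, dzbar k (fun y => TorTr g y j) z = 1 / 2 * Ric g z ![k, j]) (μ l : Fin 3) :
    ∑ s, ∑ r, ginv g z s r * (Complex.I * ddbar11 (omega g) z ![μ, s, r, l])
      = - (∑ m, g z μ m * trRm g z ![m, l]) + TT g z ![μ, l] := by
  have hR' : ∀ k m, RicPrime g z ![k, m] = 1 / 2 * Ric g z ![k, m] := by
    intro k m; rw [hg.RicPrime_eq hz, hRic]; ring
  have h1 : ∑ s, ∑ r, ginv g z s r * RmLow g z ![r, l, μ, s] = 1 / 2 * Ric g z ![μ, l] := by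
    rw [hg.contr_RmLow_eq_star_RicPrime hz, hR', star_mul, hg.star_Ric hz]
    simp [mul_comm]
  have h2 := hg.contr_RmLow_eq_Ric hz μ l
  have h3 := hg.contr_RmLow_eq_trRm hz μ l
  have h4 := hg.contr_RmLow_eq_RicPrime hz μ l
  rw [hR'] at h4
  simp only [hg.ddbar11_omega hz, alt22, mul_add, mul_sub, Finset.sum_add_distrib,
    Finset.sum_sub_distrib, ← hg.TT_eq hz]
  linear_combination h1 - h2 - h3 + h4

theorem contr22_Psi
    (hRic : ∀ k j, dzbar k (fun y => TorTr g y j) z = 1 / 2 * Ric g z ![k, j])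
    (α' : ℝ) (Φ : TField 4) (μ l : Fin 3) :
    contr22 g (Psi α' Φ g) z ![μ, l] = - (∑ m, g z μ m * trRm g z ![m, l])
      + (TT g z ![μ, l] + (α' : ℂ) * contr22 g Φ z ![μ, l])
      - (α' : ℂ) * contr22 g (trRmRm g) z ![μ, l] := by
  have h1 : contr22 g (Psi α' Φ g) z ![μ, l] = ∑ s, ∑ r, ginv g z s r *
      (Complex.I * ddbar11 (omega g) z ![μ, s, r, l]
        - (α' : ℂ) * (trRmRm g z ![μ, s, r, l] - Φ z ![μ, s, r, l])) := rfl
  have h2 : ∀ η : TField 4, contr22 g η z ![μ, l] = ∑ s, ∑ r, ginv g z s r * η z ![μ, s, r, l] :=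
    fun _ => rfl
  have h3 := hg.contr22_ddbar11_omega hz hRic μ l
  rw [h1, h2, h2]
  simp only [Fin.sum_univ_three] at h3 ⊢
  linear_combination h3

theorem PsiUp_eq
    (hRic : ∀ k j, dzbar k (fun y => TorTr g y j) z = 1 / 2 * Ric g z ![k, j])
    (α' : ℝ) (Φ : TField 4) (ρ l : Fin 3) :
    PsiUp α' Φ g z ![ρ, l] = - trRm g z ![ρ, l]
      + (∑ μ, ginv g z ρ μ * (TT g z ![μ, l] + (α' : ℂ) * contr22 g Φ z ![μ, l]))
      - (α' : ℂ) * ∑ μ, ginv g z ρ μ * contr22 g (trRmRm g) z ![μ, l] := by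
  have h1 : PsiUp α' Φ g z ![ρ, l] = ∑ μ, ginv g z ρ μ * contr22 g (Psi α' Φ g) z ![μ, l] := rfl
  have h2 := hg.raise_lower hz (fun m => trRm g z ![m, l]) ρ
  rw [h1]
  simp only [hg.contr22_Psi hz hRic]
  simp only [Fin.sum_univ_three] at h2 ⊢
  linear_combination -h2

theorem nabla_raise {A : TField 2} (hA : ∀ I, ContDiffOn ℝ ∞ (fun y => A y I) U) (j ρ l : Fin 3) :
    nabla g ![Slot.up, Slot.lo] (fun y I => ∑ μ, ginv g y (I 0) μ * A y ![μ, I 1]) z ![j, ρ, l]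
      = ∑ μ, ginv g z ρ μ * nabla g ![Slot.loBar, Slot.lo] A z ![j, μ, l] := by
  have h1 : dz j (fun y => ∑ μ, ginv g y ρ μ * A y ![μ, l]) z = _ :=
    hg.dz_raise hz (A := fun μ y => A y ![μ, l])
      (fun μ => smooth_differentiableAt hg.isOpen hz (hA _)) j ρ
  rw [nabla_up_lo]
  simp only [nabla_loBar_lo]
  have e : dz j (fun y => (fun (y : C3) (I : Fin 2 → Fin 3) =>
      ∑ μ, ginv g y (I 0) μ * A y ![μ, I 1]) y ![ρ, l]) z
      = dz j (fun y => ∑ μ, ginv g y ρ μ * A y ![μ, l]) z := rfl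
  rw [e, h1]
  simp only [Matrix.cons_val_zero, Matrix.cons_val_one, Fin.sum_univ_three]
  ring

theorem smooth_nabla_loBar_lo {A : TField 2} (hA : ∀ I, ContDiffOn ℝ ∞ (fun y => A y I) U)
    (j μ l : Fin 3) :
    ContDiffOn ℝ ∞ (fun y => nabla g ![Slot.loBar, Slot.lo] A y ![j, μ, l]) U := by
  have h3 := hg.smooth_Gam
  have h4 := smooth_dz j hg.isOpen (hA ![μ, l])
  simp only [nabla_loBar_lo]
  fun_prop

/-- Moves the raised index `ρ` outside both derivatives; the conjugate connection from `∂_{k̄}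
g^{ρμ̄}` becomes the connection term on the barred slot. -/
theorem nablaBar_nabla_raise {A : TField 2} (hA : ∀ I, ContDiffOn ℝ ∞ (fun y => A y I) U)
    (k j ρ l : Fin 3) :
    nablaBar g ![Slot.lo, Slot.up, Slot.lo] (nabla g ![Slot.up, Slot.lo]
        (fun y I => ∑ μ, ginv g y (I 0) μ * A y ![μ, I 1])) z ![k, j, ρ, l]
      = ∑ μ, ginv g z ρ μ * dbard11 g A z ![k, j, μ, l] := by
  rw [nablaBar_lo_up_lo, dzbar_congr_on k hg.isOpen hz fun y hy => hg.nabla_raise hy hA j ρ l,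
    hg.dzbar_raise hz (A := fun μ y => nabla g ![Slot.loBar, Slot.lo] A y ![j, μ, l])
      (fun μ => smooth_differentiableAt hg.isOpen hz (hg.smooth_nabla_loBar_lo hz hA j μ l)) k ρ]
  refine Finset.sum_congr rfl fun μ _ => ?_
  congr 1
  exact (nablaBar_lo_loBar_lo g z _ k j μ l).symm

end SmoothMetricOn

/-! ### Assembling `-∇_{k̄} ∇_j Ψ`. -/

theorem sum_mul_sum_combination (G : Fin 3 → ℂ) (H : Fin 3 → Fin 3 → ℂ)
    (X Y Z : Fin 3 → Fin 3 → Fin 3 → ℂ) :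
    ∑ μ, G μ * ∑ s, ∑ r, H s r * (2 * (X μ s r + Y μ s r) + Z μ s r)
      = 2 * (∑ μ, ∑ s, ∑ r, G μ * H s r * X μ s r) + 2 * (∑ μ, ∑ s, ∑ r, G μ * H s r * Y μ s r)
        + ∑ μ, ∑ s, ∑ r, G μ * H s r * Z μ s r := by
  simp only [Finset.mul_sum, ← Finset.sum_add_distrib]
  refine Finset.sum_congr rfl fun _ _ => Finset.sum_congr rfl fun _ _ =>
    Finset.sum_congr rfl fun _ _ => by ring

namespace SmoothMetricOn
variable {g : MetricField} {U : Set C3} (hg : SmoothMetricOn g U) {z : C3} (hz : z ∈ U)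
include hg

theorem smooth_trRm (I : Fin 2 → Fin 3) : ContDiffOn ℝ ∞ (fun y => trRm g y I) U :=
  ContDiffOn.sum fun s _ => ContDiffOn.sum fun r _ => (hg.smooth_ginv s r).mul (hg.smooth_Rm _)

theorem smooth_trRmRm (I : Fin 4 → Fin 3) : ContDiffOn ℝ ∞ (fun y => trRmRm g y I) U := by
  have h := hg.smooth_Rm
  simp only [trRmRm, wedge11, alt22]
  fun_prop

theorem smooth_contr22 {η : TField 4} (hη : ∀ I, ContDiffOn ℝ ∞ (fun y => η y I) U)
    (I : Fin 2 → Fin 3) : ContDiffOn ℝ ∞ (fun y => contr22 g η y I) U :=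
  ContDiffOn.sum fun s _ => ContDiffOn.sum fun r _ => (hg.smooth_ginv s r).mul (hη _)

theorem smooth_raise {A : TField 2} (hA : ∀ I, ContDiffOn ℝ ∞ (fun y => A y I) U)
    (I : Fin 2 → Fin 3) :
    ContDiffOn ℝ ∞ (fun y => ∑ μ, ginv g y (I 0) μ * A y ![μ, I 1]) U :=
  ContDiffOn.sum fun μ _ => (hg.smooth_ginv _ μ).mul (hA _)

theorem smooth_nabla_up_lo {A : TField 2} (hA : ∀ I, ContDiffOn ℝ ∞ (fun y => A y I) U)
    (j ρ l : Fin 3) :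
    ContDiffOn ℝ ∞ (fun y => nabla g ![Slot.up, Slot.lo] A y ![j, ρ, l]) U := by
  have h3 := hg.smooth_Gam
  have h4 := smooth_dz j hg.isOpen (hA ![ρ, l])
  simp only [nabla_up_lo]
  fun_prop

include hz

theorem nabla_up_lo_combination {P A B C : TField 2} (c : ℂ)
    (hA : ∀ I, ContDiffOn ℝ ∞ (fun y => A y I) U) (hB : ∀ I, ContDiffOn ℝ ∞ (fun y => B y I) U)
    (hC : ∀ I, ContDiffOn ℝ ∞ (fun y => C y I) U)
    (hP : ∀ y ∈ U, ∀ ρ l, P y ![ρ, l] = - A y ![ρ, l] + B y ![ρ, l] - c * C y ![ρ, l])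
    (j ρ l : Fin 3) :
    nabla g ![Slot.up, Slot.lo] P z ![j, ρ, l] = - nabla g ![Slot.up, Slot.lo] A z ![j, ρ, l]
      + nabla g ![Slot.up, Slot.lo] B z ![j, ρ, l]
      - c * nabla g ![Slot.up, Slot.lo] C z ![j, ρ, l] := by
  have dA := fun I => smooth_differentiableAt hg.isOpen hz (hA I)
  have dB := fun I => smooth_differentiableAt hg.isOpen hz (hB I)
  have dC := fun I => smooth_differentiableAt hg.isOpen hz (hC I)
  simp only [nabla_up_lo]
  rw [dz_congr_on j hg.isOpen hz fun y hy => hP y hy ρ l, dz_sub j (by fun_prop) (by fun_prop),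
    dz_add j (by fun_prop) (by fun_prop), dz_neg, dz_const_mul j c (dC _)]
  simp only [hP z hz, Fin.sum_univ_three]
  ring

theorem nablaBar_nabla_combination {P A B C : TField 2} (c : ℂ)
    (hA : ∀ I, ContDiffOn ℝ ∞ (fun y => A y I) U) (hB : ∀ I, ContDiffOn ℝ ∞ (fun y => B y I) U)
    (hC : ∀ I, ContDiffOn ℝ ∞ (fun y => C y I) U)
    (hP : ∀ y ∈ U, ∀ ρ l, P y ![ρ, l] = - A y ![ρ, l] + B y ![ρ, l] - c * C y ![ρ, l])
    (k j ρ l : Fin 3) :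
    dzbar k (fun y => nabla g ![Slot.up, Slot.lo] P y ![j, ρ, l]) z
      = - nablaBar g ![Slot.lo, Slot.up, Slot.lo] (nabla g ![Slot.up, Slot.lo] A) z ![k, j, ρ, l]
      + nablaBar g ![Slot.lo, Slot.up, Slot.lo] (nabla g ![Slot.up, Slot.lo] B) z ![k, j, ρ, l]
      - c * nablaBar g ![Slot.lo, Slot.up, Slot.lo] (nabla g ![Slot.up, Slot.lo] C) z
          ![k, j, ρ, l] := by
  have dA := smooth_differentiableAt hg.isOpen hz (hg.smooth_nabla_up_lo hA j ρ l)
  have dB := smooth_differentiableAt hg.isOpen hz (hg.smooth_nabla_up_lo hB j ρ l)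
  have dC := smooth_differentiableAt hg.isOpen hz (hg.smooth_nabla_up_lo hC j ρ l)
  simp only [nablaBar_lo_up_lo]
  rw [dzbar_congr_on k hg.isOpen hz fun y hy =>
      hg.nabla_up_lo_combination hy c hA hB hC hP j ρ l, dzbar_sub k (by fun_prop) (by fun_prop),
    dzbar_add k (by fun_prop) (by fun_prop), dzbar_neg, dzbar_const_mul k c dC]

/-- The curvature terms in `-∇_{k̄} ∇_j Ψ^ρ{}_l`, when the Ricci curvature is determined by the
torsion. -/
theorem neg_dzbar_nabla_PsiUp
    (hRic : ∀ y ∈ U, ∀ k j, dzbar k (fun y => TorTr g y j) y = 1 / 2 * Ric g y ![k, j])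
    (α' : ℝ) {Φ : TField 4} (hΦ : ∀ I, ContDiffOn ℝ ∞ (fun y => Φ y I) U) (k j ρ l : Fin 3) :
    - dzbar k (fun y => nabla g ![Slot.up, Slot.lo] (PsiUp α' Φ g) y ![j, ρ, l]) z
      = (lapRm g z ![k, j, ρ, l]
          + 2 * (α' : ℂ) * ∑ μ, ∑ s, ∑ r, ginv g z ρ μ * ginv g z s r *
              alt22 (fun μ s r l => ∑ α, ∑ β,
                Rm g z ![r, l, β, α] * ddbarRm g z ![s, μ, k, j, α, β]) μ s r l)
        - ∑ μ, ginv g z ρ μ *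
            dbard11 g (fun y I => TT g y I + (α' : ℂ) * contr22 g Φ y I) z ![k, j, μ, l]
        + (nablaBar g ![Slot.lo, Slot.up, Slot.lo] (torRm g) z ![k, j, ρ, l]
          + (∑ s, ∑ γ, ginv g z s γ *
              nabla g ![Slot.loBar, Slot.loBar, Slot.lo, Slot.up, Slot.lo] (torBarRm g) z
                ![s, γ, k, j, ρ, l])
          - (∑ κ, RicPrimeUp g z ![k, κ] * Rm g z ![κ, j, ρ, l])
          + (∑ s, ∑ κ, Rm g z ![k, s, κ, j] * RmUp g z ![s, κ, ρ, l])
          - (∑ s, ∑ κ, RmUpUp g z ![k, s, ρ, κ] * RmLowUp g z ![s, j, κ, l])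
          + (∑ s, ∑ κ, Rm g z ![k, s, κ, l] * RmUp g z ![s, j, ρ, κ]))
        + (α' : ℂ) * (∑ μ, ∑ s, ∑ r, ginv g z ρ μ * ginv g z s r *
            alt22 (fun μ s r l => ∑ α, ∑ β,
              (dRm g z ![j, μ, s, α, β] * dbarRm g z ![k, r, l, β, α]
                + dbarRm g z ![k, μ, s, α, β] * dRm g z ![j, r, l, β, α])) μ s r l)
        + 2 * (α' : ℂ) * (∑ μ, ∑ s, ∑ r, ginv g z ρ μ * ginv g z s r *
            alt22 (fun μ s r l => ∑ β, ∑ δ, RmUpUp g z ![r, l, β, δ] *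
              (nablaBar g ![Slot.lo, Slot.lo, Slot.loBar, Slot.loBar, Slot.lo] (torRmLow g) z
                  ![k, s, j, μ, δ, β]
                + nabla g ![Slot.loBar, Slot.loBar, Slot.lo, Slot.loBar, Slot.lo] (torBarRmLow g) z
                  ![s, μ, k, j, δ, β]
                - (∑ κ, RmBar g z ![k, s, μ, κ] * RmLow g z ![κ, j, δ, β])
                + (∑ κ, Rm g z ![k, s, κ, j] * RmLow g z ![μ, κ, δ, β])
                - (∑ κ, RmBar g z ![k, s, δ, κ] * RmLow g z ![μ, j, κ, β])
                + (∑ κ, Rm g z ![k, s, κ, β] * RmLow g z ![μ, j, δ, κ]))) μ s r l) := by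
  have hA1 : ∀ I, ContDiffOn ℝ ∞ (fun y => TT g y I + (α' : ℂ) * contr22 g Φ y I) U := fun I =>
    (hg.smooth_TT I).add (contDiffOn_const.mul (hg.smooth_contr22 hΦ I))
  have hA2 := hg.smooth_contr22 hg.smooth_trRmRm
  -- The split of `Ψ` holds on all of `U`, which allows it to be differentiated twice. Its parts are
  -- the contracted curvature, the `TT̄ + α'Φ` part and the `α'` curvature part.
  have h := hg.nablaBar_nabla_combination hz (P := PsiUp α' Φ g) (α' : ℂ) hg.smooth_trRm
    (hg.smooth_raise hA1) (hg.smooth_raise hA2)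
    (fun y hy ρ l => hg.PsiUp_eq hy (hRic y hy) α' Φ ρ l) k j ρ l
  rw [h, hg.nablaBar_nabla_raise hz hA1, hg.nablaBar_nabla_raise hz hA2,
    hg.nablaBar_nabla_trRm_eq_lapRm hz]
  have e := fun μ => hg.dbard11_contr22_trRmRm hz k j μ l
  have add : ∀ (x y : Fin 3 → Fin 3 → Fin 3 → Fin 3 → ℂ) (p s r q : Fin 3),
      alt22 (fun p s r q => x p s r q + y p s r q) p s r q = alt22 x p s r q + alt22 y p s r q := by
    intro x y p s r q; simp only [alt22]; ring
  simp only [hg.trace_dbardRm hz] at e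
  simp only [add (fun μ s r l => ∑ α, ∑ β,
    Rm g z ![r, l, β, α] * ddbarRm g z ![s, μ, k, j, α, β])] at e
  simp only [e]
  rw [sum_mul_sum_combination]
  ring

end SmoothMetricOn

/-! ### The logarithmic derivative of `N` for conformally balanced metrics. -/

theorem wedge11_omega (g : MetricField) (z : C3) (p s r q : Fin 3) :
    wedge11 (omega g) (omega g) z ![p, s, r, q]
      = -2 * (g z r q * g z p s - g z p q * g z r s) := by
  have h : wedge11 (omega g) (omega g) z ![p, s, r, q]
    = alt22 (fun p s r q => (Complex.I * g z r q) * (Complex.I * g z p s)) p s r q := rfl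
  rw [h]
  simp only [alt22]
  linear_combination (2 * (g z r q * g z p s - g z p q * g z r s)) * Complex.I_mul_I

namespace SmoothMetricOn
variable {g : MetricField} {U : Set C3} (hg : SmoothMetricOn g U) {z : C3} (hz : z ∈ U)
include hg hz

theorem eq_zero_of_lower_eq_zero {A : Fin 3 → ℂ} (h : ∀ p, ∑ m, g z p m * A m = 0) (u : Fin 3) :
    A u = 0 := by
  rw [← hg.raise_lower hz A u]
  simp only [h, mul_zero, Finset.sum_const_zero]

/-- If `d(N ω²) = 0`, then `∂_a N = N T_a`. -/
theorem dz_eq_mul_TorTr {N : C3 → ℂ} (hN : DifferentiableAt ℝ N z)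
    (h : ∀ p r a s q : Fin 3,
      dz a (fun y => N y * wedge11 (omega g) (omega g) y ![p, s, r, q]) z
        + dz s (fun y => N y * wedge11 (omega g) (omega g) y ![p, q, r, a]) z
        + dz q (fun y => N y * wedge11 (omega g) (omega g) y ![p, a, r, s]) z = 0) (a : Fin 3) :
    dz a N z = N z * TorTr g z a := by
  have h0 := hg.differentiableAt_g hz
  have e : ∀ a p s r q, dz a (fun y => N y * wedge11 (omega g) (omega g) y ![p, s, r, q]) z
      = -2 * (dz a N z * (g z r q * g z p s - g z p q * g z r s)
        + N z * (dz a (fun y => g y r q) z * g z p s + g z r q * dz a (fun y => g y p s) z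
          - dz a (fun y => g y p q) z * g z r s - g z p q * dz a (fun y => g y r s) z)) := by
    intro a p s r q
    simp only [wedge11_omega]
    rw [dz_mul a hN (by fun_prop), dz_const_mul a _ (by fun_prop),
      dz_sub a (by fun_prop) (by fun_prop), dz_mul a (h0 _ _) (h0 _ _), dz_mul a (h0 _ _) (h0 _ _)]
    ring
  simp only [e] at h
  have hT : ∀ p b c, ∑ m, g z p m * (Gam g z b m c - Gam g z c m b)
      = dz b (fun y => g y p c) z - dz c (fun y => g y p b) z := by
    intro p b c
    simp only [mul_sub, Finset.sum_sub_distrib, ← hg.dz_g hz]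
  -- `d` is the Kronecker delta, `T` the torsion with its barred index raised, `t` the same torsion
  -- lowered. Every term of the closedness equation carries lowered indices `p̄` and `r̄`, which are
  -- stripped off one after the other by nondegeneracy of `g`.
  let d : Fin 3 → Fin 3 → ℂ := fun m c => if m = c then 1 else 0
  have hd : ∀ p c, ∑ m, g z p m * d m c = g z p c := by
    intro p c; simp [d]
  let T : Fin 3 → Fin 3 → Fin 3 → ℂ := fun m b c => Gam g z b m c - Gam g z c m b
  let t : Fin 3 → Fin 3 → Fin 3 → ℂ := fun p b c =>
    dz b (fun y => g y p c) z - dz c (fun y => g y p b) z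
  have h1 : ∀ a s q u r, dz a N z * (g z r q * d u s - d u q * g z r s)
      + dz s N z * (g z r a * d u q - d u a * g z r q)
      + dz q N z * (g z r s * d u a - d u s * g z r a)
      + N z * (g z r q * T u a s + d u s * t r a q - d u q * t r a s - g z r s * T u a q
        + g z r a * T u s q - d u a * t r s q) = 0 := by
    intro a s q u r
    refine hg.eq_zero_of_lower_eq_zero hz (A := fun u =>
      dz a N z * (g z r q * d u s - d u q * g z r s)
      + dz s N z * (g z r a * d u q - d u a * g z r q)
      + dz q N z * (g z r s * d u a - d u s * g z r a)
      + N z * (g z r q * T u a s + d u s * t r a q - d u q * t r a s - g z r s * T u a q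
        + g z r a * T u s q - d u a * t r s q)) (fun p => ?_) u
    have h2 := h p r a s q
    have e1 := hd p
    have e2 := hT p
    have e3 : ∀ b c, ∑ m, g z p m * T m b c = t p b c := e2
    calc _ = dz a N z * (g z r q * (∑ m, g z p m * d m s) - (∑ m, g z p m * d m q) * g z r s)
      + dz s N z * (g z r a * (∑ m, g z p m * d m q) - (∑ m, g z p m * d m a) * g z r q)
      + dz q N z * (g z r s * (∑ m, g z p m * d m a) - (∑ m, g z p m * d m s) * g z r a)
      + N z * (g z r q * (∑ m, g z p m * T m a s) + (∑ m, g z p m * d m s) * t r a q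
        - (∑ m, g z p m * d m q) * t r a s - g z r s * (∑ m, g z p m * T m a q)
        + g z r a * (∑ m, g z p m * T m s q) - (∑ m, g z p m * d m a) * t r s q) := by
          simp only [Fin.sum_univ_three]; ring
      _ = 0 := by
          simp only [e1, e3, t]
          -- The factor undoes the `-2` in the components of `ω²`.
          linear_combination (-1 / 2) * h2
  have h2 : ∀ a s q u v, dz a N z * (d v q * d u s - d u q * d v s)
      + dz s N z * (d v a * d u q - d u a * d v q)
      + dz q N z * (d v s * d u a - d u s * d v a)
      + N z * (d v q * T u a s + d u s * T v a q - d u q * T v a s - d v s * T u a q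
        + d v a * T u s q - d u a * T v s q) = 0 := by
    intro a s q u v
    refine hg.eq_zero_of_lower_eq_zero hz (A := fun v =>
      dz a N z * (d v q * d u s - d u q * d v s)
      + dz s N z * (d v a * d u q - d u a * d v q)
      + dz q N z * (d v s * d u a - d u s * d v a)
      + N z * (d v q * T u a s + d u s * T v a q - d u q * T v a s - d v s * T u a q
        + d v a * T u s q - d u a * T v s q)) (fun r => ?_) v
    have h2 := h1 a s q u r
    have e1 := hd r
    have e3 : ∀ b c, ∑ m, g z r m * T m b c = t r b c := hT r
    calc _ = dz a N z * ((∑ m, g z r m * d m q) * d u s - d u q * (∑ m, g z r m * d m s))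
      + dz s N z * ((∑ m, g z r m * d m a) * d u q - d u a * (∑ m, g z r m * d m q))
      + dz q N z * ((∑ m, g z r m * d m s) * d u a - d u s * (∑ m, g z r m * d m a))
      + N z * ((∑ m, g z r m * d m q) * T u a s + d u s * (∑ m, g z r m * T m a q)
        - d u q * (∑ m, g z r m * T m a s) - (∑ m, g z r m * d m s) * T u a q
        + (∑ m, g z r m * d m a) * T u s q - d u a * (∑ m, g z r m * T m s q)) := by
          simp only [Fin.sum_univ_three]; ring
      _ = 0 := by
          simp only [e1, e3]
          exact h2
  have h3 : TorTr g z a = ∑ p, T p p a := by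
    rw [hg.TorTr_eq hz, ← Finset.sum_sub_distrib]
  -- Tracing over `u = s` and `v = q`: in dimension three the derivative terms add up to `(6 - 2 -
  -- 2) ∂_a N` and the torsion terms to `-2 N T_a`.
  have h4 : ∑ s, ∑ q, (dz a N z * (d q q * d s s - d s q * d q s)
      + dz s N z * (d q a * d s q - d s a * d q q)
      + dz q N z * (d q s * d s a - d s s * d q a)
      + N z * (d q q * T s a s + d s s * T q a q - d s q * T q a s - d q s * T s a q
        + d q a * T s s q - d s a * T q s q)) = 0 :=
    Finset.sum_eq_zero fun s _ => Finset.sum_eq_zero fun q _ => h2 a s q s q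
  rw [h3]
  have anti : ∀ p s q, T p s q = - T p q s := fun p s q => by simp only [T]; ring
  have a10 := fun p => anti p 1 0
  have a20 := fun p => anti p 2 0
  have a21 := fun p => anti p 2 1
  have a0 : ∀ p s, T p s s = 0 := fun p s => by simp only [T]; ring
  simp only [Fin.sum_univ_three] at h4 ⊢
  fin_cases a <;> simp [d] at h4 ⊢ <;> simp only [a0, a10, a20, a21] at h4 ⊢ <;>
    linear_combination (1 / 2) * h4

end SmoothMetricOn

/-- The cofactor side is polynomial in the entries, so the space and time derivatives of `det g` can
be compared with it by `ring`. -/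
theorem det_mul_trace_inv {M : Matrix (Fin 3) (Fin 3) ℂ} (hM : M.det ≠ 0)
    (M' : Matrix (Fin 3) (Fin 3) ℂ) :
    M.det * ∑ p, ∑ l, M⁻¹ p l * M' l p = ∑ p, ∑ l, M.adjugate p l * M' l p := by
  have h : ∀ p l, M.det * M⁻¹ p l = M.adjugate p l := by
    intro p l
    simp [Matrix.inv_def, Ring.inverse_eq_inv', hM]
  simp only [Finset.mul_sum, ← mul_assoc, h]

/-! ### Holomorphic functions with differentiable logarithmic derivatives. -/

section HolomorphicFunction
variable {F : C3 → ℂ} {U : Set C3} {z : C3}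

theorem dzbar_eq_zero (hF : DifferentiableAt ℂ F z) (j : Fin 3) : dzbar j F z = 0 := by
  have h : fderiv ℝ F z = (fderiv ℂ F z).restrictScalars ℝ := (hF.hasFDerivAt.restrictScalars ℝ).fderiv
  have e : (EuclideanSpace.single j Complex.I : C3) = Complex.I • EuclideanSpace.single j 1 := by
    ext i; simp [PiLp.single_apply]
  rw [dzbar, h, e]
  simp only [ContinuousLinearMap.coe_restrictScalars', map_smul, smul_eq_mul]
  linear_combination (fderiv ℂ F z (EuclideanSpace.single j 1)) / 2 * Complex.I_mul_I

/-- For a holomorphic function the `∂_j` determine the whole real derivative, so regularity of the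
`∂_j F` transfers to `fderiv ℝ F`. -/
theorem fderiv_eq_sum_dz (hF : DifferentiableAt ℂ F z) :
    fderiv ℝ F z = ∑ j, dz j F z • (EuclideanSpace.proj j : C3 →L[ℂ] ℂ).restrictScalars ℝ := by
  have h : fderiv ℝ F z = (fderiv ℂ F z).restrictScalars ℝ := (hF.hasFDerivAt.restrictScalars ℝ).fderiv
  have e : ∀ j, (EuclideanSpace.single j Complex.I : C3) = Complex.I • EuclideanSpace.single j 1 := by
    intro j; ext i; simp [PiLp.single_apply]
  have e2 : ∀ j, dz j F z = fderiv ℂ F z (EuclideanSpace.single j 1) := by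
    intro j
    rw [dz, h, e]
    simp only [ContinuousLinearMap.coe_restrictScalars', map_smul, smul_eq_mul]
    linear_combination -(fderiv ℂ F z (EuclideanSpace.single j 1)) / 2 * Complex.I_mul_I
  ext v
  have hv : v = ∑ j, v j • (EuclideanSpace.single j 1 : C3) := by
    ext i
    simp [Pi.single_apply]
  rw [h]
  conv_lhs => rw [hv]
  simp [e2, mul_comm]

/-- A holomorphic function whose logarithmic derivatives are differentiable has holomorphic
logarithmic derivatives. -/
theorem dzbar_log_deriv_eq_zero (hU : IsOpen U) (hz : z ∈ U) (hF : DifferentiableOn ℂ F U)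
    (hF0 : ∀ y ∈ U, F y ≠ 0) {w : Fin 3 → C3 → ℂ} (hw : ∀ j, DifferentiableAt ℝ (w j) z)
    (h : ∀ y ∈ U, ∀ j, dz j F y = F y * w j y) (k j : Fin 3) : dzbar k (w j) z = 0 := by
  have hFd : ∀ y ∈ U, DifferentiableAt ℂ F y := fun y hy => hF.differentiableAt (hU.mem_nhds hy)
  have hFr : ∀ y ∈ U, DifferentiableAt ℝ F y := fun y hy => (hFd y hy).restrictScalars ℝ
  have hz0 := hFr z hz
  -- Near `z` the derivative of `F` is built from the differentiable products `F w_j`. Hence `F` is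
  -- twice differentiable, which gives `∂_j ∂_{k̄} F = ∂_{k̄} ∂_j F` without prior smoothness of
  -- `F`.
  have e1 : fderiv ℝ F =ᶠ[nhds z] fun y => ∑ j, (F y * w j y) •
      (EuclideanSpace.proj j : C3 →L[ℂ] ℂ).restrictScalars ℝ :=
    Filter.eventuallyEq_of_mem (hU.mem_nhds hz) fun y hy => by
      rw [fderiv_eq_sum_dz (hFd y hy)]
      simp only [h y hy]
  have h2 : DifferentiableAt ℝ (fderiv ℝ F) z := by
    refine DifferentiableAt.congr_of_eventuallyEq ?_ e1
    refine DifferentiableAt.fun_sum fun i _ => ?_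
    exact ((hz0.fun_mul (hw i)).smul_const _)
  have h3 := (dz_dzbar_comm_of_differentiable j k
    (Filter.eventually_of_mem (hU.mem_nhds hz) hFr) h2).1
  rw [dz_congr_on j hU hz fun y hy => dzbar_eq_zero (hFd y hy) k, dz_const,
    dzbar_congr_on k hU hz fun y hy => h y hy j, dzbar_mul k hz0 (hw j),
    dzbar_eq_zero (hFd z hz), zero_mul, zero_add] at h3
  exact (mul_eq_zero.mp h3.symm).resolve_left (hF0 z hz)

end HolomorphicFunction

/-! ### The norm of `Ω` and the Ricci curvature of a conformally balanced metric. -/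

/-- A positive definite smooth metric and a nowhere vanishing holomorphic function, on an open
set. -/
structure MetricVolumeOn (F : C3 → ℂ) (g : MetricField) (U : Set C3) : Prop
    extends SmoothMetricOn g U where
  det_pos : ∀ y ∈ U, 0 < (g y).det.re
  holomorphic : DifferentiableOn ℂ F U
  ne_zero : ∀ y ∈ U, F y ≠ 0

namespace SmoothMetricOn
variable {g : MetricField} {U : Set C3} (hg : SmoothMetricOn g U) {z : C3} (hz : z ∈ U)
include hg hz

/-- Jacobi's formula, since `A_{jp}^p = g^{pl̄} ∂_j g_{l̄p}`. -/
theorem dz_det (j : Fin 3) :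
    dz j (fun y => (g y).det) z = (g z).det * ∑ p, Gam g z j p p := by
  have h0 := hg.differentiableAt_g hz
  have h1 := det_mul_trace_inv (hg.det_ne z hz) (fun l p => dz j (fun y => g y l p) z)
  have h2 : ∑ p, Gam g z j p p = ∑ p, ∑ l, (g z)⁻¹ p l * dz j (fun y => g y l p) z := rfl
  rw [h2, h1]
  simp only [Matrix.det_fin_three]
  have e : ∀ a b c d e f : Fin 3, dz j (fun y => g y a b * g y c d * g y e f) z
      = dz j (fun y => g y a b) z * g z c d * g z e f
        + g z a b * dz j (fun y => g y c d) z * g z e f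
        + g z a b * g z c d * dz j (fun y => g y e f) z := by
    intro a b c d e f
    rw [dz_mul j (by fun_prop) (h0 _ _), dz_mul j (h0 _ _) (h0 _ _)]
    ring
  rw [dz_sub j (by fun_prop) (by fun_prop), dz_add j (by fun_prop) (by fun_prop),
    dz_add j (by fun_prop) (by fun_prop), dz_sub j (by fun_prop) (by fun_prop),
    dz_sub j (by fun_prop) (by fun_prop)]
  simp only [e, Fin.sum_univ_three, Matrix.adjugate_fin_three]
  simp
  ring

theorem det_eq_re : (g z).det = ((g z).det.re : ℂ) := by
  have h : (g z).IsHermitian := by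
    ext a b; exact hg.herm z hz b a
  have h2 : star (g z).det = (g z).det := by
    rw [← Matrix.det_conjTranspose, h.eq]
  exact (Complex.conj_eq_iff_re.mp h2).symm

theorem star_TorTr (m : Fin 3) : star (TorTr g z m) = TorBarTr g z m := by
  have h1 : TorTr g z m = ∑ j, ∑ k, ginv g z j k *
    (dz j (fun y => g y k m) z - dz m (fun y => g y k j) z) := rfl
  have h2 : TorBarTr g z m = ∑ j, ∑ k, ginv g z k j *
    (dzbar j (fun y => g y m k) z - dzbar m (fun y => g y j k) z) := rfl
  rw [h1, h2]
  simp only [star_sum, star_mul, star_sub, hg.star_dz_g hz, hg.star_ginv hz, mul_comm]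

end SmoothMetricOn

namespace MetricVolumeOn
variable {F : C3 → ℂ} {g : MetricField} {U : Set C3} (hg : MetricVolumeOn F g U)
  {z : C3} (hz : z ∈ U)
include hg hz

theorem normOmega_pos : 0 < normOmega F g z := by
  have h1 := hg.det_pos z hz
  have h2 : 0 < ‖F z‖ := norm_pos_iff.mpr (hg.ne_zero z hz)
  exact Real.sqrt_pos.mpr (by positivity)

theorem normOmega_ne_zero : (normOmega F g z : ℂ) ≠ 0 :=
  Complex.ofReal_ne_zero.mpr (hg.normOmega_pos hz).ne'

/-- Replaces the square root by a polynomial relation; its space and time derivatives determine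
those of `N`. -/
theorem normOmega_sq : (normOmega F g z : ℂ) ^ 2 * (6 * (g z).det) = F z * star (F z) := by
  have h1 := hg.det_pos z hz
  have h2 : normOmega F g z ^ 2 * (6 * (g z).det.re) = ‖F z‖ ^ 2 := by
    rw [normOmega, Real.sq_sqrt (by positivity)]
    field_simp
  rw [hg.det_eq_re hz, Complex.star_def, Complex.mul_conj, Complex.normSq_eq_norm_sq]
  exact_mod_cast h2

theorem differentiableAt_F : DifferentiableAt ℂ F z :=
  hg.holomorphic.differentiableAt (hg.isOpen.mem_nhds hz)

theorem differentiableAt_normOmega : DifferentiableAt ℝ (fun y => (normOmega F g y : ℂ)) z := by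
  have h1 := hg.det_pos z hz
  have h2 : 0 < ‖F z‖ := norm_pos_iff.mpr (hg.ne_zero z hz)
  have h3 : DifferentiableAt ℝ F z := (hg.differentiableAt_F hz).restrictScalars ℝ
  have h4 : DifferentiableAt ℝ (fun y => ‖F y‖ ^ 2) z := h3.norm_sq ℝ
  have h5 : DifferentiableAt ℝ (fun y => (g y).det) z :=
    smooth_differentiableAt hg.isOpen hz (contDiffOn_det hg.smooth)
  have h6 : DifferentiableAt ℝ (fun y => (g y).det.re) z :=
    Complex.reCLM.differentiableAt.comp z h5
  have h7 : DifferentiableAt ℝ (fun y => normOmega F g y) z := by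
    have h10 : 6 * (g z).det.re ≠ 0 := by positivity
    have h8 : DifferentiableAt ℝ (fun y => ‖F y‖ ^ 2 / (6 * (g y).det.re)) z := by
      simp only [div_eq_mul_inv]
      exact h4.fun_mul ((h6.const_mul 6).fun_inv h10)
    have h9 : ‖F z‖ ^ 2 / (6 * (g z).det.re) ≠ 0 := by positivity
    exact h8.sqrt h9
  exact Complex.ofRealCLM.differentiableAt.comp z h7

section Balanced
variable (hbal : IsClosed22On (normOmegaSq F g) U)
include hbal

theorem dz_normOmega (a : Fin 3) :
    dz a (fun y => (normOmega F g y : ℂ)) z = normOmega F g z * TorTr g z a :=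
  hg.dz_eq_mul_TorTr hz (hg.differentiableAt_normOmega hz)
    (fun p r a s q => hbal.1 z hz p r a s q) a

/-- `N` is real, so this is the conjugate of `dz_normOmega`. -/
theorem dzbar_normOmega (a : Fin 3) :
    dzbar a (fun y => (normOmega F g y : ℂ)) z = normOmega F g z * TorBarTr g z a := by
  have h : (fun y => (normOmega F g y : ℂ)) = fun y => star (normOmega F g y : ℂ) := by
    funext y; simp
  rw [h, dzbar_star, hg.dz_normOmega hz hbal, star_mul, hg.star_TorTr hz]
  simp [mul_comm]

/-- For a conformally balanced metric, `R_{k̄j} = 2 ∂_{k̄} T_j`. -/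
theorem dzbar_TorTr (k j : Fin 3) :
    dzbar k (fun y => TorTr g y j) z = 1 / 2 * Ric g z ![k, j] := by
  have hT : ∀ j, DifferentiableAt ℝ (fun y => TorTr g y j) z := fun j =>
    smooth_differentiableAt hg.isOpen hz (hg.smooth_TorTr j)
  have hG := hg.differentiableAt_Gam hz
  -- Applying `∂_j` to `N² · 6 det g = F F̄` and dividing gives `∂_j log F = 2 T_j + A_{jp}^p`; the
  -- antiholomorphic factor does not contribute. The left side is holomorphic, so `∂_{k̄}` yields `2
  -- ∂_{k̄} T_j - R_{k̄j} = 0`.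
  have hlog : ∀ y ∈ U, ∀ j, dz j F y = F y * (2 * TorTr g y j + ∑ p, Gam g y j p p) := by
    intro y hy j
    have hN := hg.differentiableAt_normOmega hy
    have hF := hg.differentiableAt_F hy
    have hFr : DifferentiableAt ℝ F y := hF.restrictScalars ℝ
    have hFs : DifferentiableAt ℝ (fun y => star (F y)) y := hFr.star
    have hdet : DifferentiableAt ℝ (fun y => (g y).det) y :=
      smooth_differentiableAt hg.isOpen hy (contDiffOn_det hg.smooth)
    have h1 := dz_congr_on j hg.isOpen hy fun y hy => hg.normOmega_sq hy
    simp only [pow_two] at h1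
    rw [dz_mul j (hN.fun_mul hN) (hdet.const_mul 6), dz_mul j hN hN, dz_const_mul j 6 hdet,
      dz_mul j hFr hFs, dz_star, dzbar_eq_zero hF, hg.dz_normOmega hy hbal, hg.dz_det hy,
      star_zero, mul_zero, add_zero] at h1
    have h2 := hg.normOmega_sq hy
    have h3 : star (F y) ≠ 0 := star_ne_zero.mpr (hg.ne_zero y hy)
    refine mul_right_cancel₀ h3 ?_
    linear_combination -h1 + (2 * TorTr g y j + ∑ p, Gam g y j p p) * h2
  have h := dzbar_log_deriv_eq_zero hg.isOpen hz hg.holomorphic hg.ne_zero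
    (w := fun j y => 2 * TorTr g y j + ∑ p, Gam g y j p p) (fun j => by fun_prop) hlog k j
  rw [dzbar_add k ((hT j).const_mul 2) (by fun_prop), dzbar_const_mul k 2 (hT j),
    dzbar_sum _ _ fun p => by fun_prop] at h
  simp only [dzbar_Gam, Finset.sum_neg_distrib] at h
  have h2 : Ric g z ![k, j] = ∑ p, Rm g z ![k, j, p, p] := rfl
  rw [h2]
  linear_combination h / 2

end Balanced
end MetricVolumeOn

/-! ### Closedness of `Ψ`. -/

namespace SmoothMetricOn
variable {g : MetricField} {U : Set C3} (hg : SmoothMetricOn g U) {z : C3} (hz : z ∈ U)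
include hg

theorem smooth_ddbar11 {b : TField 2} (hb : ∀ I, ContDiffOn ℝ ∞ (fun y => b y I) U)
    (I : Fin 4 → Fin 3) : ContDiffOn ℝ ∞ (fun y => ddbar11 b y I) U := by
  have h := fun q r I => smooth_dz q hg.isOpen (smooth_dzbar r hg.isOpen (hb I))
  simp only [ddbar11, alt22]
  have h1 := h (I 3) (I 2) ![I 0, I 1]
  have h2 := h (I 3) (I 0) ![I 2, I 1]
  have h3 := h (I 1) (I 2) ![I 0, I 3]
  have h4 := h (I 1) (I 0) ![I 2, I 3]
  exact ((h1.sub h2).sub h3).add h4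

theorem smooth_omega (I : Fin 2 → Fin 3) : ContDiffOn ℝ ∞ (fun y => omega g y I) U :=
  contDiffOn_const.mul (hg.smooth _ _)

theorem smooth_Psi (α' : ℝ) {Φ : TField 4} (hΦ : ∀ I, ContDiffOn ℝ ∞ (fun y => Φ y I) U)
    (I : Fin 4 → Fin 3) : ContDiffOn ℝ ∞ (fun y => Psi α' Φ g y I) U :=
  (contDiffOn_const.mul (hg.smooth_ddbar11 hg.smooth_omega I)).sub
    (contDiffOn_const.mul ((hg.smooth_trRmRm I).sub (hΦ I)))

/-- `∂∂̄b` is closed. -/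
theorem isClosed_ddbar11 {b : TField 2} (hb : ∀ I, ContDiffOn ℝ ∞ (fun y => b y I) U) :
    IsClosed22On (ddbar11 b) U := by
  have hU := hg.isOpen
  have h1 := fun r I => smooth_dzbar r hU (hb I)
  have h2 := fun q r I => smooth_dz q hU (h1 r I)
  have hη : ∀ y p s r q, ddbar11 b y ![p, s, r, q]
      = dz q (dzbar r (fun y => b y ![p, s])) y - dz q (dzbar p (fun y => b y ![r, s])) y
        - dz s (dzbar r (fun y => b y ![p, q])) y + dz s (dzbar p (fun y => b y ![r, q])) y :=
    fun _ _ _ _ _ => rfl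
  refine ⟨fun z hz p r a s q => ?_, fun z hz s q a p r => ?_⟩
  · have hd := fun q r I => smooth_differentiableAt hU hz (h2 q r I)
    have e : ∀ a p s r q, dz a (fun y => ddbar11 b y ![p, s, r, q]) z
      = dz a (dz q (dzbar r (fun y => b y ![p, s]))) z
        - dz a (dz q (dzbar p (fun y => b y ![r, s]))) z
        - dz a (dz s (dzbar r (fun y => b y ![p, q]))) z
        + dz a (dz s (dzbar p (fun y => b y ![r, q]))) z := by
      intro a p s r q
      simp only [hη]
      have d1 := hd q r ![p, s]
      have d2 := hd q p ![r, s]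
      have d3 := hd s r ![p, q]
      have d4 := hd s p ![r, q]
      rw [dz_add a ((d1.fun_sub d2).fun_sub d3) d4, dz_sub a (d1.fun_sub d2) d3, dz_sub a d1 d2]
    -- The relation `∂² = 0`: the six exchanges make the cyclic sum cancel in pairs.
    have c : ∀ a q r I, dz a (dz q (dzbar r (fun y => b y I))) z
        = dz q (dz a (dzbar r (fun y => b y I))) z := fun a q r I => dz_dz_comm a q hU hz (h1 r I)
    rw [e, e, e, c a q, c a q, c a s, c a s, c s q, c s q]
    ring
  · have hd := fun q r I => smooth_differentiableAt hU hz (h2 q r I)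
    have e : ∀ a p s r q, dzbar a (fun y => ddbar11 b y ![p, s, r, q]) z
      = dz q (dzbar a (dzbar r (fun y => b y ![p, s]))) z
        - dz q (dzbar a (dzbar p (fun y => b y ![r, s]))) z
        - dz s (dzbar a (dzbar r (fun y => b y ![p, q]))) z
        + dz s (dzbar a (dzbar p (fun y => b y ![r, q]))) z := by
      intro a p s r q
      simp only [hη]
      have d1 := hd q r ![p, s]
      have d2 := hd q p ![r, s]
      have d3 := hd s r ![p, q]
      have d4 := hd s p ![r, q]
      rw [dzbar_add a ((d1.fun_sub d2).fun_sub d3) d4, dzbar_sub a (d1.fun_sub d2) d3,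
        dzbar_sub a d1 d2, dz_dzbar_comm q a hU hz (h1 _ _), dz_dzbar_comm q a hU hz (h1 _ _),
        dz_dzbar_comm s a hU hz (h1 _ _), dz_dzbar_comm s a hU hz (h1 _ _)]
    have c : ∀ q a r I, dz q (dzbar a (dzbar r (fun y => b y I))) z
        = dz q (dzbar r (dzbar a (fun y => b y I))) z := fun q a r I =>
      dz_congr_on q hU hz fun y hy => dzbar_dzbar_comm a r hU hy (hb I)
    rw [e, e, e, c _ a r, c _ a r, c _ a p, c _ a p, c _ p r, c _ p r]
    ring

/-- `Tr (Rm ∧ Rm)` is closed. -/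
theorem isClosed_trRmRm : IsClosed22On (trRmRm g) U := by
  have hU := hg.isOpen
  have hη : ∀ y p s r q, trRmRm g y ![p, s, r, q] = trRR g y ![p, s, r, q]
      - trRR g y ![r, s, p, q] - trRR g y ![p, q, r, s] + trRR g y ![r, q, p, s] :=
    fun y p s r q => trRmRm_eq g y p s r q
  have hS : ∀ y p s r q, trRR g y ![p, s, r, q]
      = ∑ α, ∑ β, Rm g y ![r, q, α, β] * Rm g y ![p, s, β, α] := fun _ _ _ _ _ => rfl
  refine ⟨fun z hz p r a s q => ?_, fun z hz s q a p r => ?_⟩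
  · have hR := hg.differentiableAt_Rm hz
    have hd := fun I => smooth_differentiableAt hU hz (hg.smooth_trRR I)
    -- `E` is the derivative of `Rm` covariant in the endomorphism slots only, for which the Bianchi
    -- identity is a symmetry without torsion. Under the trace the endomorphism connection terms
    -- cancel, so plain derivatives may be replaced by `E`.
    let E : Fin 3 → Fin 3 → Fin 3 → Fin 3 → Fin 3 → ℂ := fun a k m α β =>
      dz a (fun y => Rm g y ![k, m, α, β]) z
        + ∑ r, (Gam g z a α r * Rm g z ![k, m, r, β] - Rm g z ![k, m, α, r] * Gam g z a r β)
    have hE : ∀ a k m α β, E a k m α β = E m k a α β := by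
      intro a k m α β
      have h := hg.bianchi_dz hz k a m α β
      simp only [E, Fin.sum_univ_three] at h ⊢
      linear_combination h
    let W : Fin 3 → Fin 3 → Fin 3 → Fin 3 → Fin 3 → ℂ := fun a q r p s =>
      ∑ α, ∑ β, E a r q α β * Rm g z ![p, s, β, α]
    have hW : ∀ a q r p s, W a q r p s = W q a r p s := by
      intro a q r p s
      simp only [W, fun α β => hE a r q α β]
    have eS : ∀ a p s r q, dz a (fun y => trRR g y ![p, s, r, q]) z = W a q r p s + W a s p r q := by
      intro a p s r q
      simp only [hS]
      rw [dz_sum _ _ fun α => by fun_prop]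
      simp only [dz_sum _ _ fun β => (hR ![r, q, _, β]).fun_mul (hR ![p, s, β, _]),
        dz_mul a (hR _) (hR _)]
      simp only [W, E, Fin.sum_univ_three]
      ring
    have e : ∀ a p s r q, dz a (fun y => trRmRm g y ![p, s, r, q]) z
        = (W a q r p s + W a s p r q) - (W a q p r s + W a s r p q)
          - (W a s r p q + W a q p r s) + (W a s p r q + W a q r p s) := by
      intro a p s r q
      simp only [hη]
      rw [dz_add a (by fun_prop) (by fun_prop), dz_sub a (by fun_prop) (by fun_prop),
        dz_sub a (by fun_prop) (by fun_prop), eS, eS, eS, eS]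
    rw [e, e, e]
    linear_combination 2 * hW a q r p s - 2 * hW a q p r s + 2 * hW a s p r q - 2 * hW a s r p q
      + 2 * hW s q p r a - 2 * hW s q r p a
  · have hR := hg.differentiableAt_Rm hz
    have hd := fun I => smooth_differentiableAt hU hz (hg.smooth_trRR I)
    -- For `∂̄` no connection terms are needed, since `∂̄ Rm = 0` holds for the components.
    let W : Fin 3 → Fin 3 → Fin 3 → Fin 3 → Fin 3 → ℂ := fun a r q p s =>
      ∑ α, ∑ β, dzbar a (fun y => Rm g y ![r, q, α, β]) z * Rm g z ![p, s, β, α]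
    have hW : ∀ a r q p s, W a r q p s = W r a q p s := by
      intro a r q p s
      simp only [W, fun α β => hg.bianchi_dzbar hz a r q α β]
    have eS : ∀ a p s r q, dzbar a (fun y => trRR g y ![p, s, r, q]) z
        = W a r q p s + W a p s r q := by
      intro a p s r q
      simp only [hS]
      rw [dzbar_sum _ _ fun α => by fun_prop]
      simp only [dzbar_sum _ _ fun β => (hR ![r, q, _, β]).fun_mul (hR ![p, s, β, _]),
        dzbar_mul a (hR _) (hR _)]
      simp only [W, Fin.sum_univ_three]
      ring
    have e : ∀ a p s r q, dzbar a (fun y => trRmRm g y ![p, s, r, q]) z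
        = (W a r q p s + W a p s r q) - (W a p q r s + W a r s p q)
          - (W a r s p q + W a p q r s) + (W a p s r q + W a r q p s) := by
      intro a p s r q
      simp only [hη]
      rw [dzbar_add a (by fun_prop) (by fun_prop), dzbar_sub a (by fun_prop) (by fun_prop),
        dzbar_sub a (by fun_prop) (by fun_prop), eS, eS, eS, eS]
    rw [e, e, e]
    linear_combination 2 * hW a r q p s - 2 * hW a r s p q + 2 * hW a p s r q - 2 * hW a p q r s
      + 2 * hW p r s a q - 2 * hW p r q a s

/-- The right hand side of the flow is closed. -/
theorem isClosed_Psi (α' : ℝ) {Φ : TField 4} (hΦ : ∀ I, ContDiffOn ℝ ∞ (fun y => Φ y I) U)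
    (hcl : IsClosed22On Φ U) : IsClosed22On (Psi α' Φ g) U := by
  have hU := hg.isOpen
  have h1 := hg.isClosed_ddbar11 hg.smooth_omega
  have h2 := hg.isClosed_trRmRm
  refine ⟨fun z hz p r a s q => ?_, fun z hz s q a p r => ?_⟩
  · have d1 := fun I => smooth_differentiableAt hU hz (hg.smooth_ddbar11 hg.smooth_omega I)
    have d2 := fun I => smooth_differentiableAt hU hz (hg.smooth_trRmRm I)
    have d3 := fun I => smooth_differentiableAt hU hz (hΦ I)
    have e : ∀ a I, dz a (fun y => Psi α' Φ g y I) z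
        = Complex.I * dz a (fun y => ddbar11 (omega g) y I) z
          - (α' : ℂ) * (dz a (fun y => trRmRm g y I) z - dz a (fun y => Φ y I) z) := by
      intro a I
      simp only [Psi]
      rw [dz_sub a (by fun_prop) (by fun_prop), dz_const_mul a _ (d1 I),
        dz_const_mul a _ (by fun_prop), dz_sub a (d2 I) (d3 I)]
    rw [e, e, e]
    linear_combination Complex.I * h1.1 z hz p r a s q
      - (α' : ℂ) * (h2.1 z hz p r a s q - hcl.1 z hz p r a s q)
  · have d1 := fun I => smooth_differentiableAt hU hz (hg.smooth_ddbar11 hg.smooth_omega I)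
    have d2 := fun I => smooth_differentiableAt hU hz (hg.smooth_trRmRm I)
    have d3 := fun I => smooth_differentiableAt hU hz (hΦ I)
    have e : ∀ a I, dzbar a (fun y => Psi α' Φ g y I) z
        = Complex.I * dzbar a (fun y => ddbar11 (omega g) y I) z
          - (α' : ℂ) * (dzbar a (fun y => trRmRm g y I) z - dzbar a (fun y => Φ y I) z) := by
      intro a I
      simp only [Psi]
      rw [dzbar_sub a (by fun_prop) (by fun_prop), dzbar_const_mul a _ (d1 I),
        dzbar_const_mul a _ (by fun_prop), dzbar_sub a (d2 I) (d3 I)]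
    rw [e, e, e]
    linear_combination Complex.I * h1.2 z hz s q a p r
      - (α' : ℂ) * (h2.2 z hz s q a p r - hcl.2 z hz s q a p r)

end SmoothMetricOn

/-! ### Time derivatives on `[0, T)`, one-sided at `0`, and their exchange with spatial derivatives.
-/

section TimeDerivative
variable {T : ℝ} {U : Set C3} {f : ℝ × C3 → ℂ} (hU : IsOpen U)
  (hf : ContDiffOn ℝ ∞ f (Set.Ico 0 T ×ˢ U))
include hU

theorem uniqueDiffOn_Ico_prod : UniqueDiffOn ℝ (Set.Ico 0 T ×ˢ U) :=
  (uniqueDiffOn_Ico 0 T).prod hU.uniqueDiffOn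

include hf

theorem smooth_slice {t : ℝ} (ht : t ∈ Set.Ico 0 T) : ContDiffOn ℝ ∞ (fun y => f (t, y)) U :=
  hf.comp (contDiffOn_const.prodMk contDiffOn_id) fun _ hy => ⟨ht, hy⟩

theorem hasFDerivWithinAt_joint {t : ℝ} (ht : t ∈ Set.Ico 0 T) {z : C3} (hz : z ∈ U) :
    HasFDerivWithinAt f (fderivWithin ℝ f (Set.Ico 0 T ×ˢ U) (t, z)) (Set.Ico 0 T ×ˢ U) (t, z) :=
  ((hf (t, z) ⟨ht, hz⟩).differentiableWithinAt (by simp)).hasFDerivWithinAt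

/-- Space is open but the time interval has an endpoint, so joint derivatives are taken within the
product set; in spatial directions they agree with ordinary derivatives. -/
theorem fderiv_slice {t : ℝ} (ht : t ∈ Set.Ico 0 T) {z : C3} (hz : z ∈ U) (v : C3) :
    fderiv ℝ (fun y => f (t, y)) z v = fderivWithin ℝ f (Set.Ico 0 T ×ˢ U) (t, z) (0, v) := by
  have h1 := hasFDerivWithinAt_joint hU hf ht hz
  have h2 : HasFDerivWithinAt (fun y : C3 => (t, y)) (ContinuousLinearMap.inr ℝ ℝ C3) U z :=
    (hasFDerivAt_prodMk_right t z).hasFDerivWithinAt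
  have h3 := (h1.comp z h2 fun y hy => ⟨ht, hy⟩).hasFDerivAt (hU.mem_nhds hz)
  have h4 : fderiv ℝ (fun y => f (t, y)) z = _ := h3.fderiv
  rw [h4]
  simp

theorem hasDerivWithinAt_slice {t : ℝ} (ht : t ∈ Set.Ico 0 T) {z : C3} (hz : z ∈ U) :
    HasDerivWithinAt (fun τ => f (τ, z))
      (fderivWithin ℝ f (Set.Ico 0 T ×ˢ U) (t, z) (1, 0)) (Set.Ico 0 T) t := by
  have h1 := hasFDerivWithinAt_joint hU hf ht hz
  have h2 : HasFDerivWithinAt (fun τ : ℝ => (τ, z)) (ContinuousLinearMap.inl ℝ ℝ C3)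
      (Set.Ico 0 T) t := (hasFDerivAt_prodMk_left t z).hasFDerivWithinAt
  have hm : Set.MapsTo (fun τ : ℝ => (τ, z)) (Set.Ico 0 T) (Set.Ico 0 T ×ˢ U) :=
    fun y hy => ⟨hy, hz⟩
  exact (h1.comp t h2 hm).hasDerivWithinAt.congr_deriv (by simp)

theorem smooth_fderiv_slice (v : C3) :
    ContDiffOn ℝ ∞ (fun x : ℝ × C3 => fderiv ℝ (fun y => f (x.1, y)) x.2 v)
      (Set.Ico 0 T ×ˢ U) := by
  have h1 : ContDiffOn ℝ ∞ (fun x => fderivWithin ℝ f (Set.Ico 0 T ×ˢ U) x (0, v))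
      (Set.Ico 0 T ×ˢ U) :=
    (hf.fderivWithin (uniqueDiffOn_Ico_prod hU) (by simp)).clm_apply contDiffOn_const
  exact h1.congr fun x hx => fderiv_slice hU hf hx.1 hx.2 v

theorem smooth_dz_slice (j : Fin 3) :
    ContDiffOn ℝ ∞ (fun x : ℝ × C3 => dz j (fun y => f (x.1, y)) x.2) (Set.Ico 0 T ×ˢ U) :=
  ((smooth_fderiv_slice hU hf _).sub
    (contDiffOn_const.mul (smooth_fderiv_slice hU hf _))).div_const 2

/-- Time derivatives commute with spatial derivatives. -/
theorem hasDerivWithinAt_fderiv {t : ℝ} (ht : t ∈ Set.Ico 0 T) {z : C3} (hz : z ∈ U)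
    {f' : C3 → ℂ}
    (h : ∀ y ∈ U, HasDerivWithinAt (fun τ => f (τ, y)) (f' y) (Set.Ico 0 T) t) (v : C3) :
    HasDerivWithinAt (fun τ => fderiv ℝ (fun y => f (τ, y)) z v) (fderiv ℝ f' z v)
      (Set.Ico 0 T) t := by
  set S : Set (ℝ × C3) := Set.Ico 0 T ×ˢ U with hS
  have hSu : UniqueDiffOn ℝ S := uniqueDiffOn_Ico_prod hU
  have hT : (0 : ℝ) ≠ T := fun h => by
    have := ht.1.trans_lt ht.2
    exact this.ne h
  have hG : ContDiffOn ℝ ∞ (fderivWithin ℝ f S) S := hf.fderivWithin hSu (by simp)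
  have hH : HasFDerivWithinAt (fderivWithin ℝ f S) (fderivWithin ℝ (fderivWithin ℝ f S) S (t, z))
      S (t, z) :=
    ((hG (t, z) ⟨ht, hz⟩).differentiableWithinAt (by simp)).hasFDerivWithinAt
  -- Symmetry of the second derivative within a set extends from the interior to points of its
  -- closure, which covers `t = 0`.
  have hsymm : IsSymmSndFDerivWithinAt ℝ f S (t, z) := by
    refine (hf (t, z) ⟨ht, hz⟩).isSymmSndFDerivWithinAt (by simp; exact ENat.LEInfty.out) hSu ?_ ⟨ht, hz⟩
    rw [hS, interior_prod_eq, closure_prod_eq, interior_Ico, closure_Ioo hT, hU.interior_eq]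
    exact ⟨⟨ht.1, ht.2.le⟩, subset_closure hz⟩
  have h1 : HasDerivWithinAt (fun τ => fderiv ℝ (fun y => f (τ, y)) z v)
      (fderivWithin ℝ (fderivWithin ℝ f S) S (t, z) (1, 0) (0, v)) (Set.Ico 0 T) t := by
    have h2 : HasFDerivWithinAt (fun τ : ℝ => (τ, z)) (ContinuousLinearMap.inl ℝ ℝ C3)
      (Set.Ico 0 T) t := (hasFDerivAt_prodMk_left t z).hasFDerivWithinAt
    have hm : Set.MapsTo (fun τ : ℝ => (τ, z)) (Set.Ico 0 T) S := fun y hy => ⟨hy, hz⟩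
    have h3 := (hH.comp t h2 hm).hasDerivWithinAt
    have h4 := h3.clm_apply (hasDerivWithinAt_const t (Set.Ico 0 T) ((0 : ℝ), v))
    exact (h4.congr_deriv (by simp)).congr_of_mem (fun τ hτ => fderiv_slice hU hf hτ hz v) ht
  have h5 : fderiv ℝ f' z v = fderivWithin ℝ (fderivWithin ℝ f S) S (t, z) (0, v) (1, 0) := by
    have h2 : HasFDerivWithinAt (fun y : C3 => (t, y)) (ContinuousLinearMap.inr ℝ ℝ C3) U z :=
      (hasFDerivAt_prodMk_right t z).hasFDerivWithinAt
    have h3 := (hH.comp z h2 fun y hy => ⟨ht, hy⟩).hasFDerivAt (hU.mem_nhds hz)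
    have h4 := h3.clm_apply (hasFDerivAt_const ((1 : ℝ), (0 : C3)) z)
    have h6 : f' =ᶠ[nhds z] fun y => fderivWithin ℝ f S (t, y) (1, 0) :=
      Filter.eventuallyEq_of_mem (hU.mem_nhds hz) fun y hy =>
        (uniqueDiffOn_Ico 0 T t ht).eq_deriv _ (h y hy) (hasDerivWithinAt_slice hU hf ht hy)
    rw [h6.fderiv_eq]
    have h7 : fderiv ℝ (fun y => fderivWithin ℝ f S (t, y) (1, 0)) z = _ := h4.fderiv
    rw [h7]
    simp
  rw [h5, hsymm]
  exact h1

theorem hasDerivWithinAt_dz {t : ℝ} (ht : t ∈ Set.Ico 0 T) {z : C3} (hz : z ∈ U)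
    {f' : C3 → ℂ}
    (h : ∀ y ∈ U, HasDerivWithinAt (fun τ => f (τ, y)) (f' y) (Set.Ico 0 T) t) (j : Fin 3) :
    HasDerivWithinAt (fun τ => dz j (fun y => f (τ, y)) z) (dz j f' z) (Set.Ico 0 T) t :=
  ((hasDerivWithinAt_fderiv hU hf ht hz h _).fun_sub
    ((hasDerivWithinAt_fderiv hU hf ht hz h _).const_mul Complex.I)).div_const 2

theorem hasDerivWithinAt_dzbar {t : ℝ} (ht : t ∈ Set.Ico 0 T) {z : C3} (hz : z ∈ U)
    {f' : C3 → ℂ}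
    (h : ∀ y ∈ U, HasDerivWithinAt (fun τ => f (τ, y)) (f' y) (Set.Ico 0 T) t) (j : Fin 3) :
    HasDerivWithinAt (fun τ => dzbar j (fun y => f (τ, y)) z) (dzbar j f' z) (Set.Ico 0 T) t :=
  ((hasDerivWithinAt_fderiv hU hf ht hz h _).fun_add
    ((hasDerivWithinAt_fderiv hU hf ht hz h _).const_mul Complex.I)).div_const 2

/-- Time derivatives commute with spatial derivatives, for the product of a smooth function with
a function of the space variables which is only differentiable. -/
theorem hasDerivWithinAt_dz_mul {t : ℝ} (ht : t ∈ Set.Ico 0 T) {z : C3} (hz : z ∈ U)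
    {c ψ : C3 → ℂ} (hc : DifferentiableAt ℝ c z) (hc0 : ∀ y ∈ U, c y ≠ 0)
    (hψ : DifferentiableAt ℝ ψ z)
    (h : ∀ y ∈ U, HasDerivWithinAt (fun τ => c y * f (τ, y)) (ψ y) (Set.Ico 0 T) t) (j : Fin 3) :
    HasDerivWithinAt (fun τ => dz j (fun y => c y * f (τ, y)) z) (dz j ψ z) (Set.Ico 0 T) t ∧
    HasDerivWithinAt (fun τ => dzbar j (fun y => c y * f (τ, y)) z) (dzbar j ψ z)
      (Set.Ico 0 T) t := by
  -- Dividing by the nonzero time-independent factor reduces to the jointly smooth `f`; the spatial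
  -- product rule restores `c`, for which one derivative suffices.
  have hd : ∀ y ∈ U, HasDerivWithinAt (fun τ => f (τ, y)) ((c y)⁻¹ * ψ y) (Set.Ico 0 T) t := by
    intro y hy
    have h1 := (h y hy).const_mul (c y)⁻¹
    simpa only [inv_mul_cancel_left₀ (hc0 y hy)] using h1
  have hψ' : DifferentiableAt ℝ (fun y => (c y)⁻¹ * ψ y) z := (hc.fun_inv (hc0 z hz)).fun_mul hψ
  have e : ∀ y ∈ U, ψ y = c y * ((c y)⁻¹ * ψ y) := fun y hy =>
    (mul_inv_cancel_left₀ (hc0 y hy) _).symm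
  have hs : ∀ τ ∈ Set.Ico 0 T, DifferentiableAt ℝ (fun y => f (τ, y)) z := fun τ hτ =>
    smooth_differentiableAt hU hz (smooth_slice hU hf hτ)
  constructor
  · rw [dz_congr_on j hU hz e, dz_mul j hc hψ']
    exact (((hd z hz).const_mul (dz j c z)).fun_add
      ((hasDerivWithinAt_dz hU hf ht hz hd j).const_mul (c z))).congr_of_mem
      (fun τ hτ => dz_mul j hc (hs τ hτ)) ht
  · rw [dzbar_congr_on j hU hz e, dzbar_mul j hc hψ']
    exact (((hd z hz).const_mul (dzbar j c z)).fun_add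
      ((hasDerivWithinAt_dzbar hU hf ht hz hd j).const_mul (c z))).congr_of_mem
      (fun τ hτ => dzbar_mul j hc (hs τ hτ)) ht

end TimeDerivative

theorem eq_of_hasDerivWithinAt_zero {T : ℝ} {E : ℝ → ℂ}
    (h : ∀ t ∈ Set.Ico 0 T, HasDerivWithinAt E 0 (Set.Ico 0 T) t) {t : ℝ}
    (ht : t ∈ Set.Ico 0 T) : E t = E 0 := by
  refine (convex_Ico 0 T).is_const_of_fderivWithin_eq_zero (𝕜 := ℝ) (fun τ hτ =>
    (h τ hτ).differentiableWithinAt) (fun τ hτ => ?_) ht ⟨le_rfl, ht.1.trans_lt ht.2⟩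
  rw [(h τ hτ).hasFDerivWithinAt.fderivWithin (uniqueDiffOn_Ico 0 T τ hτ)]
  ext; simp

/-! ### Evolution of the metric, the connection and the curvature. -/

namespace SmoothMetricOn
variable {g : MetricField} {U : Set C3} (hg : SmoothMetricOn g U) {z : C3} (hz : z ∈ U)
include hg hz

/-- The contraction of the variation of `N ω²`. -/
theorem contr_variation (n n' : ℂ) (γ : Fin 3 → Fin 3 → ℂ) (p q : Fin 3) :
    ∑ s, ∑ r, ginv g z s r * (-2 * (n' * (g z r q * g z p s - g z p q * g z r s)
        + n * (γ r q * g z p s + g z r q * γ p s - γ p q * g z r s - g z p q * γ r s)))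
      = 4 * n' * g z p q + 2 * n * γ p q + 2 * n * (∑ s, ∑ r, ginv g z s r * γ r s) * g z p q := by
  have ha : ∀ A : Fin 3 → ℂ, ∑ s, ∑ r, ginv g z s r * (A r * g z p s) = A p := by
    intro A
    rw [Finset.sum_comm]
    have h : ∀ r, ∑ s, ginv g z s r * (A r * g z p s) = A r * if p = r then 1 else 0 := by
      intro r
      rw [← hg.mul_ginv hz, Finset.mul_sum]
      exact Finset.sum_congr rfl fun _ _ => by ring
    simp only [h]
    simp
  have hb : ∀ B : Fin 3 → ℂ, ∑ s, ∑ r, ginv g z s r * (g z r q * B s) = B q := by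
    intro B
    have h : ∀ s, ∑ r, ginv g z s r * (g z r q * B s) = B s * if s = q then 1 else 0 := by
      intro s
      rw [← hg.ginv_mul hz, Finset.mul_sum]
      exact Finset.sum_congr rfl fun _ _ => by ring
    simp only [h]
    simp
  -- The complex dimension enters here.
  have hc : ∑ s, ∑ r, ginv g z s r * g z r s = 3 := by
    simp [hg.ginv_mul hz]
  have h1 := ha (fun r => g z r q)
  have h2 := ha (fun r => γ r q)
  have h3 := hb (fun s => γ p s)
  simp only [Fin.sum_univ_three] at h1 h2 h3 hc ⊢
  linear_combination (-2 * n') * h1 - 2 * n * h2 - 2 * n * h3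
    + (2 * n' * g z p q + 2 * n * γ p q) * hc

end SmoothMetricOn

/-- The Anomaly flow in a coordinate system. -/
structure LocalFlow (F : C3 → ℂ) (α' : ℝ) (Φ : ℝ → TField 4) (T : ℝ) (G : ℝ → MetricField)
    (U : Set C3) : Prop where
  metric : ∀ t ∈ Set.Ico 0 T, MetricVolumeOn F (G t) U
  smooth : ∀ k j, ContDiffOn ℝ ∞ (fun y : ℝ × C3 => G y.1 y.2 k j) (Set.Ico 0 T ×ˢ U)
  smooth_form : ∀ t ∈ Set.Ico 0 T, ∀ I, ContDiffOn ℝ ∞ (fun y => Φ t y I) U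
  closed_form : ∀ t ∈ Set.Ico 0 T, IsClosed22On (Φ t) U
  flow : ∀ t ∈ Set.Ico 0 T, ∀ z ∈ U, ∀ p s r q : Fin 3,
    HasDerivWithinAt (fun τ => normOmegaSq F (G τ) z ![p, s, r, q])
      (Psi α' (Φ t) (G t) z ![p, s, r, q]) (Set.Ico 0 T) t
  balanced : IsClosed22On (normOmegaSq F (G 0)) U

/-- The time derivative of the metric along the flow. -/
def metricDot (F : C3 → ℂ) (α' : ℝ) (Φ : TField 4) (g : MetricField) (z : C3) (p q : Fin 3) : ℂ :=
  (2 * (normOmega F g z : ℂ))⁻¹ * contr22 g (Psi α' Φ g) z ![p, q]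

namespace LocalFlow
variable {F : C3 → ℂ} {α' : ℝ} {Φ : ℝ → TField 4} {T : ℝ} {G : ℝ → MetricField} {U : Set C3}
  (hG : LocalFlow F α' Φ T G U) {t : ℝ} (ht : t ∈ Set.Ico 0 T)
include hG ht

theorem isOpen : IsOpen U := (hG.metric t ht).isOpen

theorem smooth_det : ContDiffOn ℝ ∞ (fun x : ℝ × C3 => (Real.sqrt (6 * (G x.1 x.2).det.re))⁻¹)
    (Set.Ico 0 T ×ˢ U) := by
  have h1 : ContDiffOn ℝ ∞ (fun x : ℝ × C3 => (G x.1 x.2).det) (Set.Ico 0 T ×ˢ U) :=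
    contDiffOn_det hG.smooth
  have h2 : ContDiffOn ℝ ∞ (fun x : ℝ × C3 => (G x.1 x.2).det.re) (Set.Ico 0 T ×ˢ U) :=
    Complex.reCLM.contDiff.comp_contDiffOn h1
  have hp : ∀ x ∈ Set.Ico 0 T ×ˢ U, 0 < 6 * (G x.1 x.2).det.re := fun x hx =>
    mul_pos (by norm_num) ((hG.metric x.1 hx.1).det_pos x.2 hx.2)
  exact ((contDiffOn_const.mul h2).sqrt fun x hx => (hp x hx).ne').inv fun x hx =>
    (Real.sqrt_pos.mpr (hp x hx)).ne'

theorem smooth_wedge (I : Fin 4 → Fin 3) :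
    ContDiffOn ℝ ∞ (fun x : ℝ × C3 => wedge11 (omega (G x.1)) (omega (G x.1)) x.2 I)
      (Set.Ico 0 T ×ˢ U) := by
  have h := hG.smooth
  simp only [wedge11, alt22, omega]
  fun_prop

theorem smooth_normOmega_factor : ContDiffOn ℝ ∞
    (fun x : ℝ × C3 => (((Real.sqrt (6 * (G x.1 x.2).det.re))⁻¹ : ℝ) : ℂ)) (Set.Ico 0 T ×ˢ U) :=
  Complex.ofRealCLM.contDiff.comp_contDiffOn (hG.smooth_det ht)

omit ht in
-- Separates the time-independent `|F|`, which is only known to be differentiable, from a factor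
-- that is jointly smooth.
theorem normOmega_eq (g : MetricField) (z : C3) :
    (normOmega F g z : ℂ) = (‖F z‖ : ℂ) * (((Real.sqrt (6 * (g z).det.re))⁻¹ : ℝ) : ℂ) := by
  rw [normOmega, Real.sqrt_div (sq_nonneg _), Real.sqrt_sq (norm_nonneg _), div_eq_mul_inv]
  push_cast
  rfl

theorem hasDerivWithinAt_dz_normOmegaSq {z : C3} (hz : z ∈ U) (a p s r q : Fin 3) :
    HasDerivWithinAt (fun τ => dz a (fun y => normOmegaSq F (G τ) y ![p, s, r, q]) z)
      (dz a (fun y => Psi α' (Φ t) (G t) y ![p, s, r, q]) z) (Set.Ico 0 T) t ∧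
    HasDerivWithinAt (fun τ => dzbar a (fun y => normOmegaSq F (G τ) y ![p, s, r, q]) z)
      (dzbar a (fun y => Psi α' (Φ t) (G t) y ![p, s, r, q]) z) (Set.Ico 0 T) t := by
  have hU := hG.isOpen ht
  have hM := hG.metric t ht
  have e : ∀ τ y, normOmegaSq F (G τ) y ![p, s, r, q] = (‖F y‖ : ℂ) *
      ((((Real.sqrt (6 * (G τ y).det.re))⁻¹ : ℝ) : ℂ)
        * wedge11 (omega (G τ)) (omega (G τ)) y ![p, s, r, q]) := by
    intro τ y
    rw [← mul_assoc, ← hG.normOmega_eq]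
    rfl
  have hF : DifferentiableAt ℝ F z := (hM.differentiableAt_F hz).restrictScalars ℝ
  have hc : DifferentiableAt ℝ (fun y => (‖F y‖ : ℂ)) z :=
    Complex.ofRealCLM.differentiableAt.comp z (hF.norm ℝ (hM.ne_zero z hz))
  have hψ := smooth_differentiableAt hU hz
    (hM.smooth_Psi α' (hG.smooth_form t ht) ![p, s, r, q])
  have hfl := fun y hy => hG.flow t ht y hy p s r q
  simp only [e] at hfl ⊢
  exact hasDerivWithinAt_dz_mul hU
    (f := fun x => (((Real.sqrt (6 * (G x.1 x.2).det.re))⁻¹ : ℝ) : ℂ)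
        * wedge11 (omega (G x.1)) (omega (G x.1)) x.2 ![p, s, r, q])
    ((hG.smooth_normOmega_factor ht).mul (hG.smooth_wedge ht _)) ht hz hc
    (fun y hy => Complex.ofReal_ne_zero.mpr (norm_ne_zero_iff.mpr (hM.ne_zero y hy))) hψ hfl a

/-- The conformally balanced condition is preserved. -/
theorem isClosed_normOmegaSq : IsClosed22On (normOmegaSq F (G t)) U := by
  refine ⟨fun z hz p r a s q => ?_, fun z hz s q a p r => ?_⟩
  -- The time derivative of this component of `∂(N ω²)` is the corresponding component of `∂Ψ`,
  -- which vanishes, so the initial value `0` persists.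
  · refine (eq_of_hasDerivWithinAt_zero (E := fun τ =>
      dz a (fun y => normOmegaSq F (G τ) y ![p, s, r, q]) z
        + dz s (fun y => normOmegaSq F (G τ) y ![p, q, r, a]) z
        + dz q (fun y => normOmegaSq F (G τ) y ![p, a, r, s]) z) (fun τ hτ => ?_) ht).trans
      (hG.balanced.1 z hz p r a s q)
    have h := ((hG.metric τ hτ).isClosed_Psi α' (hG.smooth_form τ hτ) (hG.closed_form τ hτ)).1
      z hz p r a s q
    rw [← h]
    exact ((hG.hasDerivWithinAt_dz_normOmegaSq hτ hz _ _ _ _ _).1.fun_add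
      (hG.hasDerivWithinAt_dz_normOmegaSq hτ hz _ _ _ _ _).1).fun_add
      (hG.hasDerivWithinAt_dz_normOmegaSq hτ hz _ _ _ _ _).1
  · refine (eq_of_hasDerivWithinAt_zero (E := fun τ =>
      dzbar a (fun y => normOmegaSq F (G τ) y ![p, s, r, q]) z
        + dzbar p (fun y => normOmegaSq F (G τ) y ![r, s, a, q]) z
        + dzbar r (fun y => normOmegaSq F (G τ) y ![a, s, p, q]) z) (fun τ hτ => ?_) ht).trans
      (hG.balanced.2 z hz s q a p r)
    have h := ((hG.metric τ hτ).isClosed_Psi α' (hG.smooth_form τ hτ) (hG.closed_form τ hτ)).2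
      z hz s q a p r
    rw [← h]
    exact ((hG.hasDerivWithinAt_dz_normOmegaSq hτ hz _ _ _ _ _).2.fun_add
      (hG.hasDerivWithinAt_dz_normOmegaSq hτ hz _ _ _ _ _).2).fun_add
      (hG.hasDerivWithinAt_dz_normOmegaSq hτ hz _ _ _ _ _).2

/-- The flow of the metric. -/
theorem hasDerivWithinAt_metric {z : C3} (hz : z ∈ U) (p q : Fin 3) :
    HasDerivWithinAt (fun τ => G τ z p q) (metricDot F α' (Φ t) (G t) z p q)
      (Set.Ico 0 T) t := by
  have hU := hG.isOpen ht
  have hM := hG.metric t ht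
  have hg : ∀ k j, ∃ γ, HasDerivWithinAt (fun τ => G τ z k j) γ (Set.Ico 0 T) t := fun k j =>
    ⟨_, hasDerivWithinAt_slice hU (hG.smooth k j) ht hz⟩
  choose γ hγ using hg
  obtain ⟨n', hn'⟩ : ∃ n', HasDerivWithinAt (fun τ => (normOmega F (G τ) z : ℂ)) n'
      (Set.Ico 0 T) t := by
    simp only [hG.normOmega_eq]
    exact ⟨_, (hasDerivWithinAt_slice hU (hG.smooth_normOmega_factor ht) ht hz).const_mul _⟩
  have hdet : HasDerivWithinAt (fun τ => (G τ z).det)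
      ((G t z).det * ∑ s, ∑ r, ginv (G t) z s r * γ r s) (Set.Ico 0 T) t := by
    have h1 := det_mul_trace_inv (hM.det_ne z hz) γ
    have h2 : ∑ s, ∑ r, ginv (G t) z s r * γ r s = ∑ s, ∑ r, (G t z)⁻¹ s r * γ r s := rfl
    rw [h2, h1]
    simp only [Matrix.det_fin_three]
    have e : ∀ a b c d e f : Fin 3, HasDerivWithinAt
        (fun τ => G τ z a b * G τ z c d * G τ z e f)
        ((γ a b * G t z c d + G t z a b * γ c d) * G t z e f + G t z a b * G t z c d * γ e f)
        (Set.Ico 0 T) t := fun a b c d e f =>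
      ((hγ a b).fun_mul (hγ c d)).fun_mul (hγ e f)
    refine ((((((e 0 0 1 1 2 2).fun_sub (e 0 0 1 2 2 1)).fun_sub (e 0 1 1 0 2 2)).fun_add
      (e 0 1 1 2 2 0)).fun_add (e 0 2 1 0 2 1)).fun_sub (e 0 2 1 1 2 0)).congr_deriv ?_
    simp only [Fin.sum_univ_three, Matrix.adjugate_fin_three]
    simp
    ring
  have hut := uniqueDiffOn_Ico 0 T t ht
  have hN0 := hM.normOmega_ne_zero hz
  -- `N² · 6 det g` equals `F F̄`, which does not depend on time.
  have hdot : n' = - (1 / 2) * (normOmega F (G t) z : ℂ)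
      * ∑ s, ∑ r, ginv (G t) z s r * γ r s := by
    have h1 := (hn'.fun_mul hn').fun_mul (hdet.const_mul 6)
    have h2 : HasDerivWithinAt (fun τ => (normOmega F (G τ) z : ℂ) * (normOmega F (G τ) z : ℂ)
        * (6 * (G τ z).det)) 0 (Set.Ico 0 T) t :=
      (hasDerivWithinAt_const t (Set.Ico 0 T) (F z * star (F z))).congr_of_mem (fun τ hτ => by
        rw [← (hG.metric τ hτ).normOmega_sq hz]; ring) ht
    have h3 := hut.eq_deriv _ h1 h2
    refine mul_left_cancel₀ (mul_ne_zero hN0 (hM.det_ne z hz)) ?_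
    linear_combination h3 / 12
  have hΨ : ∀ p s r q, Psi α' (Φ t) (G t) z ![p, s, r, q]
      = -2 * (n' * (G t z r q * G t z p s - G t z p q * G t z r s)
        + (normOmega F (G t) z : ℂ) * (γ r q * G t z p s + G t z r q * γ p s
          - γ p q * G t z r s - G t z p q * γ r s)) := by
    intro p s r q
    have h1 := hG.flow t ht z hz p s r q
    have h2 : ∀ τ, normOmegaSq F (G τ) z ![p, s, r, q] = (normOmega F (G τ) z : ℂ) *
        (-2 * (G τ z r q * G τ z p s - G τ z p q * G τ z r s)) := by
      intro τ
      rw [← wedge11_omega]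
      rfl
    simp only [h2] at h1
    have h3 := hn'.fun_mul ((((hγ r q).fun_mul (hγ p s)).fun_sub
      ((hγ p q).fun_mul (hγ r s))).const_mul (-2))
    rw [hut.eq_deriv _ h1 h3]
    ring
  have h4 : contr22 (G t) (Psi α' (Φ t) (G t)) z ![p, q]
      = 2 * (normOmega F (G t) z : ℂ) * γ p q := by
    have h5 : contr22 (G t) (Psi α' (Φ t) (G t)) z ![p, q]
      = ∑ s, ∑ r, ginv (G t) z s r * Psi α' (Φ t) (G t) z ![p, s, r, q] := rfl
    rw [h5]
    simp only [hΨ]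
    -- The term `4 N' g` cancels `2 N tr(∂_t g) g`, leaving only `2 N ∂_t g`.
    rw [hM.contr_variation hz, hdot]
    ring
  rw [metricDot, h4, inv_mul_cancel_left₀ (mul_ne_zero two_ne_zero hN0)]
  exact hγ p q

theorem smooth_ginv_joint (s r : Fin 3) :
    ContDiffOn ℝ ∞ (fun x : ℝ × C3 => ginv (G x.1) x.2 s r) (Set.Ico 0 T ×ˢ U) :=
  contDiffOn_inv hG.smooth (fun x hx => (hG.metric x.1 hx.1).det_ne x.2 hx.2) s r

theorem smooth_Gam_joint (j p q : Fin 3) :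
    ContDiffOn ℝ ∞ (fun x : ℝ × C3 => Gam (G x.1) x.2 j p q) (Set.Ico 0 T ×ˢ U) :=
  ContDiffOn.sum fun l _ => (hG.smooth_ginv_joint ht p l).mul
    (smooth_dz_slice (hG.isOpen ht) (hG.smooth l q) j)

theorem hasDerivWithinAt_ginv {z : C3} (hz : z ∈ U) (s r : Fin 3) :
    HasDerivWithinAt (fun τ => ginv (G τ) z s r)
      (- ∑ b, (∑ a, ginv (G t) z s a * metricDot F α' (Φ t) (G t) z a b) * ginv (G t) z b r)
      (Set.Ico 0 T) t := by
  have hM := hG.metric t ht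
  have hi : ∀ r, ∃ γ, HasDerivWithinAt (fun τ => ginv (G τ) z s r) γ (Set.Ico 0 T) t := fun r =>
    ⟨_, hasDerivWithinAt_slice (hG.isOpen ht) (hG.smooth_ginv_joint ht s r) ht hz⟩
  choose γ hγ using hi
  have key : ∀ q, ∑ k, γ k * G t z k q
      = - ∑ k, ginv (G t) z s k * metricDot F α' (Φ t) (G t) z k q := by
    intro q
    have h1 : HasDerivWithinAt (fun τ => ∑ k, ginv (G τ) z s k * G τ z k q) _ (Set.Ico 0 T) t :=
      HasDerivWithinAt.fun_sum (u := Finset.univ) fun k _ =>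
        (hγ k).fun_mul (hG.hasDerivWithinAt_metric ht hz k q)
    have h2 : HasDerivWithinAt (fun τ => ∑ k, ginv (G τ) z s k * G τ z k q) 0 (Set.Ico 0 T) t :=
      (hasDerivWithinAt_const t (Set.Ico 0 T) (if s = q then (1 : ℂ) else 0)).congr_of_mem
        (fun τ hτ => (hG.metric τ hτ).ginv_mul hz s q) ht
    have h3 := (uniqueDiffOn_Ico 0 T t ht).eq_deriv _ h1 h2
    rw [Finset.sum_add_distrib] at h3
    linear_combination h3
  refine (hγ r).congr_deriv ?_
  rw [← hM.raise_lower_right hz γ r]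
  simp only [key, neg_mul, Finset.sum_neg_distrib]

theorem differentiableAt_metricDot {z : C3} (hz : z ∈ U) (p q : Fin 3) :
    DifferentiableAt ℝ (fun y => metricDot F α' (Φ t) (G t) y p q) z := by
  have hM := hG.metric t ht
  have h1 := smooth_differentiableAt hM.isOpen hz
    (hM.smooth_contr22 (hM.smooth_Psi α' (hG.smooth_form t ht)) ![p, q])
  exact (((hM.differentiableAt_normOmega hz).const_mul 2).fun_inv
    (mul_ne_zero two_ne_zero (hM.normOmega_ne_zero hz))).fun_mul h1

/-- The variation of the Chern connection. -/
theorem hasDerivWithinAt_Gam {z : C3} (hz : z ∈ U) (j p q : Fin 3) :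
    HasDerivWithinAt (fun τ => Gam (G τ) z j p q)
      (nabla (G t) ![Slot.up, Slot.lo] (fun y I => ∑ μ, ginv (G t) y (I 0) μ
        * metricDot F α' (Φ t) (G t) y μ (I 1)) z ![j, p, q]) (Set.Ico 0 T) t := by
  have hM := hG.metric t ht
  have h1 : HasDerivWithinAt (fun τ => Gam (G τ) z j p q) _ (Set.Ico 0 T) t :=
    HasDerivWithinAt.fun_sum (u := Finset.univ) fun l _ =>
      (hG.hasDerivWithinAt_ginv ht hz p l).fun_mul
        (hasDerivWithinAt_dz (hG.isOpen ht) (hG.smooth l q) ht hz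
          (fun y hy => hG.hasDerivWithinAt_metric ht hy l q) j)
  refine h1.congr_deriv ?_
  -- The variation of `g⁻¹` supplies the connection term on the lower index of `g⁻¹ ∂_t g`; the one
  -- on the upper index cancels against `∂_j g⁻¹`.
  have h2 : dz j (fun y => ∑ μ, ginv (G t) y p μ * metricDot F α' (Φ t) (G t) y μ q) z = _ :=
    hM.dz_raise hz (A := fun μ y => metricDot F α' (Φ t) (G t) y μ q)
      (fun μ => hG.differentiableAt_metricDot ht hz μ q) j p
  rw [nabla_up_lo]
  simp only [Matrix.cons_val_zero, Matrix.cons_val_one]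
  have hGam : ∀ r, Gam (G t) z j r q = ∑ l, ginv (G t) z r l * dz j (fun y => G t y l q) z :=
    fun _ => rfl
  rw [h2]
  simp only [hGam _, Fin.sum_univ_three]
  ring

/-- The variation of the curvature. -/
theorem hasDerivWithinAt_Rm {z : C3} (hz : z ∈ U) (k j ρ l : Fin 3) :
    HasDerivWithinAt (fun τ => Rm (G τ) z ![k, j, ρ, l])
      (- dzbar k (fun y => nabla (G t) ![Slot.up, Slot.lo] (fun y I => ∑ μ, ginv (G t) y (I 0) μ
        * metricDot F α' (Φ t) (G t) y μ (I 1)) y ![j, ρ, l]) z) (Set.Ico 0 T) t :=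
  (hasDerivWithinAt_dzbar (hG.isOpen ht) (hG.smooth_Gam_joint ht j ρ l) ht hz
    (fun _ hy => hG.hasDerivWithinAt_Gam ht hy j ρ l) k).fun_neg

end LocalFlow

/-! ### The contribution of the factor `1/(2N)`. -/

namespace MetricVolumeOn
variable {F : C3 → ℂ} {g : MetricField} {U : Set C3} (hg : MetricVolumeOn F g U)
  {z : C3} (hz : z ∈ U)
include hg hz

theorem differentiableAt_inv_normOmega :
    DifferentiableAt ℝ (fun y => (2 * (normOmega F g y : ℂ))⁻¹) z :=
  ((hg.differentiableAt_normOmega hz).const_mul 2).fun_inv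
    (mul_ne_zero two_ne_zero (hg.normOmega_ne_zero hz))

/-- Differentiate `(2N)⁻¹ (2N) = 1` and use the logarithmic derivatives of `N`. -/
theorem dz_inv_normOmega (hbal : IsClosed22On (normOmegaSq F g) U) (a : Fin 3) :
    dz a (fun y => (2 * (normOmega F g y : ℂ))⁻¹) z
        = - ((2 * (normOmega F g z : ℂ))⁻¹ * TorTr g z a) ∧
      dzbar a (fun y => (2 * (normOmega F g y : ℂ))⁻¹) z
        = - ((2 * (normOmega F g z : ℂ))⁻¹ * TorBarTr g z a) := by
  have hN := hg.differentiableAt_normOmega hz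
  have hu := hg.differentiableAt_inv_normOmega hz
  have h0 : ∀ y ∈ U, 2 * (normOmega F g y : ℂ) ≠ 0 := fun y hy =>
    mul_ne_zero two_ne_zero (hg.normOmega_ne_zero hy)
  have e : ∀ y ∈ U, (2 * (normOmega F g y : ℂ))⁻¹ * (2 * (normOmega F g y : ℂ)) = 1 :=
    fun y hy => inv_mul_cancel₀ (h0 y hy)
  constructor
  · have h1 := dz_congr_on a hg.isOpen hz e
    rw [dz_const, dz_mul a hu (hN.const_mul 2), dz_const_mul a 2 hN,
      hg.dz_normOmega hz hbal] at h1
    refine mul_right_cancel₀ (h0 z hz) ?_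
    linear_combination h1
  · have h1 := dzbar_congr_on a hg.isOpen hz e
    rw [dzbar_const, dzbar_mul a hu (hN.const_mul 2), dzbar_const_mul a 2 hN,
      hg.dzbar_normOmega hz hbal] at h1
    refine mul_right_cancel₀ (h0 z hz) ?_
    linear_combination h1

theorem nabla_metricDot (hbal : IsClosed22On (normOmegaSq F g) U) {α' : ℝ} {Φ : TField 4}
    (hΦ : ∀ I, ContDiffOn ℝ ∞ (fun y => Φ y I) U) (j ρ l : Fin 3) :
    nabla g ![Slot.up, Slot.lo] (fun y I => ∑ μ, ginv g y (I 0) μ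
        * metricDot F α' Φ g y μ (I 1)) z ![j, ρ, l]
      = (2 * (normOmega F g z : ℂ))⁻¹ * (nabla g ![Slot.up, Slot.lo] (PsiUp α' Φ g) z ![j, ρ, l]
        - TorTr g z j * PsiUp α' Φ g z ![ρ, l]) := by
  have hP := smooth_differentiableAt hg.isOpen hz
    (hg.smooth_raise (hg.smooth_contr22 (hg.smooth_Psi α' hΦ)) ![ρ, l])
  have hP' : DifferentiableAt ℝ (fun y => PsiUp α' Φ g y ![ρ, l]) z := hP
  have h1 : ∀ y ρ l, ∑ μ, ginv g y ρ μ * metricDot F α' Φ g y μ l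
      = (2 * (normOmega F g y : ℂ))⁻¹ * PsiUp α' Φ g y ![ρ, l] := by
    intro y ρ l
    have h2 : PsiUp α' Φ g y ![ρ, l]
      = ∑ μ, ginv g y ρ μ * contr22 g (Psi α' Φ g) y ![μ, l] := rfl
    simp only [h2, metricDot, Finset.mul_sum]
    exact Finset.sum_congr rfl fun _ _ => by ring
  simp only [h1, nabla_up_lo, Matrix.cons_val_zero, Matrix.cons_val_one]
  rw [dz_mul j (hg.differentiableAt_inv_normOmega hz) hP', (hg.dz_inv_normOmega hz hbal j).1]
  simp only [Fin.sum_univ_three]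
  ring

/-- A second product rule on `(2N)⁻¹ (∇_j Ψ - T_j Ψ)`. The factor gives `-T̄_{k̄}`, and `∂_{k̄} T_j
= ½ R_{k̄j}` gives the Ricci term. -/
theorem neg_dzbar_nabla_metricDot (hbal : IsClosed22On (normOmegaSq F g) U) {α' : ℝ}
    {Φ : TField 4} (hΦ : ∀ I, ContDiffOn ℝ ∞ (fun y => Φ y I) U) (k j ρ l : Fin 3) :
    - dzbar k (fun y => nabla g ![Slot.up, Slot.lo] (fun y I => ∑ μ, ginv g y (I 0) μ
        * metricDot F α' Φ g y μ (I 1)) y ![j, ρ, l]) z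
      = (1 / (2 * (normOmega F g z : ℂ))) *
        (- dzbar k (fun y => nabla g ![Slot.up, Slot.lo] (PsiUp α' Φ g) y ![j, ρ, l]) z
          + TorBarTr g z k * nabla g ![Slot.up, Slot.lo] (PsiUp α' Φ g) z ![j, ρ, l]
          + TorTr g z j * nablaBar g ![Slot.up, Slot.lo] (PsiUp α' Φ g) z ![k, ρ, l]
          + ((1 / 2) * Ric g z ![k, j] - TorTr g z j * TorBarTr g z k)
            * PsiUp α' Φ g z ![ρ, l]) := by
  have hPs : ∀ I, ContDiffOn ℝ ∞ (fun y => PsiUp α' Φ g y I) U :=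
    hg.smooth_raise (hg.smooth_contr22 (hg.smooth_Psi α' hΦ))
  have hP := smooth_differentiableAt hg.isOpen hz (hPs ![ρ, l])
  have hD := smooth_differentiableAt hg.isOpen hz (hg.smooth_nabla_up_lo hPs j ρ l)
  have hT := smooth_differentiableAt hg.isOpen hz (hg.smooth_TorTr j)
  rw [dzbar_congr_on k hg.isOpen hz fun y hy => hg.nabla_metricDot hy hbal hΦ j ρ l,
    dzbar_mul k (hg.differentiableAt_inv_normOmega hz) (hD.fun_sub (hT.fun_mul hP)),
    dzbar_sub k hD (hT.fun_mul hP), dzbar_mul k hT hP, (hg.dz_inv_normOmega hz hbal k).2,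
    hg.dzbar_TorTr hz hbal, nablaBar_up_lo]
  ring

end MetricVolumeOn

/-! ### From the manifold to a chart. -/

section Chart
open scoped ComplexOrder
variable {X : Type*} [TopologicalSpace X] [ChartedSpace C3 X] [IsManifold 𝓘(ℂ, C3) ω X]
  {φ : OpenPartialHomeomorph X C3} (hφ : φ ∈ holCharts X) {z : C3} (hz : z ∈ φ.target)
include hφ hz

theorem mfderiv_symm_injective :
    Function.Injective (mfderiv 𝓘(ℂ, C3) 𝓘(ℂ, C3) φ.symm z) := by
  have h1 : φ ∈ IsManifold.maximalAtlas 𝓘(ℂ, C3) 1 X :=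
    IsManifold.maximalAtlas_subset_of_le le_top hφ
  have h : φ.MDifferentiable 𝓘(ℂ, C3) 𝓘(ℂ, C3) :=
    ⟨fun x hx => (mdifferentiableAt_of_mem_maximalAtlas h1 hx).mdifferentiableWithinAt,
      fun x hx => (mdifferentiableAt_symm_of_mem_maximalAtlas h1 hx).mdifferentiableWithinAt⟩
  exact h.symm.mfderiv_injective hz

theorem linearIndependent_coordVec : LinearIndependent ℂ (coordVec φ z) := by
  have h : LinearIndependent ℂ fun j : Fin 3 => EuclideanSpace.single j (1 : ℂ) := by
    refine Fintype.linearIndependent_iff.mpr fun c hc i => ?_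
    simpa [Pi.single_apply] using congrArg (fun v : C3 => v i) hc
  exact h.map' (mfderiv 𝓘(ℂ, C3) 𝓘(ℂ, C3) φ.symm z).toLinearMap
    (LinearMap.ker_eq_bot.mpr (mfderiv_symm_injective hφ hz))

/-- The coordinate vectors form a basis, and a nonzero alternating form of top degree does not
vanish on a basis. -/
theorem HolVolumeForm.comp_ne_zero (Ω : HolVolumeForm X) : Ω.comp φ z ≠ 0 := by
  have hc : Fintype.card (Fin 3) = Module.finrank ℂ (TangentSpace 𝓘(ℂ, C3) (φ.symm z)) := by
    change _ = Module.finrank ℂ C3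
    simp
  have h := (AlternatingMap.map_basis_ne_zero_iff
    (basisOfLinearIndependentOfCardEqFinrank (linearIndependent_coordVec hφ hz) hc)
    (Ω.form (φ.symm z))).mpr (Ω.ne_zero _)
  rwa [coe_basisOfLinearIndependentOfCardEqFinrank] at h

/-- The component matrix is the Gram matrix of the Hermitian form on the linearly independent
coordinate vectors; its determinant is therefore positive. -/
theorem HermitianMetric.posDef_comp (h : HermitianMetric X) : (h.comp φ z).PosDef := by
  refine Matrix.PosDef.of_dotProduct_mulVec_pos ?_ fun c hc => ?_
  · ext k j
    exact h.hermitian _ _ _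
  · have e : star c ⬝ᵥ Matrix.mulVec (h.comp φ z) c = h.form (φ.symm z)
        (∑ k, c k • coordVec φ z k) (∑ j, c j • coordVec φ z j) := by
      simp [dotProduct, Matrix.mulVec, HermitianMetric.comp, map_sum, LinearMap.sum_apply,
        Finset.mul_sum, mul_comm, mul_left_comm]
      exact Finset.sum_comm
    have hv : ∑ j, c j • coordVec φ z j ≠ 0 := fun h0 => hc <| funext <|
      Fintype.linearIndependent_iff.mp (linearIndependent_coordVec hφ hz) c h0
    rw [e, Complex.pos_iff]
    refine ⟨h.pos _ _ hv, ?_⟩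
    exact (Complex.conj_eq_iff_im.mp (h.hermitian _ _ _)).symm

omit hz in
theorem HermitianMetric.metricVolumeOn (h : HermitianMetric X) (Ω : HolVolumeForm X) :
    MetricVolumeOn (Ω.comp φ) (h.comp φ) φ.target where
  isOpen := φ.open_target
  smooth := h.smooth φ hφ
  herm _ _ _ _ := h.hermitian _ _ _
  det_ne _ hy := (h.posDef_comp hφ hy).det_pos.ne'
  det_pos _ hy := (Complex.pos_iff.mp (h.posDef_comp hφ hy).det_pos).1
  holomorphic := Ω.holomorphic φ hφ
  ne_zero _ hy := Ω.comp_ne_zero hφ hy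

omit hz in
theorem IsAnomalyFlow.localFlow {Ω : HolVolumeForm X} {α' : ℝ} {Φ : ℝ → Form22 X} {T : ℝ}
    (hΦ : ∀ t ∈ Set.Ico 0 T, (Φ t).IsClosed) {h₀ : HermitianMetric X}
    (hbal : h₀.IsConformallyBalanced Ω) {h : ℝ → HermitianMetric X}
    (hflow : IsAnomalyFlow Ω α' Φ T h₀ h) :
    LocalFlow (Ω.comp φ) α' (fun t => (Φ t).comp φ) T (fun t => (h t).comp φ) φ.target where
  metric t _ := (h t).metricVolumeOn hφ Ω
  smooth := hflow.smooth φ hφ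
  smooth_form t _ _ := (Φ t).smooth φ hφ _ _ _ _
  closed_form t ht := hΦ t ht φ hφ
  flow := hflow.flow φ hφ
  balanced := by
    simpa only [hflow.initial] using hbal φ hφ

end Chart

end AnomalyFlow

end

theorem theorem4 {X : Type*} [TopologicalSpace X] [ChartedSpace C3 X] [IsManifold 𝓘(ℂ, C3) ω X]
    (Ω : HolVolumeForm X) (α' : ℝ) (Φ : ℝ → Form22 X) (T : ℝ)
    (hΦ : ∀ t ∈ Set.Ico 0 T, (Φ t).IsClosed)
    (h₀ : HermitianMetric X) (hbal : h₀.IsConformallyBalanced Ω)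
    (h : ℝ → HermitianMetric X) (hflow : IsAnomalyFlow Ω α' Φ T h₀ h) :
    ∀ φ ∈ holCharts X, ∀ t ∈ Set.Ico 0 T, ∀ z ∈ φ.target, ∀ k j ρ l : Fin 3,
    ∀ g : MetricField, g = (h t).comp φ → ∀ Φt : TField 4, Φt = (Φ t).comp φ →
    HasDerivWithinAt (fun τ => Rm ((h τ).comp φ) z ![k, j, ρ, l])
      ((1 / (2 * (normOmega (Ω.comp φ) g z : ℂ))) *
        -- leading terms
        ((lapRm g z ![k, j, ρ, l]
          + 2 * (α' : ℂ) * ∑ μ, ∑ s, ∑ r, ginv g z ρ μ * ginv g z s r *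
              alt22 (fun μ s r l => ∑ α, ∑ β,
                Rm g z ![r, l, β, α] * ddbarRm g z ![s, μ, k, j, α, β]) μ s r l)
        -- terms with the torsion trace and `Ψ`
        + TorBarTr g z k * nabla g ![Slot.up, Slot.lo] (PsiUp α' Φt g) z ![j, ρ, l]
        + TorTr g z j * nablaBar g ![Slot.up, Slot.lo] (PsiUp α' Φt g) z ![k, ρ, l]
        + ((1 / 2) * Ric g z ![k, j] - TorTr g z j * TorBarTr g z k) * PsiUp α' Φt g z ![ρ, l]
        -- second derivatives of the torsion square and of `Φ`
        - ∑ μ, ginv g z ρ μ *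
            dbard11 g (fun y I => TT g y I + (α' : ℂ) * contr22 g Φt y I) z ![k, j, μ, l]
        -- torsion and curvature terms without `α'`
        + (nablaBar g ![Slot.lo, Slot.up, Slot.lo] (torRm g) z ![k, j, ρ, l]
          + (∑ s, ∑ γ, ginv g z s γ *
              nabla g ![Slot.loBar, Slot.loBar, Slot.lo, Slot.up, Slot.lo] (torBarRm g) z
                ![s, γ, k, j, ρ, l])
          - (∑ κ, RicPrimeUp g z ![k, κ] * Rm g z ![κ, j, ρ, l])
          + (∑ s, ∑ κ, Rm g z ![k, s, κ, j] * RmUp g z ![s, κ, ρ, l])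
          - (∑ s, ∑ κ, RmUpUp g z ![k, s, ρ, κ] * RmLowUp g z ![s, j, κ, l])
          + (∑ s, ∑ κ, Rm g z ![k, s, κ, l] * RmUp g z ![s, j, ρ, κ]))
        -- terms quadratic in the first derivatives of the curvature
        + (α' : ℂ) * (∑ μ, ∑ s, ∑ r, ginv g z ρ μ * ginv g z s r *
            alt22 (fun μ s r l => ∑ α, ∑ β,
              (dRm g z ![j, μ, s, α, β] * dbarRm g z ![k, r, l, β, α]
                + dbarRm g z ![k, μ, s, α, β] * dRm g z ![j, r, l, β, α])) μ s r l)
        -- remaining terms with `α'`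
        + 2 * (α' : ℂ) * (∑ μ, ∑ s, ∑ r, ginv g z ρ μ * ginv g z s r *
            alt22 (fun μ s r l => ∑ β, ∑ δ, RmUpUp g z ![r, l, β, δ] *
              (nablaBar g ![Slot.lo, Slot.lo, Slot.loBar, Slot.loBar, Slot.lo] (torRmLow g) z
                  ![k, s, j, μ, δ, β]
                + nabla g ![Slot.loBar, Slot.loBar, Slot.lo, Slot.loBar, Slot.lo] (torBarRmLow g) z
                  ![s, μ, k, j, δ, β]
                - (∑ κ, RmBar g z ![k, s, μ, κ] * RmLow g z ![κ, j, δ, β])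
                + (∑ κ, Rm g z ![k, s, κ, j] * RmLow g z ![μ, κ, δ, β])
                - (∑ κ, RmBar g z ![k, s, δ, κ] * RmLow g z ![μ, j, κ, β])
                + (∑ κ, Rm g z ![k, s, κ, β] * RmLow g z ![μ, j, δ, κ]))) μ s r l)))
      (Set.Ico 0 T) t := by
  intro φ hφ t ht z hz k j ρ l g hgdef Φt hΦt
  subst hgdef hΦt
  have hL := hflow.localFlow hφ hΦ hbal
  have hM := hL.metric t ht
  have hb := hL.isClosed_normOmegaSq ht
  -- The derivative is already known as `-∇_{k̄} ∇_j (g^{-1} ∂_t g)`; what remains is to expand it,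
  -- using the balanced condition at time `t`.
  refine (hL.hasDerivWithinAt_Rm ht hz k j ρ l).congr_deriv ?_
  rw [hM.neg_dzbar_nabla_metricDot hz hb (hL.smooth_form t ht),
    hM.neg_dzbar_nabla_PsiUp hz (fun y hy k j => hM.dzbar_TorTr hy hb k j) α'
      (hL.smooth_form t ht)]
  ring
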